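/- **Setting.** Let $\Omega\subset\mathbb R^2$ be a simply connected bounded Lipschitz domain with connected polygonal boundary $\partial\Omega=\Gamma_D\cup\Gamma_N$, where $\Gamma_D$ is compact, $\Gamma_N=\partial\Omega\setminus\Gamma_D$, and both have positive length. Let $\nu$ be the outer unit normal and $\mathbb S$ the symmetric real $2\times2$ matrices. For $\lambda,\mu>0$ let $\mathbb C E=2\mu E+\lambda\operatorname{tr}(E)1_{2\times2}$ on $\mathbb S$. Let $f\in L^2(\Omega;\mathbb R^2)$, $g\in L^2(\Gamma_N;\mathbb R^2)$, and let $u_D\in H^1(\Omega;\mathbb R^2)$ have a continuous trace on $\Gamma_D$. Let $u\in H^1(\Omega;\mathbb R^2)$ and $\sigma\in H(\operatorname{div},\Omega;\mathbb S)$ satisfy $$-\operatorname{div}\sigma=f,\quad \sigma=\mathbb C\varepsilon(u)\ \text{ in }\Omega,\qquad u=u_D\ \text{ on }\Gamma_D,\qquad \sigma\nu=g\ \text{ on }\Gamma_N,$$ where $\varepsilon(u)=\operatorname{sym}Du$ and the last condition means $\sigma\in\Sigma(g)$, the set of all $\tau\in H(\operatorname{div},\Omega;\mathbb S)$ with $\int_{\Gamma_N}\psi\cdot\tau\nu\,ds=\int_{\Gamma_N}\psi\cdot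 g\,ds$ for all $\psi\in H^1(\Omega;\mathbb R^2)$ that vanish on $\Gamma_D$. **Discretization.** Let $\mathcal T$ be a regular triangulation of $\Omega$ into triangles $T$ of diameter $h_T$, whose boundary edges partition $\Gamma_D$ and $\overline{\Gamma_N}$ into the Dirichlet edges $\mathcal E(\Gamma_D)$ and the Neumann edges $\mathcal E(\Gamma_N)$, and with interior edges $\mathcal E(\Omega)$; $h_E$ is the length of an edge $E$, $\nu_E$ its unit normal with a fixed orientation (outward on $\partial\Omega$), $\tau_E=(-\nu_{E,2},\nu_{E,1})$, $\partial/\partial s$ the derivative along $\tau_E$, and $[v]_E=v|_{T_+}-v|_{T_-}$ the jump across $E=\partial T_+\cap\partial T_-$ when $\nu_E$ points out of $T_+$. Assume $u_D|_E\in H^2(E;\mathbb R^2)$ for all $E\in\mathcal E(\Gamma_D)$. For $k\ge1$ let $P_k(\mathcal T;X)$ denote the piecewise polynomials of total degree at most $k$ with values in $X$ and $$AW_k(\mathcal T)=\{\tau\in P_{k+2}(\mathcal T;\mathbb S)\cap H(\operatorname{div},\Omega;\mathbb S):\operatorname{div}\tau\in P_k(\mathcal T;\mathbb R^2)\}.$$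 Let $g_h=(\tau_h\nu)|_{\Gamma_N}$ for some $\tau_h\in AW_k(\mathcal T)$, with $\int_E(g-g_h)\,ds=0$ for all $E\in\mathcal E(\Gamma_N)$. Let $\sigma_h\in\Sigma(g_h)\cap AW_k(\mathcal T)$ and $u_h\in P_k(\mathcal T;\mathbb R^2)$ satisfy $$\int_\Omega\sigma_h:\mathbb C^{-1}\tau_h\,dx+\int_\Omega u_h\cdot\operatorname{div}\tau_h\,dx=\int_{\Gamma_D}u_D\cdot(\tau_h\nu)\,ds\quad\text{for all }\tau_h\in\Sigma(0)\cap AW_k(\mathcal T),$$ $$\int_\Omega v_h\cdot\operatorname{div}\sigma_h\,dx=-\int_\Omega f\cdot v_h\,dx\quad\text{for all }v_h\in P_k(\mathcal T;\mathbb R^2).$$ **Estimator.** Let $f_h$ be the $L^2$ projection of $f$ onto $P_k(\mathcal T;\mathbb R^2)$, let $m\ge k+2$, and let $\Pi_{m,E}$ be the $L^2(E)$ projection onto polynomials of degree at most $m$ on $E$. Set $$\operatorname{osc}^2(f)=\sum_{T\in\mathcal T}h_T^2\|f-f_h\|_{L^2(T)}^2,\qquad \operatorname{osc}^2(g-g_h)=\sum_{E\in\mathcal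 E(\Gamma_N)}h_E\|g-g_h\|_{L^2(E)}^2,$$ $$\operatorname{osc}^2(u_D)=\sum_{E\in\mathcal E(\Gamma_D)}\Big(h_E\Big\|(1-\Pi_{m,E})\frac{\partial(u_D\cdot\tau_E)}{\partial s}\Big\|_{L^2(E)}^2+h_E^3\Big\|(1-\Pi_{m,E})\frac{\partial^2(u_D\cdot\nu_E)}{\partial s^2}\Big\|_{L^2(E)}^2\Big).$$ With $\operatorname{rot}\Phi=\partial_1\Phi_2-\partial_2\Phi_1$ (row-wise for matrices; applied triangle by triangle) and $\boldsymbol\varepsilon_h=\mathbb C^{-1}\sigma_h$, let $$\begin{aligned}\eta^2(\mathcal T,\sigma_h)={}&\sum_{T\in\mathcal T}h_T^4\|\operatorname{rot}\operatorname{rot}\boldsymbol\varepsilon_h\|_{L^2(T)}^2+\operatorname{osc}^2(f)+\operatorname{osc}^2(g-g_h)\\&+\sum_{E\in\mathcal E(\Omega)}\Big(h_E\|\tau_E\cdot[\boldsymbol\varepsilon_h]_E\tau_E\|_{L^2(E)}^2+h_E^3\Big\|\tau_E\cdot\Big([\operatorname{rot}\boldsymbol\varepsilon_h]_E-\frac{\partial[\boldsymbol\varepsilon_h]_E\nu_E}{\partial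 s}\Big)\Big\|_{L^2(E)}^2\Big)\\&+\sum_{E\in\mathcal E(\Gamma_D)}\Big(h_E\Big\|\tau_E\cdot\Big(\boldsymbol\varepsilon_h\tau_E-\frac{\partial u_D}{\partial s}\Big)\Big\|_{L^2(E)}^2+h_E^3\Big\|\tau_E\cdot\operatorname{rot}\boldsymbol\varepsilon_h-\nu_E\cdot\Big(\frac{\partial\boldsymbol\varepsilon_h\tau_E}{\partial s}-\frac{\partial^2u_D}{\partial s^2}\Big)\Big\|_{L^2(E)}^2\Big).\end{aligned}$$ **Theorem (efficiency).** For all $k\ge1$, $m\ge k+2$ and $\theta_0>0$ there is a constant $C>0$, depending only on $k$, $m$ and $\theta_0$, such that in the above setting, for every $\lambda,\mu>0$ and every triangulation $\mathcal T$ all of whose angles are at least $\theta_0$, $$C^{-1}\eta(\mathcal T,\sigma_h)\le\frac1{2\mu}\|\sigma-\sigma_h\|_{L^2(\Omega)}+\operatorname{osc}(f)+\operatorname{osc}(g-g_h)+\operatorname{osc}(u_D).$$ Consequently, with $C_{\rm eff}=C\max\{1,1/(2\mu)\}$, which is independent of the mesh size and of $\lambda$ (and of $\mu\ge1/2$), $$C_{\rm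 eff}^{-1}\eta(\mathcal T,\sigma_h)\le\|\sigma-\sigma_h\|_{L^2(\Omega)}+\operatorname{osc}(f)+\operatorname{osc}(g-g_h)+\operatorname{osc}(u_D).$$ -/

import Mathlib

open MeasureTheory Set Filter Topology
open scoped ContDiff

noncomputable section

namespace AW

/-- The Euclidean plane. -/
abbrev E2 : Type := EuclideanSpace ℝ (Fin 2)

/-- Real `2 × 2` matrices. -/
abbrev M2 : Type := Matrix (Fin 2) (Fin 2) ℝ

/-- Polynomials in the two cartesian coordinates. -/
abbrev Poly2 : Type := MvPolynomial (Fin 2) ℝ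

/-- Value of a polynomial at a point of the plane. -/
def pev (p : Poly2) (x : E2) : ℝ := MvPolynomial.eval (fun i => x i) p

/-! ### Isotropic elasticity -/

/-- `ℂ E = 2 μ E + λ tr(E) 1`. -/
def stiffness {R : Type*} [CommRing R] [Algebra ℝ R] (lam mu : ℝ)
    (A : Matrix (Fin 2) (Fin 2) R) : Matrix (Fin 2) (Fin 2) R :=
  (2 * mu) • A + lam • (A.trace • (1 : Matrix (Fin 2) (Fin 2) R))

/-- `ℂ⁻¹ E = (2 μ)⁻¹ (E - λ / (2 (λ + μ)) tr(E) 1)`; it applies to matrices of numbers and to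
matrices of polynomials alike. -/
def compliance {R : Type*} [CommRing R] [Algebra ℝ R] (lam mu : ℝ)
    (A : Matrix (Fin 2) (Fin 2) R) : Matrix (Fin 2) (Fin 2) R :=
  (2 * mu)⁻¹ • (A - (lam / (2 * (lam + mu))) • (A.trace • (1 : Matrix (Fin 2) (Fin 2) R)))

theorem compliance_stiffness (lam mu : ℝ) (hl : 0 < lam) (hm : 0 < mu) (A : M2) :
    compliance lam mu (stiffness lam mu A) = A := by
  have h1 : lam + mu ≠ 0 := by positivity
  ext i j
  fin_cases i <;> fin_cases j <;>
    simp [compliance, stiffness, Matrix.trace, Fin.sum_univ_two] <;> field_simp <;> ring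

theorem stiffness_compliance (lam mu : ℝ) (hl : 0 < lam) (hm : 0 < mu) (A : M2) :
    stiffness lam mu (compliance lam mu A) = A := by
  have h1 : lam + mu ≠ 0 := by positivity
  ext i j
  fin_cases i <;> fin_cases j <;>
    simp [compliance, stiffness, Matrix.trace, Fin.sum_univ_two] <;> field_simp <;> ring

/-! ### Sobolev functions and traces -/

/-- Partial derivative `∂_j φ`. -/
def partialD (j : Fin 2) (φ : E2 → ℝ) (x : E2) : ℝ :=
  fderiv ℝ φ x (EuclideanSpace.single j 1)

/-- The smooth functions with compact support in `Ω`. -/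
def IsTest (Ω : Set E2) (φ : E2 → ℝ) : Prop :=
  ContDiff ℝ ∞ φ ∧ HasCompactSupport φ ∧ tsupport φ ⊆ Ω

/-- `v ∈ H¹(Ω)` (scalar) with weak gradient `G`. -/
def IsH1 (Ω : Set E2) (v : E2 → ℝ) (G : E2 → Fin 2 → ℝ) : Prop :=
  MemLp v 2 (volume.restrict Ω) ∧
  ∀ j, MemLp (fun x => G x j) 2 (volume.restrict Ω) ∧
    ∀ φ, IsTest Ω φ → ∫ x in Ω, v x * partialD j φ x = - ∫ x in Ω, G x j * φ x

/-- The arc-length measure `ds` on a subset `S` of the plane. -/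
def arcMeasure (S : Set E2) : Measure E2 := (μH[1] : Measure E2).restrict S

/-- `v ∈ H¹(Ω)` has the trace `t ∈ L²(S)` on the part `S` of the boundary: `v` is the limit in
`H¹(Ω)` of smooth functions on the plane whose restrictions to `S` converge to `t` in `L²(S)`. -/
def HasTrace (Ω S : Set E2) (v t : E2 → ℝ) : Prop :=
  MemLp t 2 (arcMeasure S) ∧
  ∃ G : E2 → Fin 2 → ℝ, IsH1 Ω v G ∧
  ∃ w : ℕ → E2 → ℝ, (∀ n, ContDiff ℝ ∞ (w n)) ∧
    Tendsto (fun n => eLpNorm (fun x => w n x - v x) 2 (volume.restrict Ω)) atTop (𝓝 0) ∧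
    (∀ j, Tendsto (fun n => eLpNorm (fun x => partialD j (w n) x - G x j) 2
      (volume.restrict Ω)) atTop (𝓝 0)) ∧
    Tendsto (fun n => eLpNorm (fun x => w n x - t x) 2 (arcMeasure S)) atTop (𝓝 0)

/-- The (row-wise) distributional divergence of `σ` on `Ω` is `d`. -/
def IsWeakDiv (Ω : Set E2) (σ : E2 → M2) (d : E2 → E2) : Prop :=
  ∀ i, ∀ φ, IsTest Ω φ →
    ∫ x in Ω, (∑ j, σ x i j * partialD j φ x) = - ∫ x in Ω, d x i * φ x

/-- `σ ∈ H(div, Ω; 𝕊)` with `div σ = d`. -/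
def IsHdiv (Ω : Set E2) (σ : E2 → M2) (d : E2 → E2) : Prop :=
  (∀ i j, MemLp (fun x => σ x i j) 2 (volume.restrict Ω)) ∧
  (∀ᵐ x ∂(volume.restrict Ω), (σ x).IsSymm) ∧
  MemLp d 2 (volume.restrict Ω) ∧ IsWeakDiv Ω σ d

/-- The Neumann boundary. -/
def neumannBdry (Ω ΓD : Set E2) : Set E2 := frontier Ω \ ΓD

/-- The stress space `Σ(g)`: all `σ ∈ H(div, Ω; 𝕊)` with `σ ν = g` on `Γ_N`, i.e.
`∫_{Γ_N} ψ · σν ds = ∫_{Γ_N} ψ · g ds` for every `ψ ∈ H¹(Ω; ℝ²)` (with trace `t`) vanishing on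
`Γ_D`; the left side is the duality pairing `∫_Ω (σ : Dψ + ψ · div σ) dx`. -/
def MemSigma (Ω ΓD : Set E2) (g : E2 → E2) (σ : E2 → M2) : Prop :=
  ∃ d : E2 → E2, IsHdiv Ω σ d ∧
  ∀ (ψ : E2 → E2) (Dψ : E2 → M2) (t : E2 → E2),
    (∀ i, IsH1 Ω (fun x => ψ x i) (fun x => Dψ x i)) →
    (∀ i, HasTrace Ω (frontier Ω) (fun x => ψ x i) (fun x => t x i)) →
    (∀ᵐ x ∂(arcMeasure ΓD), t x = 0) →
    (∫ x in Ω, ∑ i, ∑ j, σ x i j * Dψ x i j) + (∫ x in Ω, ∑ i, ψ x i * d x i)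
      = ∫ x, (∑ i, t x i * g x i) ∂(arcMeasure (neumannBdry Ω ΓD))

/-- `(u, σ) ∈ H¹(Ω; ℝ²) × H(div, Ω; 𝕊)` solves `-div σ = f`, `σ = ℂ ε(u)` in `Ω`,
`u = u_D` on `Γ_D`, `σ ν = g` on `Γ_N`. -/
def IsSolution (Ω ΓD : Set E2) (lam mu : ℝ) (uD f g : E2 → E2) (u : E2 → E2) (σ : E2 → M2) :
    Prop :=
  (∃ Du : E2 → M2, (∀ i, IsH1 Ω (fun x => u x i) (fun x => Du x i)) ∧
    ∀ᵐ x ∂(volume.restrict Ω),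
      σ x = stiffness lam mu ((1 / 2 : ℝ) • (Du x + (Du x).transpose))) ∧
  (∀ i, HasTrace Ω ΓD (fun x => u x i) (fun x => uD x i)) ∧
  IsHdiv Ω σ (fun x => - f x) ∧
  MemSigma Ω ΓD g σ

/-! ### Domain and triangulation -/

/-- Near each boundary point, and after a rigid motion, `Ω` is the set below the graph of a
Lipschitz function. -/
def HasLipschitzBoundary (Ω : Set E2) : Prop :=
  ∀ x ∈ frontier Ω, ∃ U ∈ 𝓝 x, ∃ (L : E2 ≃ᵢ E2) (φ : ℝ → ℝ) (K : NNReal), LipschitzWith K φ ∧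
    ∀ y ∈ U, y ∈ Ω ↔ L y 1 < φ (L y 0)

/-- A simply connected bounded Lipschitz domain with connected boundary (the boundary is polygonal
as soon as there is a triangulation). -/
structure IsElasticBody (Ω : Set E2) : Prop where
  isOpen : IsOpen Ω
  isBounded : Bornology.IsBounded Ω
  simplyConnected : IsSimplyConnected Ω
  lipschitz : HasLipschitzBoundary Ω
  connected_frontier : IsConnected (frontier Ω)

/-- An oriented edge `(a, b)`, running from `a` to `b`. -/
abbrev Edge : Type := E2 × E2

/-- Edge length `h_E`. -/
def Edge.len (e : Edge) : ℝ := ‖e.2 - e.1‖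

/-- Unit tangent `τ_E`. -/
def Edge.tau (e : Edge) : E2 := (Edge.len e)⁻¹ • (e.2 - e.1)

/-- Unit normal `ν_E`, with `τ_E = (0, -1; 1, 0) ν_E`; it points to the right of `τ_E`. -/
def Edge.nu (e : Edge) : E2 := !₂[Edge.tau e 1, - Edge.tau e 0]

/-- Arc-length parametrization of `E`, for `0 ≤ s ≤ h_E`. -/
def Edge.pt (e : Edge) (s : ℝ) : E2 := e.1 + s • Edge.tau e

/-- The edge as a set. -/
def Edge.seg (e : Edge) : Set E2 := segment ℝ e.1 e.2

/-- `∫_E w ds`. -/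
def Edge.integral (e : Edge) (w : ℝ → ℝ) : ℝ := ∫ s in Ioo 0 (Edge.len e), w s

/-- The triangle with vertex set `t` has `e` as an edge and lies to the left of `e`; equivalently,
`ν_E` points outside the triangle along `e`. -/
def LiesLeft (t : Finset E2) (e : Edge) : Prop :=
  e.1 ∈ t ∧ e.2 ∈ t ∧
    ∃ c ∈ t, 0 < (e.2 - e.1) 0 * (c - e.1) 1 - (e.2 - e.1) 1 * (c - e.1) 0

/-- The closed triangle with vertex set `t`. -/
def tri (t : Finset E2) : Set E2 := convexHull ℝ (t : Set E2)

/-- Triangle diameter `h_T`. -/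
def triDiam (t : Finset E2) : ℝ := Metric.diam (tri t)

open Classical in
/-- All edges of the triangles in `𝒯`, oriented such that some triangle of `𝒯` lies to the left. -/
def orientedEdges (𝒯 : Finset (Finset E2)) : Finset Edge :=
  (𝒯.biUnion fun t => t ×ˢ t).filter fun e => ∃ t ∈ 𝒯, LiesLeft t e

open Classical in
/-- Edges with a triangle on one side only, oriented such that `ν_E` points outside the domain. -/
def boundaryEdges (𝒯 : Finset (Finset E2)) : Finset Edge :=
  (orientedEdges 𝒯).filter fun e => ¬ ∃ t ∈ 𝒯, LiesLeft t e.swap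

open Classical in
/-- Edges with a triangle on both sides, each listed with both of its orientations. -/
def interiorEdgesBoth (𝒯 : Finset (Finset E2)) : Finset Edge :=
  (orientedEdges 𝒯).filter fun e => ∃ t ∈ 𝒯, LiesLeft t e.swap

/-- Regular triangulation of `Ω` into triangles, given by their vertex sets, together with a choice
of an orientation (that is, of the unit normal `ν_E`) of each interior edge. -/
structure Mesh (Ω : Set E2) where
  /-- The triangles. -/
  T : Finset (Finset E2)
  card_eq : ∀ t ∈ T, t.card = 3
  nondegenerate : ∀ t ∈ T, AffineIndependent ℝ (fun x : t => (x : E2))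
  /-- Two triangles are disjoint or share exactly a vertex, an edge, or the whole triangle. -/
  regular : ∀ t ∈ T, ∀ t' ∈ T, tri t ∩ tri t' = convexHull ℝ ((t : Set E2) ∩ (t' : Set E2))
  cover : ⋃ t ∈ T, tri t = closure Ω
  /-- The interior edges `ℰ(Ω)`, each with its chosen orientation. -/
  interiorEdges : Finset Edge
  interiorEdges_subset : interiorEdges ⊆ interiorEdgesBoth T
  orientation : ∀ e ∈ interiorEdgesBoth T, Xor (e ∈ interiorEdges) (e.swap ∈ interiorEdges)

variable {Ω : Set E2}

open Classical in
/-- The Dirichlet edges `ℰ(Γ_D)`. -/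
def Mesh.dirichletEdges (𝒯 : Mesh Ω) (ΓD : Set E2) : Finset Edge :=
  (boundaryEdges 𝒯.T).filter fun e => Edge.seg e ⊆ ΓD

open Classical in
/-- The Neumann edges `ℰ(Γ_N)`: all the other boundary edges. -/
def Mesh.neumannEdges (𝒯 : Mesh Ω) (ΓD : Set E2) : Finset Edge :=
  (boundaryEdges 𝒯.T).filter fun e => ¬ Edge.seg e ⊆ ΓD

/-- `Γ_D` is partitioned by the Dirichlet edges: the boundary condition changes only at nodes. -/
def Mesh.Compatible (𝒯 : Mesh Ω) (ΓD : Set E2) : Prop :=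
  ΓD = ⋃ e ∈ 𝒯.dirichletEdges ΓD, Edge.seg e

/-- All angles of all triangles are at least `θ₀`. -/
def Mesh.MinAngle (𝒯 : Mesh Ω) (θ₀ : ℝ) : Prop :=
  ∀ t ∈ 𝒯.T, ∀ a ∈ t, ∀ b ∈ t, ∀ c ∈ t, a ≠ b → b ≠ c → a ≠ c →
    θ₀ ≤ EuclideanGeometry.angle a b c

open Classical in
/-- The triangle `T₊` on the left of `e`, so that `ν_E` points outside `T₊`; the triangle `T₋` is
`Mesh.left e.swap`. -/
def Mesh.left (𝒯 : Mesh Ω) (e : Edge) : Finset E2 :=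
  if h : ∃ t ∈ 𝒯.T, LiesLeft t e then h.choose else ∅

/-! ### Piecewise polynomials -/

/-- Scalar piecewise polynomials: one polynomial for each triangle. -/
abbrev PW : Type := Finset E2 → Poly2

/-- Vector-valued piecewise polynomials. -/
abbrev PWVec : Type := Finset E2 → Fin 2 → Poly2

/-- Matrix-valued piecewise polynomials. -/
abbrev PWMat : Type := Finset E2 → Matrix (Fin 2) (Fin 2) Poly2

/-- The function on `Ω` (up to the edges, a null set) given by a piecewise polynomial. -/
def Mesh.fn (𝒯 : Mesh Ω) (p : PW) (x : E2) : ℝ :=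
  ∑ t ∈ 𝒯.T, (interior (tri t)).indicator (pev (p t)) x

/-- The vector field given by a piecewise polynomial. -/
def Mesh.vecFn (𝒯 : Mesh Ω) (p : PWVec) (x : E2) : E2 :=
  WithLp.toLp 2 fun i => 𝒯.fn (fun t => p t i) x

/-- The matrix field given by a piecewise polynomial. -/
def Mesh.matFn (𝒯 : Mesh Ω) (p : PWMat) (x : E2) : M2 :=
  fun i j => 𝒯.fn (fun t => p t i j) x

/-- Row-wise divergence. -/
def pdiv (A : Matrix (Fin 2) (Fin 2) Poly2) (i : Fin 2) : Poly2 :=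
  ∑ j, MvPolynomial.pderiv j (A i j)

/-- `rot Φ = ∂₁ Φ₂ - ∂₂ Φ₁`. -/
def rot (Φ : Fin 2 → Poly2) : Poly2 := MvPolynomial.pderiv 0 (Φ 1) - MvPolynomial.pderiv 1 (Φ 0)

/-- Row-wise rotation of a matrix field. -/
def rowRot (A : Matrix (Fin 2) (Fin 2) Poly2) (i : Fin 2) : Poly2 := rot (A i)

/-- Tangential derivative `∂p/∂s = τ · ∇p` along an edge. -/
def tanDeriv (e : Edge) (p : Poly2) : Poly2 :=
  ∑ j, MvPolynomial.C (Edge.tau e j) * MvPolynomial.pderiv j p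

/-- `P_k(𝒯; ℝ²)`. -/
def Mesh.MemVh (𝒯 : Mesh Ω) (k : ℕ) (v : PWVec) : Prop :=
  ∀ t ∈ 𝒯.T, ∀ i, (v t i).totalDegree ≤ k

/-- The Arnold-Winther space `AW_k(𝒯)`. The divergence of a function in `H(div)` which is smooth
on each triangle is the piecewise divergence. -/
def Mesh.MemAW (𝒯 : Mesh Ω) (k : ℕ) (τ : PWMat) : Prop :=
  (∀ t ∈ 𝒯.T, (τ t).IsSymm ∧ (∀ i j, (τ t i j).totalDegree ≤ k + 2) ∧
    ∀ i, (pdiv (τ t) i).totalDegree ≤ k) ∧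
  IsHdiv Ω (𝒯.matFn τ) (𝒯.vecFn fun t => pdiv (τ t))

/-- The normal trace `(τ_h ν)(s)` along a boundary edge. -/
def Mesh.normalTrace (𝒯 : Mesh Ω) (τ : PWMat) (e : Edge) (s : ℝ) : E2 :=
  WithLp.toLp 2 fun i => ∑ j, pev (τ (𝒯.left e) i j) (Edge.pt e s) * Edge.nu e j

/-- `g_h ∈ G(𝒯)`, the space of normal traces of `AW_k(𝒯)` on `Γ_N`. -/
def Mesh.MemG (𝒯 : Mesh Ω) (k : ℕ) (ΓD : Set E2) (gh : E2 → E2) : Prop :=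
  ∃ τ : PWMat, 𝒯.MemAW k τ ∧ ∀ e ∈ 𝒯.neumannEdges ΓD,
    ∀ᵐ s ∂(volume.restrict (Ioo 0 (Edge.len e))), gh (Edge.pt e s) = 𝒯.normalTrace τ e s

/-- `(σ_h, u_h) ∈ Σ(g_h, 𝒯) × P_k(𝒯; ℝ²)` solves the mixed finite element equations, where
`Σ(g_h, 𝒯) = Σ(g_h) ∩ AW_k(𝒯)`. -/
def Mesh.IsDiscreteSolution (𝒯 : Mesh Ω) (k : ℕ) (ΓD : Set E2) (lam mu : ℝ)
    (uD f gh : E2 → E2) (σh : PWMat) (uh : PWVec) : Prop :=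
  𝒯.MemAW k σh ∧ MemSigma Ω ΓD gh (𝒯.matFn σh) ∧ 𝒯.MemVh k uh ∧
  (∀ τ : PWMat, 𝒯.MemAW k τ → MemSigma Ω ΓD (fun _ => 0) (𝒯.matFn τ) →
    (∫ x in Ω, ∑ i, ∑ j, 𝒯.matFn σh x i j * compliance lam mu (𝒯.matFn τ x) i j)
      + (∫ x in Ω, ∑ i, 𝒯.vecFn uh x i * 𝒯.vecFn (fun t => pdiv (τ t)) x i)
      = ∑ e ∈ 𝒯.dirichletEdges ΓD,
          Edge.integral e fun s => ∑ i, uD (Edge.pt e s) i * 𝒯.normalTrace τ e s i) ∧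
  (∀ v : PWVec, 𝒯.MemVh k v →
    ∫ x in Ω, ∑ i, 𝒯.vecFn v x i * 𝒯.vecFn (fun t => pdiv (σh t)) x i
      = - ∫ x in Ω, ∑ i, f x i * 𝒯.vecFn v x i)

/-! ### Weak derivatives along an edge and `L²` projections -/

/-- `g` is the weak derivative of `f` on the interval `(0, h)`. -/
def IsWeakDeriv (h : ℝ) (f g : ℝ → ℝ) : Prop :=
  ∀ φ : ℝ → ℝ, ContDiff ℝ ∞ φ → HasCompactSupport φ → tsupport φ ⊆ Ioo 0 h →
    ∫ s in Ioo 0 h, f s * deriv φ s = - ∫ s in Ioo 0 h, g s * φ s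

/-- `f ∈ H¹(0, h)`. -/
def MemH1Interval (h : ℝ) (f : ℝ → ℝ) : Prop :=
  MemLp f 2 (volume.restrict (Ioo 0 h)) ∧
    ∃ g, MemLp g 2 (volume.restrict (Ioo 0 h)) ∧ IsWeakDeriv h f g

open Classical in
/-- The weak derivative in `L²(0, h)` of a function in `H¹(0, h)` (unique almost everywhere). -/
def weakDeriv (h : ℝ) (f : ℝ → ℝ) : ℝ → ℝ :=
  if H : ∃ g, MemLp g 2 (volume.restrict (Ioo 0 h)) ∧ IsWeakDeriv h f g then H.choose else 0

/-- `f ∈ H²(0, h)`. -/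
def MemH2Interval (h : ℝ) (f : ℝ → ℝ) : Prop :=
  MemH1Interval h f ∧ MemH1Interval h (weakDeriv h f)

/-- The components of `∂u_D/∂s` along `E`. -/
def dsData (uD : E2 → E2) (e : Edge) (i : Fin 2) : ℝ → ℝ :=
  weakDeriv (Edge.len e) fun s => uD (Edge.pt e s) i

/-- The components of `∂²u_D/∂s²` along `E`. -/
def dssData (uD : E2 → E2) (e : Edge) (i : Fin 2) : ℝ → ℝ :=
  weakDeriv (Edge.len e) (dsData uD e i)

open Classical in
/-- The orthogonal projection in `L²(m)` of `f` onto the finite-dimensional space `S` of functions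
(unique almost everywhere). -/
def l2Proj {α : Type*} [MeasurableSpace α] (m : Measure α) (S : Set (α → ℝ)) (f : α → ℝ) : α → ℝ :=
  if H : ∃ p ∈ S, ∀ q ∈ S, ∫ x, (f x - p x) * q x ∂m = 0 then H.choose else 0

/-- The projection `Π_{m,E}` onto the polynomials of degree at most `m` in the arc length. -/
def edgeProj (m : ℕ) (e : Edge) (w : ℝ → ℝ) : ℝ → ℝ :=
  l2Proj (volume.restrict (Ioo 0 (Edge.len e)))
    {q | ∃ p : Polynomial ℝ, p.natDegree ≤ m ∧ q = fun s => p.eval s} w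

/-- The projection in `L²(T)` onto `P_k(T)`. -/
def triProj (k : ℕ) (t : Finset E2) (w : E2 → ℝ) : E2 → ℝ :=
  l2Proj (volume.restrict (tri t)) {q | ∃ p : Poly2, p.totalDegree ≤ k ∧ q = pev p} w

/-! ### Oscillations and the error estimator -/

/-- `osc²(f, 𝒯) = ∑ h_T² ‖f - f_h‖²_{L²(T)}`. -/
def Mesh.oscVolSq (𝒯 : Mesh Ω) (k : ℕ) (f : E2 → E2) : ℝ :=
  ∑ t ∈ 𝒯.T, triDiam t ^ 2 *
    ∑ i, ∫ x in tri t, (f x i - triProj k t (fun y => f y i) x) ^ 2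

/-- `osc²(g - g_h, ℰ(Γ_N)) = ∑ h_E ‖g - g_h‖²_{L²(E)}`. -/
def Mesh.oscNeuSq (𝒯 : Mesh Ω) (ΓD : Set E2) (g gh : E2 → E2) : ℝ :=
  ∑ e ∈ 𝒯.neumannEdges ΓD, Edge.len e *
    Edge.integral e fun s => ∑ i, (g (Edge.pt e s) i - gh (Edge.pt e s) i) ^ 2

/-- `∂(u_D · τ_E)/∂s` along `E`. -/
def dsTan (uD : E2 → E2) (e : Edge) (s : ℝ) : ℝ := ∑ i, Edge.tau e i * dsData uD e i s

/-- `∂²(u_D · ν_E)/∂s²` along `E`. -/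
def dssNor (uD : E2 → E2) (e : Edge) (s : ℝ) : ℝ := ∑ i, Edge.nu e i * dssData uD e i s

/-- `osc²(u_D, ℰ(Γ_D))`, the sum of `osc_I²` and `osc_II²` over the Dirichlet edges. -/
def Mesh.oscDirSq (𝒯 : Mesh Ω) (m : ℕ) (ΓD : Set E2) (uD : E2 → E2) : ℝ :=
  ∑ e ∈ 𝒯.dirichletEdges ΓD,
    (Edge.len e * (Edge.integral e fun s => (dsTan uD e s - edgeProj m e (dsTan uD e) s) ^ 2)
    + Edge.len e ^ 3 *
      (Edge.integral e fun s => (dssNor uD e s - edgeProj m e (dssNor uD e) s) ^ 2))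

/-- `τ_E · A τ_E` at the point with parameter `s`. -/
def tanTan (A : Matrix (Fin 2) (Fin 2) Poly2) (e : Edge) (s : ℝ) : ℝ :=
  ∑ i, ∑ j, Edge.tau e i * pev (A i j) (Edge.pt e s) * Edge.tau e j

/-- `τ_E · rot A`. -/
def tanRot (A : Matrix (Fin 2) (Fin 2) Poly2) (e : Edge) (s : ℝ) : ℝ :=
  ∑ i, Edge.tau e i * pev (rowRot A i) (Edge.pt e s)

/-- `a · ∂(A b)/∂s` for constant vectors `a` and `b`. -/
def dsPair (a b : E2) (A : Matrix (Fin 2) (Fin 2) Poly2) (e : Edge) (s : ℝ) : ℝ :=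
  ∑ i, ∑ j, a i * pev (tanDeriv e (A i j)) (Edge.pt e s) * b j

/-- The jump `[A]_E` of a piecewise polynomial across an interior edge. -/
def Mesh.jump (𝒯 : Mesh Ω) (A : PWMat) (e : Edge) : Matrix (Fin 2) (Fin 2) Poly2 :=
  A (𝒯.left e) - A (𝒯.left e.swap)

/-- The Green strain approximation `ε_h = ℂ⁻¹ σ_h`. -/
def strain (lam mu : ℝ) (σh : PWMat) : PWMat := fun t => compliance lam mu (σh t)

/-- The square `η²(𝒯, σ_h)` of the error estimator. -/
def Mesh.etaSq (𝒯 : Mesh Ω) (k : ℕ) (ΓD : Set E2) (lam mu : ℝ) (uD f g gh : E2 → E2)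
    (σh : PWMat) : ℝ :=
  (∑ t ∈ 𝒯.T, triDiam t ^ 4 *
      ∫ x in tri t, pev (rot (rowRot (strain lam mu σh t))) x ^ 2)
  + 𝒯.oscVolSq k f + 𝒯.oscNeuSq ΓD g gh
  + (∑ e ∈ 𝒯.interiorEdges,
      (Edge.len e * (Edge.integral e fun s => tanTan (𝒯.jump (strain lam mu σh) e) e s ^ 2)
      + Edge.len e ^ 3 * (Edge.integral e fun s =>
          (tanRot (𝒯.jump (strain lam mu σh) e) e s
            - dsPair (Edge.tau e) (Edge.nu e) (𝒯.jump (strain lam mu σh) e) e s) ^ 2)))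
  + (∑ e ∈ 𝒯.dirichletEdges ΓD,
      (Edge.len e * (Edge.integral e fun s =>
          (tanTan (strain lam mu σh (𝒯.left e)) e s - dsTan uD e s) ^ 2)
      + Edge.len e ^ 3 * (Edge.integral e fun s =>
          (tanRot (strain lam mu σh (𝒯.left e)) e s
            - (dsPair (Edge.nu e) (Edge.tau e) (strain lam mu σh (𝒯.left e)) e s
              - dssNor uD e s)) ^ 2)))

/-- The stress error `‖σ - σ_h‖_{L²(Ω)}`. -/
def Mesh.stressError (𝒯 : Mesh Ω) (σ : E2 → M2) (σh : PWMat) : ℝ :=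
  √(∫ x in Ω, ∑ i, ∑ j, (σ x i j - 𝒯.matFn σh x i j) ^ 2)

end AW

end

noncomputable section

namespace AW

/-! For a smooth `φ` with compact support in `Ω` the rotated Hessian Curl Curl `φ` is symmetric and
divergence-free, so its integral against `Du`, and hence against the strain, vanishes. The strain
error `ε(u) - ε_h` tested with Curl Curl `φ` therefore sees only `ε_h`. Two integrations by parts on
each triangle turn this into `∫ rot rot ε_h φ` plus two edge terms: the tangential-tangential
component of `ε_h` against the normal derivative of `φ`, and the flux `∂_w (v·ε_h v) - 2 ∂_v (v·ε_h
w)` against `φ`, where `v` is the tangent and `w` the inward normal. These are the residuals in the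
estimator. Cauchy-Schwarz bounds the tested error by the local strain error times the size of the
second derivatives of `φ`, and the powers of `h` in the estimator are what this scaling produces.

The functions `φ` are tensor products in edge coordinates, taken from a fixed finite family: a
smooth bump times a monomial along the edge (`bub`), and across it either another `bub`, which
vanishes near the edge, or one of the profiles `prof 0`, `prof 1`. The profiles have value and slope
`(1, 0)` and `(0, 1)` at the edge, so they isolate the flux and the tangential component
respectively. The residuals of `ε_h` are polynomials of bounded degree, and the moment matrix of the
bump is invertible (`isUnit_gram`), so finitely many moments control their norms. Neither extensions
of edge functions nor inverse inequalities enter. The minimum angle condition enters only through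
`exists_fits`: next to every edge each triangle contains a rectangle of comparable size, which
carries the test functions.

`exists_local_const` combines these facts on one triangle. On an interior edge the estimates of both
sides are added with the same `φ`, and the contributions of `Du` cancel (`exists_interior_const`).
On a Dirichlet edge `φ` does not vanish on the boundary, and Green's identity for a function with
trace `u_D` (`Fits.integral_ccPair_of_hasTrace`) yields the derivatives of `u_D`; these are not
polynomials, and their distance from polynomials is the oscillation (`exists_dirichlet_const`).

All of this concerns strains and does not involve `λ` or `μ`. The material enters only through the
fact that the compliance has norm at most `1/(2μ)` (`frob_compliance_le`), which gives robustness in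
`λ`. -/

/-! ### Orthonormal frames -/

/-- `v`, `w` is an orthonormal basis of the plane. -/
structure IsFrame (v w : E2) : Prop where
  vv : v 0 ^ 2 + v 1 ^ 2 = 1
  ww : w 0 ^ 2 + w 1 ^ 2 = 1
  vw : v 0 * w 0 + v 1 * w 1 = 0

/-- The coordinate of `x` in the direction `v`, with origin `a`. -/
def coord (a v x : E2) : ℝ := (x 0 - a 0) * v 0 + (x 1 - a 1) * v 1

/-- The point with coordinates `z` in the frame `v`, `w` with origin `a`. -/
def framePt (a v w : E2) (z : ℝ × ℝ) : E2 := a + z.1 • v + z.2 • w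

/-- A square matrix with orthonormal rows has orthonormal columns. With the determinant as a sign,
`w` is plus or minus the quarter turn of `v`. -/
theorem IsFrame.dual {v w : E2} (h : IsFrame v w) :
    v 0 ^ 2 + w 0 ^ 2 = 1 ∧ v 1 ^ 2 + w 1 ^ 2 = 1 ∧ v 0 * v 1 + w 0 * w 1 = 0 := by
  obtain ⟨h1, h2, h3⟩ := h
  have e : (v 0 * w 1 - v 1 * w 0) ^ 2 = 1 := by
    linear_combination (w 0 ^ 2 + w 1 ^ 2) * h1 + h2 - (v 0 * w 0 + v 1 * w 1) * h3
  have hw0 : w 0 = -(v 0 * w 1 - v 1 * w 0) * v 1 := by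
    linear_combination (-w 0) * h1 + v 0 * h3
  have hw1 : w 1 = (v 0 * w 1 - v 1 * w 0) * v 0 := by
    linear_combination (-w 1) * h1 + v 1 * h3
  have a0 : w 0 ^ 2 = v 1 ^ 2 := by
    rw [hw0]; linear_combination v 1 ^ 2 * e
  have a1 : w 1 ^ 2 = v 0 ^ 2 := by
    rw [hw1]; linear_combination v 0 ^ 2 * e
  refine ⟨by linarith, by linarith, ?_⟩
  have : w 0 * w 1 = - v 0 * v 1 := by
    linear_combination w 1 * hw0 - (v 0 * w 1 - v 1 * w 0) * v 1 * hw1 - v 0 * v 1 * e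
  linarith

theorem IsFrame.neg {v w : E2} (h : IsFrame v w) : IsFrame v (-w) :=
  ⟨h.vv, by simpa using h.ww, by have := h.vw; simp; linarith⟩

theorem coord_framePt_left {v w : E2} (h : IsFrame v w) (a : E2) (z : ℝ × ℝ) :
    coord a v (framePt a v w z) = z.1 := by
  simp [coord, framePt]; linear_combination z.1 * h.vv + z.2 * h.vw

theorem coord_framePt_right {v w : E2} (h : IsFrame v w) (a : E2) (z : ℝ × ℝ) :
    coord a w (framePt a v w z) = z.2 := by
  simp [coord, framePt]; linear_combination z.2 * h.ww + z.1 * h.vw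

theorem framePt_coord {v w : E2} (h : IsFrame v w) (a x : E2) :
    framePt a v w (coord a v x, coord a w x) = x := by
  obtain ⟨h1, h2, h3⟩ := h.dual
  ext i
  fin_cases i
  · simp [coord, framePt]; linear_combination (x 0 - a 0) * h1 + (x 1 - a 1) * h3
  · simp [coord, framePt]; linear_combination (x 1 - a 1) * h2 + (x 0 - a 0) * h3

theorem coord_neg (a w x : E2) : coord a (-w) x = - coord a w x := by
  simp [coord]; ring

theorem hasFDerivAt_coord (a v x : E2) :
    ∃ L : E2 →L[ℝ] ℝ, HasFDerivAt (coord a v) L x ∧ ∀ y, L y = y 0 * v 0 + y 1 * v 1 := by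
  refine ⟨(v 0) • (EuclideanSpace.proj 0 : E2 →L[ℝ] ℝ) + (v 1) • (EuclideanSpace.proj 1), ?_, ?_⟩
  · have h0 : HasFDerivAt (fun x : E2 => x 0) (EuclideanSpace.proj 0 : E2 →L[ℝ] ℝ) x :=
      (EuclideanSpace.proj (0 : Fin 2) : E2 →L[ℝ] ℝ).hasFDerivAt
    have h1 : HasFDerivAt (fun x : E2 => x 1) (EuclideanSpace.proj 1 : E2 →L[ℝ] ℝ) x :=
      (EuclideanSpace.proj (1 : Fin 2) : E2 →L[ℝ] ℝ).hasFDerivAt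
    exact ((h0.sub_const (a 0)).mul_const (v 0)).add ((h1.sub_const (a 1)).mul_const (v 1))
  · intro y; simp; ring

theorem contDiff_coord (a v : E2) : ContDiff ℝ ∞ (coord a v) := by
  unfold coord; fun_prop

theorem contDiff_framePt (a v w : E2) : ContDiff ℝ ∞ (framePt a v w) := by
  unfold framePt; fun_prop

theorem norm_framePt_sub {v w : E2} (h : IsFrame v w) (a : E2) (s n : ℝ) :
    ‖framePt a v w (s, n) - a‖ ^ 2 = s ^ 2 + n ^ 2 := by
  rw [EuclideanSpace.norm_sq_eq]
  simp [framePt, Fin.sum_univ_two]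
  linear_combination s ^ 2 * h.vv + n ^ 2 * h.ww + 2 * s * n * h.vw

/-- The map is a translation after a linear isometry, after the volume-preserving identification of
`ℝ × ℝ` with the Euclidean plane. -/
theorem measurePreserving_framePt {v w : E2} (h : IsFrame v w) (a : E2) :
    MeasurePreserving (framePt a v w) volume volume := by
  let L : E2 →ₗ[ℝ] E2 :=
    { toFun := fun y => y 0 • v + y 1 • w
      map_add' := fun x y => by ext i; simp; ring
      map_smul' := fun c x => by ext i; simp; ring }
  let I : E2 →ₗᵢ[ℝ] E2 := ⟨L, fun y => by
    have := norm_framePt_sub h 0 (y 0) (y 1)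
    rw [← sq_eq_sq₀ (norm_nonneg _) (norm_nonneg _)]
    simpa [framePt, L, EuclideanSpace.norm_sq_eq y, Fin.sum_univ_two] using this⟩
  have hI := (I.toLinearIsometryEquiv rfl).measurePreserving
  have h1 : MeasurePreserving (fun y : E2 => a + y) volume volume :=
    measurePreserving_add_left volume a
  have h2 := (EuclideanSpace.volume_preserving_symm_measurableEquiv_toLp (Fin 2)).symm
  have h3 := (volume_preserving_finTwoArrow ℝ).symm
  have := ((h1.comp hI).comp h2).comp h3
  convert this using 1
  funext z
  simp [framePt, I, L, add_assoc]

theorem measurableEmbedding_framePt {v w : E2} (h : IsFrame v w) (a : E2) :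
    MeasurableEmbedding (framePt a v w) := by
  have hc : Continuous (framePt a v w) := (contDiff_framePt a v w).continuous
  refine hc.measurableEmbedding ?_
  intro x y hxy
  have h1 := congrArg (coord a v) hxy
  have h2 := congrArg (coord a w) hxy
  rw [coord_framePt_left h, coord_framePt_left h] at h1
  rw [coord_framePt_right h, coord_framePt_right h] at h2
  exact Prod.ext h1 h2

/-! ### Integration by parts on a half plane -/

/-- The half plane to the side of `w`. -/
def halfPlane (a w : E2) : Set E2 := {x | 0 ≤ coord a w x}

theorem setIntegral_halfPlane {v w : E2} (h : IsFrame v w) (a : E2) (F : E2 → ℝ) :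
    ∫ x in halfPlane a w, F x
      = ∫ z in (univ : Set ℝ) ×ˢ Ici (0 : ℝ), F (framePt a v w z) := by
  rw [← (measurePreserving_framePt h a).setIntegral_preimage_emb
    (measurableEmbedding_framePt h a) F]
  congr 2
  ext z
  simp [halfPlane, coord_framePt_right h]

theorem hasCompactSupport_prod {α β : ℝ → ℝ} (hα : HasCompactSupport α)
    (hβ : HasCompactSupport β) (f : ℝ × ℝ → ℝ) :
    HasCompactSupport (fun z : ℝ × ℝ => f z * (α z.1 * β z.2)) := by
  refine HasCompactSupport.intro (hα.isCompact.prod hβ.isCompact) ?_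
  intro z hz
  by_cases h1 : α z.1 = 0
  · simp [h1]
  by_cases h2 : β z.2 = 0
  · simp [h2]
  exact absurd ⟨subset_tsupport _ h1, subset_tsupport _ h2⟩ hz

theorem integrable_mul_prod {f : ℝ × ℝ → ℝ} {α β : ℝ → ℝ} (hf : Continuous f)
    (hα : Continuous α) (hαc : HasCompactSupport α)
    (hβ : Continuous β) (hβc : HasCompactSupport β) :
    Integrable (fun z : ℝ × ℝ => f z * (α z.1 * β z.2)) := by
  apply Continuous.integrable_of_hasCompactSupport
  · fun_prop
  · exact hasCompactSupport_prod hαc hβc f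

theorem integral_mul_deriv_of_compact {g β : ℝ → ℝ} (hg : ContDiff ℝ ∞ g) (hβ : ContDiff ℝ ∞ β)
    (hβc : HasCompactSupport β) :
    ∫ s, g s * deriv β s = - ∫ s, deriv g s * β s := by
  have hg' : Continuous (deriv g) := hg.continuous_deriv (by simp)
  have hβ' : Continuous (deriv β) := hβ.continuous_deriv (by simp)
  refine integral_mul_deriv_eq_deriv_mul_of_integrable
    (fun x _ => (hg.differentiable (by simp) x).hasDerivAt)
    (fun x _ => (hβ.differentiable (by simp) x).hasDerivAt) ?_ ?_ ?_
  · exact (hg.continuous.mul hβ').integrable_of_hasCompactSupport hβc.deriv.mul_left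
  · exact (hg'.mul hβ.continuous).integrable_of_hasCompactSupport hβc.mul_left
  · exact (hg.continuous.mul hβ.continuous).integrable_of_hasCompactSupport hβc.mul_left

/-- The compact support of `β` removes the contribution at infinity. The one at `0` survives and
becomes the edge term in the plane. -/
theorem integral_Ici_mul_deriv {g β : ℝ → ℝ} (hg : ContDiff ℝ ∞ g) (hβ : ContDiff ℝ ∞ β)
    (hβc : HasCompactSupport β) :
    ∫ s in Ici (0 : ℝ), g s * deriv β s
      = - (∫ s in Ici (0 : ℝ), deriv g s * β s) - g 0 * β 0 := by
  have hg' : Continuous (deriv g) := hg.continuous_deriv (by simp)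
  have hβ' : Continuous (deriv β) := hβ.continuous_deriv (by simp)
  rw [integral_Ici_eq_integral_Ioi, integral_Ici_eq_integral_Ioi]
  have hc : HasCompactSupport (g * β) := hβc.mul_left
  have := integral_Ioi_mul_deriv_eq_deriv_mul (a := (0 : ℝ)) (a' := g 0 * β 0) (b' := 0)
    (fun x _ => (hg.differentiable (by simp) x).hasDerivAt)
    (fun x _ => (hβ.differentiable (by simp) x).hasDerivAt)
    ((hg.continuous.mul hβ').integrable_of_hasCompactSupport hβc.deriv.mul_left).integrableOn
    ((hg'.mul hβ.continuous).integrable_of_hasCompactSupport hβc.mul_left).integrableOn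
    ((hg.continuous.mul hβ.continuous).tendsto 0 |>.mono_left nhdsWithin_le_nhds)
    (by
      have h1 := hc.is_zero_at_infty
      exact h1.mono_left (by rw [cocompact_eq_atBot_atTop]; exact le_sup_right))
  rw [this]; ring

theorem deriv_framePt_left {f : E2 → ℝ} (hf : ContDiff ℝ ∞ f) (a v w : E2) (s n : ℝ) :
    deriv (fun s => f (framePt a v w (s, n))) s = fderiv ℝ f (framePt a v w (s, n)) v := by
  have h1 : HasDerivAt (fun s => framePt a v w (s, n)) v s := by
    have : HasDerivAt (fun s : ℝ => a + s • v + n • w) ((1 : ℝ) • v) s :=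
      (((hasDerivAt_id s).smul_const v).const_add a).add_const _
    simpa [framePt] using this
  exact ((hf.differentiable (by simp) _).hasFDerivAt.comp_hasDerivAt s h1).deriv

theorem deriv_framePt_right {f : E2 → ℝ} (hf : ContDiff ℝ ∞ f) (a v w : E2) (s n : ℝ) :
    deriv (fun n => f (framePt a v w (s, n))) n = fderiv ℝ f (framePt a v w (s, n)) w := by
  have h1 : HasDerivAt (fun n => framePt a v w (s, n)) w n := by
    have : HasDerivAt (fun n : ℝ => a + s • v + n • w) ((1 : ℝ) • w) n :=
      ((hasDerivAt_id n).smul_const w).const_add _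
    simpa [framePt] using this
  exact ((hf.differentiable (by simp) _).hasFDerivAt.comp_hasDerivAt n h1).deriv

theorem continuous_fderiv_apply {f : E2 → ℝ} (hf : ContDiff ℝ ∞ f) (v : E2) :
    Continuous (fun x => fderiv ℝ f x v) :=
  (hf.continuous_fderiv (by simp)).clm_apply continuous_const

/-- Integration by parts along the boundary of a half plane. -/
theorem halfPlane_parts_tangential {v w : E2} (h : IsFrame v w) (a : E2) {f : E2 → ℝ}
    {α β : ℝ → ℝ} (hf : ContDiff ℝ ∞ f) (hα : ContDiff ℝ ∞ α) (hαc : HasCompactSupport α)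
    (hβ : ContDiff ℝ ∞ β) (hβc : HasCompactSupport β) :
    ∫ x in halfPlane a w, f x * (deriv α (coord a v x) * β (coord a w x))
      = - ∫ x in halfPlane a w, fderiv ℝ f x v * (α (coord a v x) * β (coord a w x)) := by
  have hG := (contDiff_framePt a v w)
  have hα' : Continuous (deriv α) := hα.continuous_deriv (by simp)
  rw [setIntegral_halfPlane h, setIntegral_halfPlane h]
  simp only [coord_framePt_left h, coord_framePt_right h]
  have hsw : ∀ F : ℝ × ℝ → ℝ, Integrable F →
      ∫ z in (univ : Set ℝ) ×ˢ Ici (0 : ℝ), F z = ∫ n in Ici (0 : ℝ), ∫ s, F (s, n) := by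
    intro F hF
    rw [Measure.volume_eq_prod, setIntegral_prod _ hF.integrableOn, setIntegral_univ,
      integral_integral_swap]
    have := hF.integrableOn (s := (univ : Set ℝ) ×ˢ Ici (0 : ℝ))
    rwa [IntegrableOn, Measure.volume_eq_prod, ← Measure.prod_restrict,
      Measure.restrict_univ] at this
  rw [hsw _ (integrable_mul_prod (f := fun z => f (framePt a v w z))
      (hf.continuous.comp hG.continuous) hα' hαc.deriv hβ.continuous hβc),
    hsw _ (integrable_mul_prod (f := fun z => fderiv ℝ f (framePt a v w z) v)
      ((continuous_fderiv_apply hf v).comp hG.continuous) hα.continuous hαc hβ.continuous hβc),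
    ← integral_neg]
  congr 1
  funext n
  have := integral_mul_deriv_of_compact (g := fun s => f (framePt a v w (s, n))) (β := α)
    (hf.comp (hG.comp (by fun_prop))) hα hαc
  simp only [deriv_framePt_left hf] at this
  simp only [← mul_assoc, integral_mul_const]
  rw [this]; ring

/-- Integration by parts in the normal direction of a half plane. -/
theorem halfPlane_parts_normal {v w : E2} (h : IsFrame v w) (a : E2) {f : E2 → ℝ}
    {α β : ℝ → ℝ} (hf : ContDiff ℝ ∞ f) (hα : ContDiff ℝ ∞ α) (hαc : HasCompactSupport α)
    (hβ : ContDiff ℝ ∞ β) (hβc : HasCompactSupport β) :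
    ∫ x in halfPlane a w, f x * (α (coord a v x) * deriv β (coord a w x))
      = - (∫ x in halfPlane a w, fderiv ℝ f x w * (α (coord a v x) * β (coord a w x)))
        - β 0 * ∫ s, f (a + s • v) * α s := by
  have hG := (contDiff_framePt a v w)
  have hβ' : Continuous (deriv β) := hβ.continuous_deriv (by simp)
  rw [setIntegral_halfPlane h, setIntegral_halfPlane h]
  simp only [coord_framePt_left h, coord_framePt_right h]
  have i1 := integrable_mul_prod (f := fun z => f (framePt a v w z))
      (hf.continuous.comp hG.continuous) hα.continuous hαc hβ' hβc.deriv
  have i2 := integrable_mul_prod (f := fun z => fderiv ℝ f (framePt a v w z) w)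
      ((continuous_fderiv_apply hf w).comp hG.continuous) hα.continuous hαc hβ.continuous hβc
  rw [Measure.volume_eq_prod, setIntegral_prod _ i1.integrableOn,
    setIntegral_prod _ i2.integrableOn, setIntegral_univ, setIntegral_univ]
  have key : ∀ s, ∫ n in Ici (0 : ℝ), f (framePt a v w (s, n)) * (α s * deriv β n)
      = - (∫ n in Ici (0 : ℝ), fderiv ℝ f (framePt a v w (s, n)) w * (α s * β n))
        - β 0 * (f (a + s • v) * α s) := by
    intro s
    have := integral_Ici_mul_deriv (g := fun n => f (framePt a v w (s, n))) (β := β)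
      (hf.comp (hG.comp (by fun_prop))) hβ hβc
    simp only [deriv_framePt_right hf] at this
    have e1 : ∀ A B C : ℝ, A * (B * C) = B * (A * C) := fun A B C => by ring
    simp only [e1 _ (α s), integral_const_mul]
    rw [this]
    simp [framePt]; ring
  simp only [key]
  rw [integral_sub, integral_neg, integral_const_mul]
  · have := i2.integrableOn (s := (univ : Set ℝ) ×ˢ Ici (0 : ℝ))
    rw [IntegrableOn, Measure.volume_eq_prod, ← Measure.prod_restrict,
      Measure.restrict_univ] at this
    exact this.integral_prod_left.neg
  · apply Integrable.const_mul
    apply Continuous.integrable_of_hasCompactSupport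
    · exact (hf.continuous.comp (by fun_prop)).mul hα.continuous
    · exact hαc.mul_left

/-! ### Sets that look like a triangle on the `w` side of an edge in direction `v` -/

/-- In the frame `v`, `w` at `a`, the compact set `S` lies on the `w` side, contains a rectangle
of size comparable to `h` at the middle of the edge `[a, a + h v]`, and has size at most `R h`. -/
structure Fits (S : Set E2) (a v w : E2) (h δ R : ℝ) : Prop where
  frame : IsFrame v w
  len_pos : 0 < h
  depth_pos : 0 < δ
  depth_le : δ ≤ 1
  isCompact : IsCompact S
  subset : S ⊆ halfPlane a w
  mem : ∀ x, coord a v x ∈ Icc (3 / 8 * h) (5 / 8 * h) → coord a w x ∈ Icc 0 (δ * h) → x ∈ S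
  coord_le : ∀ x ∈ S, |coord a v x| ≤ R * h ∧ |coord a w x| ≤ R * h
  volume_le : volume.real S ≤ R * h ^ 2

/-- Smooth functions supported in the middle part of `[0, h]`. -/
structure TangTest (h : ℝ) (α : ℝ → ℝ) : Prop where
  smooth : ContDiff ℝ ∞ α
  supp : tsupport α ⊆ Icc (3 / 8 * h) (5 / 8 * h)

/-- Smooth functions supported in `[-d, d]`. -/
structure NormTest (d : ℝ) (β : ℝ → ℝ) : Prop where
  smooth : ContDiff ℝ ∞ β
  supp : tsupport β ⊆ Icc (-d) d

theorem contDiff_deriv_of_smooth {α : ℝ → ℝ} (h : ContDiff ℝ ∞ α) : ContDiff ℝ ∞ (deriv α) :=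
  (contDiff_infty_iff_deriv.1 h).2

theorem tsupport_deriv_subset_tsupport (α : ℝ → ℝ) : tsupport (deriv α) ⊆ tsupport α :=
  closure_minimal support_deriv_subset (isClosed_tsupport α)

theorem TangTest.deriv {h : ℝ} {α : ℝ → ℝ} (H : TangTest h α) : TangTest h (deriv α) :=
  ⟨contDiff_deriv_of_smooth H.smooth, (tsupport_deriv_subset_tsupport α).trans H.supp⟩

theorem NormTest.deriv {h : ℝ} {α : ℝ → ℝ} (H : NormTest h α) : NormTest h (deriv α) :=
  ⟨contDiff_deriv_of_smooth H.smooth, (tsupport_deriv_subset_tsupport α).trans H.supp⟩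

theorem TangTest.compact {h : ℝ} {α : ℝ → ℝ} (H : TangTest h α) : HasCompactSupport α :=
  isCompact_Icc.of_isClosed_subset (isClosed_tsupport α) H.supp

theorem NormTest.compact {h : ℝ} {α : ℝ → ℝ} (H : NormTest h α) : HasCompactSupport α :=
  isCompact_Icc.of_isClosed_subset (isClosed_tsupport α) H.supp

theorem TangTest.eq_zero {h : ℝ} {α : ℝ → ℝ} (H : TangTest h α) {s : ℝ}
    (hs : s ∉ Icc (3 / 8 * h) (5 / 8 * h)) : α s = 0 :=
  image_eq_zero_of_notMem_tsupport fun h' => hs (H.supp h')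

theorem NormTest.eq_zero {h : ℝ} {α : ℝ → ℝ} (H : NormTest h α) {s : ℝ}
    (hs : s ∉ Icc (-h) h) : α s = 0 :=
  image_eq_zero_of_notMem_tsupport fun h' => hs (H.supp h')

theorem TangTest.integral_eq {h : ℝ} (hh : 0 < h) {α : ℝ → ℝ} (H : TangTest h α) (g : ℝ → ℝ) :
    ∫ s, g s * α s = ∫ s in Ioo 0 h, g s * α s := by
  rw [setIntegral_eq_integral_of_forall_compl_eq_zero]
  intro s hs
  rw [H.eq_zero, mul_zero]
  intro h'
  exact hs ⟨by linarith [h'.1], by linarith [h'.2]⟩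

/-- The tensor product of `α` and `β` in the coordinates of a frame. -/
def tens (a v w : E2) (α β : ℝ → ℝ) (x : E2) : ℝ := α (coord a v x) * β (coord a w x)

theorem continuous_tens (a v w : E2) {α β : ℝ → ℝ} (hα : Continuous α) (hβ : Continuous β) :
    Continuous (tens a v w α β) :=
  (hα.comp (contDiff_coord a v).continuous).mul (hβ.comp (contDiff_coord a w).continuous)

theorem contDiff_tens (a v w : E2) {α β : ℝ → ℝ} (hα : ContDiff ℝ ∞ α) (hβ : ContDiff ℝ ∞ β) :
    ContDiff ℝ ∞ (tens a v w α β) :=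
  (hα.comp (contDiff_coord a v)).mul (hβ.comp (contDiff_coord a w))

section parts

variable {S : Set E2} {a v w : E2} {h δ R : ℝ} {α β : ℝ → ℝ}

/-- On the half plane the test function is supported in the rectangle contained in `S`. So
integration by parts over a triangle can be done over a half plane, and the other two sides
contribute nothing. -/
theorem Fits.setIntegral_eq (F : Fits S a v w h δ R) (hα : TangTest h α)
    (hβ : NormTest (δ * h) β) (g : E2 → ℝ) :
    ∫ x in S, g x * tens a v w α β x = ∫ x in halfPlane a w, g x * tens a v w α β x := by
  refine (setIntegral_eq_of_subset_of_forall_sdiff_eq_zero ?_ F.subset ?_).symm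
  · exact (isClosed_le continuous_const (contDiff_coord a w).continuous).measurableSet
  · rintro x ⟨hx, hxS⟩
    by_contra hne
    have h1 : α (coord a v x) ≠ 0 := fun h0 => hne (by simp [tens, h0])
    have h2 : β (coord a w x) ≠ 0 := fun h0 => hne (by simp [tens, h0])
    refine hxS (F.mem x ?_ ⟨hx, ?_⟩)
    · by_contra h3; exact h1 (hα.eq_zero h3)
    · by_contra h3; exact h2 (hβ.eq_zero fun h4 => h3 h4.2)

theorem Fits.parts_tangential (F : Fits S a v w h δ R) (hα : TangTest h α)
    (hβ : NormTest (δ * h) β) {f : E2 → ℝ} (hf : ContDiff ℝ ∞ f) :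
    ∫ x in S, fderiv ℝ f x v * tens a v w α β x = - ∫ x in S, f x * tens a v w (deriv α) β x := by
  rw [F.setIntegral_eq hα hβ, F.setIntegral_eq hα.deriv hβ]
  have := halfPlane_parts_tangential F.frame a hf hα.smooth hα.compact hβ.smooth hβ.compact
  simp only [tens]
  linarith

theorem Fits.parts_normal (F : Fits S a v w h δ R) (hα : TangTest h α)
    (hβ : NormTest (δ * h) β) {f : E2 → ℝ} (hf : ContDiff ℝ ∞ f) :
    ∫ x in S, fderiv ℝ f x w * tens a v w α β x
      = - (∫ x in S, f x * tens a v w α (deriv β) x)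
        - β 0 * ∫ s in Ioo 0 h, f (a + s • v) * α s := by
  rw [F.setIntegral_eq hα hβ, F.setIntegral_eq hα hβ.deriv, ← hα.integral_eq F.len_pos]
  have := halfPlane_parts_normal F.frame a hf hα.smooth hα.compact hβ.smooth hβ.compact
  simp only [tens]
  linarith

theorem Fits.integrableOn (F : Fits S a v w h δ R) {f : E2 → ℝ} (hf : Continuous f) :
    IntegrableOn f S := hf.continuousOn.integrableOn_compact F.isCompact

end parts

/-! ### Bilinear forms of matrices in a frame -/

/-- `v · M w`. -/
def quad (v w : E2) (M : M2) : ℝ := ∑ i, ∑ j, v i * M i j * w j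

/-- The product of `M` with the rotated Hessian `Curl Curl φ` of the function
`φ = α(v-coordinate) β(w-coordinate)`. -/
def ccPair (a v w : E2) (α β : ℝ → ℝ) (M : M2) (x : E2) : ℝ :=
  quad v v M * tens a v w α (deriv (deriv β)) x
    - (quad v w M + quad w v M) * tens a v w (deriv α) (deriv β) x
    + quad w w M * tens a v w (deriv (deriv α)) β x

/-- Row-wise gradient. -/
def gradM (W : Fin 2 → E2 → ℝ) (x : E2) : M2 := fun i j => partialD j (W i) x

theorem fderiv_apply_eq_partialD (f : E2 → ℝ) (x v : E2) :
    fderiv ℝ f x v = ∑ j, v j * partialD j f x := by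
  have : v = ∑ j, v j • EuclideanSpace.single j (1 : ℝ) := by
    ext i; fin_cases i <;> simp [Fin.sum_univ_two]
  conv_lhs => rw [this]
  simp [partialD]

theorem quad_gradM {W : Fin 2 → E2 → ℝ} (hW : ∀ i, ContDiff ℝ ∞ (W i)) (v w x : E2) :
    quad v w (gradM W x) = fderiv ℝ (fun y => ∑ i, v i * W i y) x w := by
  have h1 : fderiv ℝ (fun y => ∑ i, v i * W i y) x = ∑ i, v i • fderiv ℝ (W i) x := by
    rw [fderiv_fun_sum fun i _ => ((hW i).differentiable (by simp) x).const_mul _]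
    congr 1; funext i
    exact fderiv_const_mul ((hW i).differentiable (by simp) x) _
  rw [h1, Fin.sum_univ_two]
  change _ = v 0 * fderiv ℝ (W 0) x w + v 1 * fderiv ℝ (W 1) x w
  simp only [fderiv_apply_eq_partialD (W _), quad, gradM, Fin.sum_univ_two]
  ring

section identities

variable {S : Set E2} {a v w : E2} {h δ R : ℝ} {α β : ℝ → ℝ}

/-- Green's identity for the gradient of a smooth vector field. -/
theorem Fits.integral_ccPair_gradM (F : Fits S a v w h δ R) (hα : TangTest h α)
    (hβ : NormTest (δ * h) β) {W : Fin 2 → E2 → ℝ} (hW : ∀ i, ContDiff ℝ ∞ (W i)) :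
    ∫ x in S, ccPair a v w α β (gradM W x) x
      = deriv β 0 * (∫ s in Ioo 0 h, (∑ i, v i * W i (a + s • v)) * deriv α s)
        - β 0 * ∫ s in Ioo 0 h, (∑ i, w i * W i (a + s • v)) * deriv (deriv α) s := by
  have hs : ∀ y : E2, ContDiff ℝ ∞ fun x => ∑ i, y i * W i x := fun y =>
    ContDiff.sum fun i _ => contDiff_const.mul (hW i)
  have hc : ∀ (y z : E2) {γ ε : ℝ → ℝ}, TangTest h γ → NormTest (δ * h) ε →
      IntegrableOn (fun x => fderiv ℝ (fun x => ∑ i, y i * W i x) x z * tens a v w γ ε x) S :=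
    fun y z γ ε hγ hε => F.integrableOn ((continuous_fderiv_apply (hs y) z).mul
      (continuous_tens a v w hγ.smooth.continuous hε.smooth.continuous))
  simp only [ccPair, quad_gradM hW, add_mul]
  rw [integral_add, integral_sub, integral_add]
  -- One integration by parts moves the derivatives off `W`; the remaining area integrals cancel in
  -- pairs because mixed derivatives of the test function agree.
  · rw [F.parts_tangential hα hβ.deriv.deriv (hs v), F.parts_normal hα.deriv hβ.deriv (hs v),
      F.parts_tangential hα.deriv hβ.deriv (hs w), F.parts_normal hα.deriv.deriv hβ (hs w)]
    ring
  · exact hc _ _ hα.deriv hβ.deriv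
  · exact hc _ _ hα.deriv hβ.deriv
  · exact hc _ _ hα hβ.deriv.deriv
  · exact (hc _ _ hα.deriv hβ.deriv).add (hc _ _ hα.deriv hβ.deriv)
  · exact (hc _ _ hα hβ.deriv.deriv).sub
      ((hc _ _ hα.deriv hβ.deriv).add (hc _ _ hα.deriv hβ.deriv))
  · exact hc _ _ hα.deriv.deriv hβ

end identities

/-! ### Polynomials -/

/-- Directional derivative of a polynomial. -/
def dirD (v : E2) (p : Poly2) : Poly2 := ∑ j, MvPolynomial.C (v j) * MvPolynomial.pderiv j p

/-- `v · P w` for a matrix of polynomials. -/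
def pquad (v w : E2) (P : Matrix (Fin 2) (Fin 2) Poly2) : Poly2 :=
  ∑ i, ∑ j, MvPolynomial.C (v i) * P i j * MvPolynomial.C (w j)

/-- Values of a matrix of polynomials. -/
def evM (P : Matrix (Fin 2) (Fin 2) Poly2) (x : E2) : M2 := fun i j => pev (P i j) x

theorem contDiff_pev (p : Poly2) : ContDiff ℝ ∞ (pev p) := by
  induction p using MvPolynomial.induction_on with
  | C r =>
    have : pev (MvPolynomial.C r) = fun _ => r := by funext x; simp [pev]
    rw [this]; exact contDiff_const
  | add p q hp hq =>
    have : pev (p + q) = fun x => pev p x + pev q x := by funext x; simp [pev]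
    rw [this]; exact hp.add hq
  | mul_X p i hp =>
    have : pev (p * MvPolynomial.X i) = fun x => pev p x * x i := by funext x; simp [pev]
    rw [this]; exact hp.mul (by fun_prop)

theorem hasFDerivAt_pev (p : Poly2) (x : E2) :
    HasFDerivAt (pev p) (∑ j, pev (MvPolynomial.pderiv j p) x •
      (EuclideanSpace.proj j : E2 →L[ℝ] ℝ)) x := by
  induction p using MvPolynomial.induction_on with
  | C r =>
    have : pev (MvPolynomial.C r) = fun _ => r := by funext x; simp [pev]
    rw [this]
    simpa [pev] using hasFDerivAt_const r x
  | add p q hp hq =>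
    have : pev (p + q) = fun x => pev p x + pev q x := by funext x; simp [pev]
    rw [this]
    refine (hp.add hq).congr_fderiv ?_
    rw [← Finset.sum_add_distrib]
    congr 1; funext j
    simp [pev, add_smul]
  | mul_X p i hp =>
    have : pev (p * MvPolynomial.X i) = fun x => pev p x * x i := by funext x; simp [pev]
    rw [this]
    have hi : HasFDerivAt (fun x : E2 => x i) (EuclideanSpace.proj i : E2 →L[ℝ] ℝ) x :=
      (EuclideanSpace.proj i : E2 →L[ℝ] ℝ).hasFDerivAt
    refine (hp.mul hi).congr_fderiv ?_
    ext y
    fin_cases i <;> simp [pev, Fin.sum_univ_two, MvPolynomial.pderiv_X, Derivation.leibniz] <;> ring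

theorem fderiv_pev (p : Poly2) (x v : E2) : fderiv ℝ (pev p) x v = pev (dirD v p) x := by
  rw [(hasFDerivAt_pev p x).fderiv]
  simp [dirD, pev, mul_comm]

theorem quad_evM (v w x : E2) (P : Matrix (Fin 2) (Fin 2) Poly2) :
    quad v w (evM P x) = pev (pquad v w P) x := by
  simp [quad, evM, pquad, pev]

theorem pquad_comm {P : Matrix (Fin 2) (Fin 2) Poly2} (hP : P.IsSymm) (v w : E2) :
    pquad v w P = pquad w v P := by
  have : P 1 0 = P 0 1 := hP.apply 0 1
  simp only [pquad, Fin.sum_univ_two, this]; ring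

/-- Frames of both orientations occur, one for each side of an edge; `D` is the orientation sign. -/
theorem IsFrame.exists_sign {v w : E2} (h : IsFrame v w) :
    ∃ D : ℝ, D ^ 2 = 1 ∧ w 0 = - D * v 1 ∧ w 1 = D * v 0 := by
  obtain ⟨h1, h2, h3⟩ := h
  refine ⟨v 0 * w 1 - v 1 * w 0, ?_, ?_, ?_⟩
  · linear_combination (w 0 ^ 2 + w 1 ^ 2) * h1 + h2 - (v 0 * w 0 + v 1 * w 1) * h3
  · linear_combination (-w 0) * h1 + v 0 * h3
  · linear_combination (-w 1) * h1 + v 1 * h3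

/-- The commutator of two derivations is a derivation, and this one kills the generators. -/
theorem pderiv_comm (i j : Fin 2) (p : Poly2) :
    MvPolynomial.pderiv i (MvPolynomial.pderiv j p)
      = MvPolynomial.pderiv j (MvPolynomial.pderiv i p) := by
  have : ⁅(MvPolynomial.pderiv i : Derivation ℝ Poly2 Poly2),
      (MvPolynomial.pderiv j : Derivation ℝ Poly2 Poly2)⁆ = 0 := by
    refine MvPolynomial.derivation_ext fun k => ?_
    rw [Derivation.commutator_apply]
    simp only [MvPolynomial.pderiv_X, Pi.single_apply]
    split_ifs <;> simp
  have h := DFunLike.congr_fun this p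
  rw [Derivation.commutator_apply] at h
  exact sub_eq_zero.1 h

/-- `rot rot` is invariant under orthogonal transformations. -/
theorem IsFrame.rot_rowRot {v w : E2} (h : IsFrame v w) {P : Matrix (Fin 2) (Fin 2) Poly2}
    (hP : P.IsSymm) (x : E2) :
    pev (dirD w (dirD w (pquad v v P))) x - 2 * pev (dirD w (dirD v (pquad v w P))) x
      + pev (dirD v (dirD v (pquad w w P))) x = pev (rot (rowRot P)) x := by
  obtain ⟨D, hD, h0, h1⟩ := h.exists_sign
  have hc : ∀ p : Poly2, MvPolynomial.pderiv 1 (MvPolynomial.pderiv 0 p)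
      = MvPolynomial.pderiv 0 (MvPolynomial.pderiv 1 p) := fun p => pderiv_comm 1 0 p
  have hs : P 1 0 = P 0 1 := hP.apply 0 1
  -- In the frame the operator is multiplied by the squared determinant of the frame, which is 1 for
  -- either orientation.
  have hv : D ^ 2 * (v 0 ^ 2 + v 1 ^ 2) ^ 2 = 1 := by rw [hD, h.vv]; ring
  simp only [dirD, pquad, rot, rowRot, Fin.sum_univ_two, hs, map_add, map_sub, Derivation.leibniz,
    MvPolynomial.pderiv_C, hc, add_zero, zero_add, smul_eq_mul, mul_zero]
  simp only [pev, map_add, map_sub, map_mul, MvPolynomial.eval_C, h0, h1]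
  set E := MvPolynomial.eval fun i => x i
  linear_combination (E (MvPolynomial.pderiv 0 (MvPolynomial.pderiv 0 (P 1 1)))
    - 2 * E (MvPolynomial.pderiv 0 (MvPolynomial.pderiv 1 (P 0 1)))
    + E (MvPolynomial.pderiv 1 (MvPolynomial.pderiv 1 (P 0 0)))) * hv

/-! ### Green's identity for polynomials -/

section identities

variable {S : Set E2} {a v w : E2} {h δ R : ℝ} {α β : ℝ → ℝ}

/-- The boundary term of Green's identity that pairs with the values of the test function. -/
def edgeFlux (v w : E2) (P : Matrix (Fin 2) (Fin 2) Poly2) (x : E2) : ℝ :=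
  pev (dirD w (pquad v v P)) x - 2 * pev (dirD v (pquad v w P)) x

/-- Green's identity for a symmetric matrix of polynomials. -/
theorem Fits.integral_ccPair_evM (F : Fits S a v w h δ R) (hα : TangTest h α)
    (hβ : NormTest (δ * h) β) {P : Matrix (Fin 2) (Fin 2) Poly2} (hP : P.IsSymm) :
    ∫ x in S, ccPair a v w α β (evM P x) x
      = (∫ x in S, pev (rot (rowRot P)) x * tens a v w α β x)
        + β 0 * (∫ s in Ioo 0 h, edgeFlux v w P (a + s • v) * α s)
        - deriv β 0 * ∫ s in Ioo 0 h, pev (pquad v v P) (a + s • v) * α s := by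
  have hc : ∀ (p : Poly2) {γ ε : ℝ → ℝ}, TangTest h γ → NormTest (δ * h) ε →
      IntegrableOn (fun x => pev p x * tens a v w γ ε x) S :=
    fun p γ ε hγ hε => F.integrableOn ((contDiff_pev p).continuous.mul
      (continuous_tens a v w hγ.smooth.continuous hε.smooth.continuous))
  have hl : ∀ (p : Poly2) {γ : ℝ → ℝ}, TangTest h γ →
      IntegrableOn (fun s => pev p (a + s • v) * γ s) (Ioo 0 h) := fun p γ hγ =>
    (Continuous.integrableOn_Icc (((contDiff_pev p).continuous.comp (by fun_prop)).mul
      hγ.smooth.continuous)).mono_set Ioo_subset_Icc_self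
  have t := fun p {γ ε : ℝ → ℝ} (hγ : TangTest h γ) (hε : NormTest (δ * h) ε) =>
    F.parts_tangential hγ hε (contDiff_pev p)
  have n := fun p {γ ε : ℝ → ℝ} (hγ : TangTest h γ) (hε : NormTest (δ * h) ε) =>
    F.parts_normal hγ hε (contDiff_pev p)
  simp only [fderiv_pev] at t n
  have hρ : ∫ x in S, pev (rot (rowRot P)) x * tens a v w α β x
      = (∫ x in S, pev (dirD w (dirD w (pquad v v P))) x * tens a v w α β x)
        - 2 * (∫ x in S, pev (dirD w (dirD v (pquad v w P))) x * tens a v w α β x)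
        + ∫ x in S, pev (dirD v (dirD v (pquad w w P))) x * tens a v w α β x := by
    rw [← integral_const_mul, ← integral_sub, ← integral_add]
    · congr 1; funext x
      rw [← F.frame.rot_rowRot hP]; ring
    · exact (hc _ hα hβ).sub ((hc _ hα hβ).const_mul 2)
    · exact hc _ hα hβ
    · exact hc _ hα hβ
    · exact (hc _ hα hβ).const_mul 2
  have hf : ∫ s in Ioo 0 h, edgeFlux v w P (a + s • v) * α s
      = (∫ s in Ioo 0 h, pev (dirD w (pquad v v P)) (a + s • v) * α s)
        - 2 * ∫ s in Ioo 0 h, pev (dirD v (pquad v w P)) (a + s • v) * α s := by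
    rw [← integral_const_mul, ← integral_sub (hl _ hα) ((hl _ hα).const_mul 2)]
    congr 1; funext s
    rw [edgeFlux]; ring
  simp only [ccPair, quad_evM, pquad_comm hP w v, add_mul]
  rw [integral_add, integral_sub, integral_add]
  · rw [hρ, hf]
    -- Each second derivative is moved from the test function to `P` in two steps. Both boundary
    -- terms of the `vv` entry and one of the mixed entries survive; tangential steps have none.
    linarith [n (pquad v v P) hα hβ.deriv, n (dirD w (pquad v v P)) hα hβ,
      t (pquad v w P) hα hβ.deriv, n (dirD v (pquad v w P)) hα hβ,
      t (pquad w w P) hα.deriv hβ, t (dirD v (pquad w w P)) hα hβ]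
  · exact hc _ hα.deriv hβ.deriv
  · exact hc _ hα.deriv hβ.deriv
  · exact hc _ hα hβ.deriv.deriv
  · exact (hc _ hα.deriv hβ.deriv).add (hc _ hα.deriv hβ.deriv)
  · exact (hc _ hα hβ.deriv.deriv).sub
      ((hc _ hα.deriv hβ.deriv).add (hc _ hα.deriv hβ.deriv))
  · exact hc _ hα.deriv.deriv hβ

end identities

/-! ### Bubble functions -/

/-- A smooth bump in the middle of the unit interval. -/
def midBump : ContDiffBump (1 / 2 : ℝ) := ⟨1 / 16, 1 / 9, by norm_num, by norm_num⟩

/-- A smooth cut-off function near the origin. -/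
def cutoff : ContDiffBump (0 : ℝ) := ⟨1 / 4, 1 / 2, by norm_num, by norm_num⟩

/-- The bump times a monomial. -/
def bub (i : ℕ) (y : ℝ) : ℝ := midBump y * y ^ i

/-- The profiles of the edge test functions in the normal direction. -/
def prof (i : ℕ) (y : ℝ) : ℝ := cutoff y * y ^ i

theorem contDiff_bub (i : ℕ) : ContDiff ℝ ∞ (bub i) :=
  midBump.contDiff.mul (contDiff_id.pow i)

theorem contDiff_prof (i : ℕ) : ContDiff ℝ ∞ (prof i) :=
  cutoff.contDiff.mul (contDiff_id.pow i)

theorem tsupport_bub_subset_Ioo (i : ℕ) : tsupport (bub i) ⊆ Ioo (3 / 8) (5 / 8) := by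
  refine (tsupport_mul_subset_left (f := midBump) (g := fun y => y ^ i)).trans ?_
  rw [midBump.tsupport_eq, Real.closedBall_eq_Icc]
  -- The outer radius `1/9` is below `1/8`, which leaves room for an open interval around the
  -- support.
  exact Icc_subset_Ioo (by norm_num [midBump]) (by norm_num [midBump])

theorem tsupport_prof_subset_Ioo (i : ℕ) : tsupport (prof i) ⊆ Ioo (-1) 1 := by
  refine (tsupport_mul_subset_left (f := cutoff) (g := fun y => y ^ i)).trans ?_
  rw [cutoff.tsupport_eq, Real.closedBall_eq_Icc]
  exact Icc_subset_Ioo (by norm_num [cutoff]) (by norm_num [cutoff])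

theorem tsupport_bub (i : ℕ) : tsupport (bub i) ⊆ Icc (3 / 8) (5 / 8) :=
  (tsupport_bub_subset_Ioo i).trans Ioo_subset_Icc_self

theorem tsupport_prof (i : ℕ) : tsupport (prof i) ⊆ Icc (-1) 1 :=
  (tsupport_prof_subset_Ioo i).trans Ioo_subset_Icc_self

theorem tangTest_bub (i : ℕ) : TangTest 1 (bub i) :=
  ⟨contDiff_bub i, by simpa using tsupport_bub i⟩

theorem normTest_bub (i : ℕ) : NormTest 1 (bub i) :=
  ⟨contDiff_bub i, (tsupport_bub i).trans (Icc_subset_Icc (by norm_num) (by norm_num))⟩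

theorem normTest_prof (i : ℕ) : NormTest 1 (prof i) := ⟨contDiff_prof i, tsupport_prof i⟩

/-- The cut-off is 1 near the origin, so values and slopes at the edge are those of the monomials
`1` and `y`. -/
theorem prof_eventuallyEq (i : ℕ) : prof i =ᶠ[𝓝 0] fun y => y ^ i := by
  filter_upwards [cutoff.eventuallyEq_one] with y hy
  simp [prof, hy]

theorem prof_zero_zero : prof 0 0 = 1 := by simpa using (prof_eventuallyEq 0).eq_of_nhds

theorem prof_one_zero : prof 1 0 = 0 := by simpa using (prof_eventuallyEq 1).eq_of_nhds

theorem deriv_prof_zero : deriv (prof 0) 0 = 0 := by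
  rw [(prof_eventuallyEq 0).deriv_eq]; simp

theorem deriv_prof_one : deriv (prof 1) 0 = 1 := by
  rw [(prof_eventuallyEq 1).deriv_eq]; simp

theorem bub_eq_zero {i : ℕ} {y : ℝ} (hy : y ∉ Icc (3 / 8 : ℝ) (5 / 8)) : bub i y = 0 :=
  (tangTest_bub i).eq_zero (by simpa using hy)

/-- Bounds for a function and its first two derivatives. -/
def BoundedBy (B : ℝ) (f : ℝ → ℝ) : Prop :=
  ∀ y, |f y| ≤ B ∧ |deriv f y| ≤ B ∧ |deriv (deriv f) y| ≤ B

theorem BoundedBy.mono {B B' : ℝ} {f : ℝ → ℝ} (h : BoundedBy B f) (hB : B ≤ B') :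
    BoundedBy B' f := fun y => ⟨(h y).1.trans hB, (h y).2.1.trans hB, (h y).2.2.trans hB⟩

theorem exists_boundedBy {f : ℝ → ℝ} (hf : ContDiff ℝ ∞ f) (hc : HasCompactSupport f) :
    ∃ B, 0 ≤ B ∧ BoundedBy B f := by
  have h1 := contDiff_deriv_of_smooth hf
  have h2 := contDiff_deriv_of_smooth h1
  obtain ⟨B0, h0⟩ := hf.continuous.bounded_above_of_compact_support hc
  obtain ⟨B1, h1⟩ := h1.continuous.bounded_above_of_compact_support hc.deriv
  obtain ⟨B2, h2⟩ := h2.continuous.bounded_above_of_compact_support hc.deriv.deriv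
  refine ⟨max B0 (max B1 B2), ?_, fun y => ⟨?_, ?_, ?_⟩⟩
  · exact le_max_of_le_left ((norm_nonneg _).trans (h0 0))
  · exact le_max_of_le_left (h0 y)
  · exact le_max_of_le_right (le_max_of_le_left (h1 y))
  · exact le_max_of_le_right (le_max_of_le_right (h2 y))

/-- A common bound for all bubbles of degree at most `N` and for the normal profiles. -/
theorem exists_bubble_bound (N : ℕ) :
    ∃ B, 0 ≤ B ∧ (∀ i ≤ N, BoundedBy B (bub i)) ∧ ∀ i ≤ 1, BoundedBy B (prof i) := by
  choose B hB0 hB using fun i => exists_boundedBy (contDiff_bub i) (tangTest_bub i).compact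
  choose D hD0 hD using fun i => exists_boundedBy (contDiff_prof i) (normTest_prof i).compact
  refine ⟨∑ i ∈ Finset.range (N + 1), B i + ∑ i ∈ Finset.range 2, D i, ?_, ?_, ?_⟩
  · exact add_nonneg (Finset.sum_nonneg fun i _ => hB0 i) (Finset.sum_nonneg fun i _ => hD0 i)
  · intro i hi
    refine (hB i).mono ?_
    have := Finset.single_le_sum (f := B) (fun i _ => hB0 i)
      (Finset.mem_range.2 (Nat.lt_succ_of_le hi))
    linarith [Finset.sum_nonneg fun i (_ : i ∈ Finset.range 2) => hD0 i]
  · intro i hi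
    refine (hD i).mono ?_
    have := Finset.single_le_sum (f := D) (fun i _ => hD0 i)
      (Finset.mem_range.2 (Nat.lt_succ_of_le hi))
    linarith [Finset.sum_nonneg fun i (_ : i ∈ Finset.range (N + 1)) => hB0 i]

/-! ### Scaling -/

/-- The function `f` on the scale `h`. -/
def rescale (h : ℝ) (f : ℝ → ℝ) (s : ℝ) : ℝ := f (s * h⁻¹)

theorem deriv_rescale (h : ℝ) (f : ℝ → ℝ) :
    deriv (rescale h f) = fun s => h⁻¹ * rescale h (deriv f) s := by
  funext s
  have : rescale h f = fun s => f (h⁻¹ * s) := by funext s; rw [rescale, mul_comm]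
  rw [this, deriv_comp_mul_left, rescale, mul_comm s, smul_eq_mul]

theorem deriv_deriv_rescale (h : ℝ) (f : ℝ → ℝ) :
    deriv (deriv (rescale h f)) = fun s => h⁻¹ ^ 2 * rescale h (deriv (deriv f)) s := by
  rw [deriv_rescale]
  funext s
  rw [deriv_const_mul_field, deriv_rescale]; ring

theorem contDiff_rescale (h : ℝ) {f : ℝ → ℝ} (hf : ContDiff ℝ ∞ f) :
    ContDiff ℝ ∞ (rescale h f) := hf.comp (contDiff_id.mul contDiff_const)

theorem tsupport_rescale_subset_preimage (h : ℝ) (f : ℝ → ℝ) :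
    tsupport (rescale h f) ⊆ (fun s => s * h⁻¹) ⁻¹' tsupport f :=
  tsupport_comp_subset_preimage f (by fun_prop)

theorem tsupport_rescale_subset {h l u : ℝ} (hh : 0 < h) {f : ℝ → ℝ} (hf : tsupport f ⊆ Icc l u) :
    tsupport (rescale h f) ⊆ Icc (l * h) (u * h) := by
  intro s hs
  have : s * h⁻¹ ∈ Icc l u := hf (tsupport_rescale_subset_preimage h f hs)
  rw [mem_Icc, ← div_eq_mul_inv, le_div_iff₀ hh, div_le_iff₀ hh] at this
  exact this

theorem tsupport_rescale_subset_Ioo {h l u : ℝ} (hh : 0 < h) {f : ℝ → ℝ}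
    (hf : tsupport f ⊆ Ioo l u) : tsupport (rescale h f) ⊆ Ioo (l * h) (u * h) := by
  intro s hs
  have : s * h⁻¹ ∈ Ioo l u := hf (tsupport_rescale_subset_preimage h f hs)
  rw [mem_Ioo, ← div_eq_mul_inv, lt_div_iff₀ hh, div_lt_iff₀ hh] at this
  exact this

theorem TangTest.rescale {h : ℝ} (hh : 0 < h) {f : ℝ → ℝ} (hf : TangTest 1 f) :
    TangTest h (rescale h f) :=
  ⟨contDiff_rescale h hf.smooth, tsupport_rescale_subset hh (by simpa using hf.supp)⟩

theorem NormTest.rescale {d : ℝ} (hd : 0 < d) {f : ℝ → ℝ} (hf : NormTest 1 f) :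
    NormTest d (rescale d f) :=
  ⟨contDiff_rescale d hf.smooth, by simpa using tsupport_rescale_subset hd hf.supp⟩

/-! ### Moments determine polynomials -/

/-- The moment matrix of the bump. -/
def gram (N : ℕ) : Matrix (Fin (N + 1)) (Fin (N + 1)) ℝ :=
  fun i j => ∫ y, y ^ (j : ℕ) * bub i y

theorem integrable_mul_bub {g : ℝ → ℝ} (hg : Continuous g) (i : ℕ) :
    Integrable fun y => g y * bub i y :=
  (hg.mul (contDiff_bub i).continuous).integrable_of_hasCompactSupport
    (tangTest_bub i).compact.mul_left

theorem gram_mulVec (N : ℕ) (c : Fin (N + 1) → ℝ) (i : Fin (N + 1)) :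
    (gram N).mulVec c i = ∫ y, (∑ j, c j * y ^ (j : ℕ)) * bub i y := by
  simp only [Matrix.mulVec, dotProduct, gram, Finset.sum_mul]
  rw [integral_finsetSum]
  · refine Finset.sum_congr rfl fun j _ => ?_
    rw [← integral_mul_const]
    congr 1; funext y; ring
  · intro j _
    exact integrable_mul_bub (by fun_prop) i

/-- This is the Gram matrix of the monomials for the weight `midBump`. A vector in its kernel gives
a polynomial `q` with `∫ midBump q² = 0`, so `q` vanishes where the bump is positive and hence
identically. -/
theorem isUnit_gram (N : ℕ) : IsUnit (gram N) := by
  rw [← Matrix.mulVec_injective_iff_isUnit, ← Matrix.coe_mulVecLin, injective_iff_map_eq_zero]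
  intro c hc
  have hc' : ∀ i, (gram N).mulVec c i = 0 := fun i => congrFun hc i
  set q : Polynomial ℝ := ∑ j : Fin (N + 1), Polynomial.C (c j) * Polynomial.X ^ (j : ℕ) with hq
  have hqe : ∀ y, q.eval y = ∑ j, c j * y ^ (j : ℕ) := fun y => by
    simp [hq, Polynomial.eval_finsetSum]
  have h0 : ∫ y, midBump y * q.eval y ^ 2 = 0 := by
    have : (fun y => midBump y * q.eval y ^ 2)
        = fun y => ∑ i, c i * ((∑ j, c j * y ^ (j : ℕ)) * bub i y) := by
      funext y
      rw [pow_two, ← hqe y]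
      nth_rewrite 1 [hqe y]
      rw [Finset.sum_mul, Finset.mul_sum]
      refine Finset.sum_congr rfl fun i _ => ?_
      simp only [bub]; ring
    rw [this, integral_finsetSum]
    · refine Finset.sum_eq_zero fun i _ => ?_
      rw [integral_const_mul, ← gram_mulVec, hc', mul_zero]
    · intro i _
      exact (integrable_mul_bub (by fun_prop) i).const_mul _
  have hcont : Continuous fun y => midBump y * q.eval y ^ 2 :=
    midBump.continuous.mul (q.continuous.pow 2)
  have hnn : 0 ≤ fun y => midBump y * q.eval y ^ 2 := fun y =>
    mul_nonneg midBump.nonneg (sq_nonneg _)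
  have hz : (fun y => midBump y * q.eval y ^ 2) = 0 := by
    by_contra hne
    obtain ⟨y, hy⟩ := Function.ne_iff.1 hne
    have := hcont.integral_pos_of_hasCompactSupport_nonneg_nonzero (x := y)
      (μ := volume) midBump.hasCompactSupport.mul_right hnn hy
    exact this.ne' h0
  have hinf : q = 0 := by
    refine Polynomial.eq_zero_of_infinite_isRoot q ?_
    refine (Ioo_infinite (show (1 / 2 - 1 / 16 : ℝ) < 1 / 2 + 1 / 16 by norm_num)).mono ?_
    intro y hy
    have h1 : midBump y = 1 := midBump.one_of_mem_closedBall (by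
      rw [Real.closedBall_eq_Icc]; exact Ioo_subset_Icc_self hy)
    have := congrFun hz y
    simpa [h1] using this
  funext j
  have := congrArg (fun p => Polynomial.coeff p j) hinf
  simpa [hq, Polynomial.finsetSum_coeff, Polynomial.coeff_C_mul, Polynomial.coeff_X_pow,
    Fin.val_inj] using this

/-- Coefficients are bounded by moments. -/
theorem exists_moment_const (N : ℕ) : ∃ C, 0 < C ∧ ∀ (c : Fin (N + 1) → ℝ) (Y : ℝ),
    (∀ i, |(gram N).mulVec c i| ≤ Y) → ∀ i, |c i| ≤ C * Y := by
  refine ⟨∑ i, ∑ j, |(gram N)⁻¹ i j| + 1, by positivity, fun c Y h i => ?_⟩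
  have hY : 0 ≤ Y := (abs_nonneg _).trans (h i)
  have h1 : (gram N)⁻¹.mulVec ((gram N).mulVec c) = c := by
    rw [Matrix.mulVec_mulVec, Matrix.nonsing_inv_mul _
      ((Matrix.isUnit_iff_isUnit_det _).1 (isUnit_gram N)), Matrix.one_mulVec]
  rw [← h1]
  calc |∑ j, (gram N)⁻¹ i j * (gram N).mulVec c j|
      ≤ ∑ j, |(gram N)⁻¹ i j| * Y := by
        refine (Finset.abs_sum_le_sum_abs _ _).trans (Finset.sum_le_sum fun j _ => ?_)
        rw [abs_mul]
        exact mul_le_mul_of_nonneg_left (h j) (abs_nonneg _)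
    _ = (∑ j, |(gram N)⁻¹ i j|) * Y := by rw [Finset.sum_mul]
    _ ≤ _ := by
        refine mul_le_mul_of_nonneg_right ?_ hY
        have := Finset.single_le_sum (f := fun i => ∑ j, |(gram N)⁻¹ i j|)
          (fun i _ => Finset.sum_nonneg fun j _ => abs_nonneg _) (Finset.mem_univ i)
        linarith

/-- A polynomial on `(0, h)` is bounded in `L²` by its moments against bubbles. -/
theorem exists_edge_moment_const (N : ℕ) : ∃ C, 0 < C ∧ ∀ (h X : ℝ) (q : Polynomial ℝ), 0 < h →
    q.natDegree ≤ N →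
    (∀ i ≤ N, |∫ s in Ioo 0 h, q.eval s * rescale h (bub i) s| ≤ X) →
    h * ∫ s in Ioo 0 h, q.eval s ^ 2 ≤ C * X ^ 2 := by
  obtain ⟨C, hC, hm⟩ := exists_moment_const N
  refine ⟨((N + 1) * C) ^ 2, by positivity, fun h X q hh hq hX => ?_⟩
  -- Coefficients in the variable `s / h`; the moments on `(0, h)` are then `h` times those of the
  -- fixed bump.
  set c : Fin (N + 1) → ℝ := fun j => q.coeff j * h ^ (j : ℕ) with hc
  have hX0 : 0 ≤ X := (abs_nonneg _).trans (hX 0 (Nat.zero_le _))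
  have hqe : ∀ s, q.eval s = ∑ j, c j * (s * h⁻¹) ^ (j : ℕ) := fun s => by
    rw [Polynomial.eval_eq_sum_range' (Nat.lt_succ_of_le hq), Finset.sum_range]
    refine Finset.sum_congr rfl fun j _ => ?_
    simp only [hc, mul_pow, inv_pow]
    field_simp
  have hmom : ∀ i : Fin (N + 1), ∫ s in Ioo 0 h, q.eval s * rescale h (bub i) s
      = h * (gram N).mulVec c i := fun i => by
    rw [← ((tangTest_bub i).rescale hh).integral_eq hh, gram_mulVec]
    simp only [hqe, rescale]
    have := Measure.integral_comp_mul_right (fun y => (∑ j, c j * y ^ (j : ℕ)) * bub i y) h⁻¹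
    rw [this, inv_inv, abs_of_pos hh, smul_eq_mul]
  have hci : ∀ i, |c i| ≤ C * (X / h) := by
    refine hm c _ fun i => ?_
    have := hX i (Nat.lt_succ_iff.1 i.2)
    rw [hmom, abs_mul, abs_of_pos hh] at this
    rwa [le_div_iff₀ hh, mul_comm]
  have hsup : ∀ s ∈ Ioo 0 h, q.eval s ^ 2 ≤ ((N + 1) * (C * (X / h))) ^ 2 := fun s hs => by
    rw [← sq_abs]
    refine pow_le_pow_left₀ (abs_nonneg _) ?_ 2
    rw [hqe]
    refine (Finset.abs_sum_le_sum_abs _ _).trans ?_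
    refine (Finset.sum_le_card_nsmul _ _ (C * (X / h)) fun j _ => ?_).trans (by simp)
    rw [abs_mul, abs_pow]
    have h1 : |s * h⁻¹| ≤ 1 := by
      rw [abs_of_nonneg (by have := hs.1; positivity), ← div_eq_mul_inv, div_le_one hh]
      exact hs.2.le
    calc |c j| * |s * h⁻¹| ^ (j : ℕ) ≤ |c j| * 1 :=
          mul_le_mul_of_nonneg_left (pow_le_one₀ (abs_nonneg _) h1) (abs_nonneg _)
      _ ≤ _ := by rw [mul_one]; exact hci j
  have hInt : ∫ s in Ioo 0 h, q.eval s ^ 2 ≤ h * ((N + 1) * (C * (X / h))) ^ 2 := by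
    have h1 : IntegrableOn (fun s => q.eval s ^ 2) (Ioo 0 h) :=
      ((q.continuous.pow 2).integrableOn_Icc).mono_set Ioo_subset_Icc_self
    have := setIntegral_mono_on h1 (integrableOn_const (by simp)) measurableSet_Ioo hsup
    refine this.trans ?_
    simp [hh.le]
  calc h * ∫ s in Ioo 0 h, q.eval s ^ 2 ≤ h * (h * ((N + 1) * (C * (X / h))) ^ 2) :=
        mul_le_mul_of_nonneg_left hInt hh.le
    _ = _ := by field_simp

/-! ### Polynomials of two variables in the coordinates of a frame -/

/-- An affine substitution does not raise the degree; this allows passing to frame coordinates. -/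
theorem totalDegree_aeval_le {p : Poly2} {N : ℕ} (hp : p.totalDegree ≤ N) (y : Fin 2 → Poly2)
    (hy : ∀ i, (y i).totalDegree ≤ 1) : (MvPolynomial.aeval y p).totalDegree ≤ N := by
  rw [MvPolynomial.aeval_def, MvPolynomial.eval₂_eq']
  refine MvPolynomial.totalDegree_finsetSum_le fun d hd => ?_
  have h1 := (MvPolynomial.le_totalDegree hd).trans hp
  rw [Finsupp.sum_fintype _ _ (fun _ => rfl), Fin.sum_univ_two] at h1
  refine (MvPolynomial.totalDegree_mul _ _).trans ?_
  rw [MvPolynomial.algebraMap_eq, MvPolynomial.totalDegree_C, zero_add, Fin.prod_univ_two]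
  refine (MvPolynomial.totalDegree_mul _ _).trans ?_
  have h2 : ∀ i, (y i ^ d i).totalDegree ≤ d i := fun i =>
    (MvPolynomial.totalDegree_pow _ _).trans ((Nat.mul_le_mul_left _ (hy i)).trans (by simp))
  exact (add_le_add (h2 0) (h2 1)).trans h1

/-- Listing the coefficients in a full square array, padded by zeros, is what lets the one-variable
moment bound act on each index separately. -/
theorem exists_eval_eq_sum {p : Poly2} {N : ℕ} (hp : p.totalDegree ≤ N) :
    ∃ c : Fin (N + 1) → Fin (N + 1) → ℝ, ∀ z : Fin 2 → ℝ,
      MvPolynomial.eval z p = ∑ i, ∑ j, c i j * (z 0 ^ (i : ℕ) * z 1 ^ (j : ℕ)) := by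
  classical
  refine ⟨fun i j => ∑ d ∈ p.support, if d 0 = i ∧ d 1 = j then p.coeff d else 0, fun z => ?_⟩
  simp only [Finset.sum_mul]
  rw [MvPolynomial.eval_eq']
  have : ∀ i : Fin (N + 1), ∑ j : Fin (N + 1), ∑ d ∈ p.support,
      (if d 0 = i ∧ d 1 = j then p.coeff d else 0) * (z 0 ^ (i : ℕ) * z 1 ^ (j : ℕ))
      = ∑ d ∈ p.support, ∑ j : Fin (N + 1),
      (if d 0 = i ∧ d 1 = j then p.coeff d else 0) * (z 0 ^ (i : ℕ) * z 1 ^ (j : ℕ)) :=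
    fun i => Finset.sum_comm
  simp only [this]
  rw [Finset.sum_comm]
  refine Finset.sum_congr rfl fun d hd => ?_
  have h1 := (MvPolynomial.le_totalDegree hd).trans hp
  rw [Finsupp.sum_fintype _ _ (fun _ => rfl), Fin.sum_univ_two] at h1
  rw [Finset.sum_eq_single (⟨d 0, by omega⟩ : Fin (N + 1)),
    Finset.sum_eq_single (⟨d 1, by omega⟩ : Fin (N + 1))]
  · simp [Fin.prod_univ_two]
  · intro j _ hj
    have : ¬ (d 1 = (j : ℕ)) := fun h => hj (Fin.ext h.symm)
    simp [this]
  · simp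
  · intro i _ hi
    have : ¬ (d 0 = (i : ℕ)) := fun h => hi (Fin.ext h.symm)
    simp [this]
  · simp

theorem IsFrame.exists_coeff {v w : E2} (h : IsFrame v w) (a : E2) {r₁ r₂ : ℝ} (h₁ : r₁ ≠ 0)
    (h₂ : r₂ ≠ 0) {p : Poly2} {N : ℕ} (hp : p.totalDegree ≤ N) :
    ∃ c : Fin (N + 1) → Fin (N + 1) → ℝ, ∀ x, pev p x = ∑ i, ∑ j,
      c i j * ((coord a v x * r₁⁻¹) ^ (i : ℕ) * (coord a w x * r₂⁻¹) ^ (j : ℕ)) := by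
  set y : Fin 2 → Poly2 := fun i => MvPolynomial.C (a i) +
    MvPolynomial.C (r₁ * v i) * MvPolynomial.X 0 + MvPolynomial.C (r₂ * w i) * MvPolynomial.X 1
    with hy
  have hd : ∀ (r : ℝ) (j : Fin 2),
      (MvPolynomial.C r * MvPolynomial.X j : Poly2).totalDegree ≤ 1 := fun r j =>
    (MvPolynomial.totalDegree_mul _ _).trans (by simp)
  have hyd : ∀ i, (y i).totalDegree ≤ 1 := fun i =>
    (MvPolynomial.totalDegree_add _ _).trans (max_le
      ((MvPolynomial.totalDegree_add _ _).trans (max_le (by simp) (hd _ _))) (hd _ _))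
  obtain ⟨c, hc⟩ := exists_eval_eq_sum (totalDegree_aeval_le hp y hyd)
  refine ⟨c, fun x => ?_⟩
  have h3 := hc ![coord a v x * r₁⁻¹, coord a w x * r₂⁻¹]
  simp only [Matrix.cons_val_zero, Matrix.cons_val_one] at h3
  rw [← h3, pev]
  have h4 : ∀ z : Fin 2 → ℝ, MvPolynomial.eval z (MvPolynomial.aeval y p)
      = MvPolynomial.eval (fun i => MvPolynomial.eval z (y i)) p := fun z => by
    rw [MvPolynomial.aeval_def, MvPolynomial.algebraMap_eq, MvPolynomial.eval₂_eq',
      MvPolynomial.eval_eq' (fun i => MvPolynomial.eval z (y i))]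
    simp
  rw [h4]
  congr 2
  funext i
  conv_lhs => rw [← framePt_coord h a x]
  simp [hy, framePt]
  field_simp

theorem integral_comp_framePt {v w : E2} (h : IsFrame v w) (a : E2) (F : E2 → ℝ) :
    ∫ x, F x = ∫ z, F (framePt a v w z) :=
  ((measurePreserving_framePt h a).integral_comp (measurableEmbedding_framePt h a) F).symm

theorem integral_rescale {h : ℝ} (hh : 0 < h) (f : ℝ → ℝ) :
    ∫ s, f (s * h⁻¹) = h * ∫ y, f y := by
  rw [Measure.integral_comp_mul_right f h⁻¹, inv_inv, abs_of_pos hh, smul_eq_mul]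

section planar

variable {S : Set E2} {a v w : E2} {h δ R : ℝ}

/-- The moments of a polynomial against tensor products of bubbles. -/
theorem Fits.integral_mul_tens_bub (F : Fits S a v w h δ R) {N : ℕ} {p : Poly2}
    {c : Fin (N + 1) → Fin (N + 1) → ℝ}
    (hc : ∀ x, pev p x = ∑ i, ∑ j,
      c i j * ((coord a v x * h⁻¹) ^ (i : ℕ) * (coord a w x * (δ * h)⁻¹) ^ (j : ℕ)))
    (k l : Fin (N + 1)) :
    ∫ x in S, pev p x * tens a v w (rescale h (bub k)) (rescale (δ * h) (bub l)) x
      = h * (δ * h) * (gram N).mulVec (fun i => (gram N).mulVec (c i) l) k := by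
  have hh := F.len_pos
  have hd : 0 < δ * h := mul_pos F.depth_pos hh
  rw [F.setIntegral_eq ((tangTest_bub k).rescale hh) ((normTest_bub l).rescale hd),
    -- Since `bub l` vanishes on the negative axis, the half plane may be replaced by the whole
    -- plane, where the integral factors.
    setIntegral_eq_integral_of_forall_compl_eq_zero, integral_comp_framePt F.frame a]
  · simp only [hc, tens, coord_framePt_left F.frame, coord_framePt_right F.frame, Finset.sum_mul]
    have hInt : ∀ i j : Fin (N + 1), Integrable fun z : ℝ × ℝ =>
        c i j * ((z.1 * h⁻¹) ^ (i : ℕ) * (z.2 * (δ * h)⁻¹) ^ (j : ℕ))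
          * (rescale h (bub k) z.1 * rescale (δ * h) (bub l) z.2) := fun i j =>
      integrable_mul_prod (by fun_prop) ((tangTest_bub k).rescale hh).smooth.continuous
        ((tangTest_bub k).rescale hh).compact ((normTest_bub l).rescale hd).smooth.continuous
        ((normTest_bub l).rescale hd).compact
    rw [integral_finsetSum _ fun i _ => integrable_finsetSum _ fun j _ => hInt i j]
    simp only [integral_finsetSum _ fun j _ => hInt _ j]
    simp only [Matrix.mulVec, dotProduct, Finset.mul_sum]
    refine Finset.sum_congr rfl fun i _ => Finset.sum_congr rfl fun j _ => ?_
    have := integral_prod_mul (μ := (volume : Measure ℝ)) (ν := (volume : Measure ℝ))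
      (fun s => (s * h⁻¹) ^ (i : ℕ) * rescale h (bub k) s)
      (fun n => (n * (δ * h)⁻¹) ^ (j : ℕ) * rescale (δ * h) (bub l) n)
    rw [← Measure.volume_eq_prod] at this
    have e1 := integral_rescale hh fun y => y ^ (i : ℕ) * bub k y
    have e2 := integral_rescale hd fun y => y ^ (j : ℕ) * bub l y
    rw [show ∫ s, (s * h⁻¹) ^ (i : ℕ) * rescale h (bub k) s = _ from e1,
      show ∫ s, (s * (δ * h)⁻¹) ^ (j : ℕ) * rescale (δ * h) (bub l) s = _ from e2] at this
    rw [show (fun z : ℝ × ℝ => c i j * ((z.1 * h⁻¹) ^ (i : ℕ) * (z.2 * (δ * h)⁻¹) ^ (j : ℕ))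
          * (rescale h (bub k) z.1 * rescale (δ * h) (bub l) z.2))
        = fun z => c i j * (((z.1 * h⁻¹) ^ (i : ℕ) * rescale h (bub k) z.1) *
          ((z.2 * (δ * h)⁻¹) ^ (j : ℕ) * rescale (δ * h) (bub l) z.2)) from by funext z; ring,
      integral_const_mul, this]
    simp only [gram]; ring
  · intro x hx
    have hx' : coord a w x < 0 := not_le.1 hx
    have : rescale (δ * h) (bub l) (coord a w x) = 0 := by
      refine bub_eq_zero fun h' => ?_
      have := mul_neg_of_neg_of_pos hx' (inv_pos.2 hd)
      linarith [h'.1]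
    rw [tens, this]; ring

end planar

/-- A polynomial on a set of bounded shape is bounded in `L²` by its moments. -/
theorem exists_volume_moment_const (N : ℕ) (δ R : ℝ) : ∃ C, 0 < C ∧
    ∀ (S : Set E2) (a v w : E2) (h X : ℝ) (p : Poly2), Fits S a v w h δ R → p.totalDegree ≤ N →
    (∀ i ≤ N, ∀ j ≤ N,
      |∫ x in S, pev p x * tens a v w (rescale h (bub i)) (rescale (δ * h) (bub j)) x| ≤ X) →
    h ^ 2 * ∫ x in S, pev p x ^ 2 ≤ C * X ^ 2 := by
  obtain ⟨C, hC, hm⟩ := exists_moment_const N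
  -- Bounds the rescaled coordinates on all of `S`, not only on the rectangle where the moments are
  -- taken. The normal coordinate is scaled by `δ h`, hence the quotient.
  set K : ℝ := max 1 (R / δ) with hK
  refine ⟨|R| * ((N + 1) ^ 2 * (K ^ N * K ^ N * (C * (C * δ⁻¹)))) ^ 2 + 1, by positivity,
    fun S a v w h X p F hp hX => ?_⟩
  have hh := F.len_pos
  have hδ := F.depth_pos
  have hd : 0 < δ * h := mul_pos hδ hh
  have hX0 : 0 ≤ X := (abs_nonneg _).trans (hX 0 (Nat.zero_le _) 0 (Nat.zero_le _))
  have hK1 : 1 ≤ K := le_max_left _ _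
  obtain ⟨c, hc⟩ := F.frame.exists_coeff a hh.ne' hd.ne' hp
  have hci : ∀ i j, |c i j| ≤ C * (C * (X / (h * (δ * h)))) := by
    intro i
    -- The tensor Gram matrix is inverted one index at a time.
    refine hm (c i) _ fun l => ?_
    refine hm (fun i => (gram N).mulVec (c i) l) _ (fun k => ?_) i
    have := hX k (Nat.lt_succ_iff.1 k.2) l (Nat.lt_succ_iff.1 l.2)
    rw [F.integral_mul_tens_bub hc, abs_mul, abs_of_pos (mul_pos hh hd)] at this
    rwa [le_div_iff₀ (mul_pos hh hd), mul_comm]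
  set Z := (N + 1) ^ 2 * (K ^ N * K ^ N * (C * (C * (X / (h * (δ * h)))))) with hZ
  have hZ0 : 0 ≤ Z := by positivity
  have hsup : ∀ x ∈ S, pev p x ^ 2 ≤ Z ^ 2 := fun x hx => by
    rw [← sq_abs]
    refine pow_le_pow_left₀ (abs_nonneg _) ?_ 2
    obtain ⟨hx1, hx2⟩ := F.coord_le x hx
    have k1 : |coord a v x * h⁻¹| ≤ K := by
      rw [abs_mul, abs_of_pos (inv_pos.2 hh), ← div_eq_mul_inv, div_le_iff₀ hh]
      have hR : 0 ≤ R := by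
        have := (abs_nonneg _).trans hx1
        exact nonneg_of_mul_nonneg_left this hh
      refine hx1.trans (mul_le_mul_of_nonneg_right ?_ hh.le)
      refine le_max_of_le_right ?_
      rw [le_div_iff₀ hδ]
      exact mul_le_of_le_one_right hR F.depth_le
    have k2 : |coord a w x * (δ * h)⁻¹| ≤ K := by
      rw [abs_mul, abs_of_pos (inv_pos.2 hd), ← div_eq_mul_inv, div_le_iff₀ hd]
      calc |coord a w x| ≤ R * h := hx2
        _ = R / δ * (δ * h) := by field_simp
        _ ≤ K * (δ * h) := mul_le_mul_of_nonneg_right (le_max_right _ _) hd.le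
    have kp : ∀ (t : ℝ) (i : Fin (N + 1)), |t| ≤ K → |t| ^ (i : ℕ) ≤ K ^ N := fun t i ht =>
      (pow_le_pow_left₀ (abs_nonneg _) ht _).trans
        (pow_le_pow_right₀ hK1 (Nat.lt_succ_iff.1 i.2))
    rw [hc]
    have hterm : ∀ i j : Fin (N + 1),
        |c i j * ((coord a v x * h⁻¹) ^ (i : ℕ) * (coord a w x * (δ * h)⁻¹) ^ (j : ℕ))|
          ≤ K ^ N * K ^ N * (C * (C * (X / (h * (δ * h))))) := fun i j => by
      rw [abs_mul, abs_mul, abs_pow, abs_pow, mul_comm]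
      exact mul_le_mul (mul_le_mul (kp _ i k1) (kp _ j k2) (by positivity) (by positivity))
        (hci i j) (abs_nonneg _) (by positivity)
    refine (Finset.abs_sum_le_sum_abs _ _).trans ?_
    refine (Finset.sum_le_sum fun i _ => (Finset.abs_sum_le_sum_abs _ _).trans
      (Finset.sum_le_sum fun j _ => hterm i j)).trans ?_
    simp only [Finset.sum_const, Finset.card_univ, Fintype.card_fin, nsmul_eq_mul, hZ]
    push_cast
    apply le_of_eq; ring
  have hInt : ∫ x in S, pev p x ^ 2 ≤ volume.real S * Z ^ 2 := by
    have := setIntegral_mono_on (F.integrableOn ((contDiff_pev p).continuous.pow 2))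
      (integrableOn_const (μ := volume) (C := Z ^ 2) F.isCompact.measure_lt_top.ne)
      F.isCompact.measurableSet hsup
    refine this.trans ?_
    simp
  have hR := F.volume_le
  calc h ^ 2 * ∫ x in S, pev p x ^ 2 ≤ h ^ 2 * (|R| * h ^ 2 * Z ^ 2) := by
        refine mul_le_mul_of_nonneg_left (hInt.trans ?_) (by positivity)
        refine mul_le_mul_of_nonneg_right (hR.trans ?_) (by positivity)
        exact mul_le_mul_of_nonneg_right (le_abs_self R) (by positivity)
    _ = |R| * ((N + 1) ^ 2 * (K ^ N * K ^ N * (C * (C * δ⁻¹)))) ^ 2 * X ^ 2 := by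
        rw [hZ]; field_simp
    _ ≤ _ := mul_le_mul_of_nonneg_right (by linarith) (by positivity)

/-! ### Estimates of the residual on one triangle -/

/-- Cauchy-Schwarz, from the discriminant of the nonnegative quadratic `t ↦ ∫ (t f + g)²`. -/
theorem sq_integral_mul_le {X : Type*} [MeasurableSpace X] {m : Measure X} {f g : X → ℝ}
    (hf : MemLp f 2 m) (hg : MemLp g 2 m) :
    (∫ x, f x * g x ∂m) ^ 2 ≤ (∫ x, f x ^ 2 ∂m) * ∫ x, g x ^ 2 ∂m := by
  set A := ∫ x, f x ^ 2 ∂m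
  set B := ∫ x, f x * g x ∂m
  set C := ∫ x, g x ^ 2 ∂m
  have hq : ∀ t : ℝ, 0 ≤ A * (t * t) + (2 * B) * t + C := fun t => by
    have e : A * (t * t) + (2 * B) * t + C = ∫ x, (t * f x + g x) ^ 2 ∂m := by
      have : (fun x => (t * f x + g x) ^ 2)
          = fun x => (t * t * f x ^ 2 + 2 * t * (f x * g x)) + g x ^ 2 := by funext x; ring
      have hfg : Integrable (fun x => f x * g x) m := hf.integrable_mul hg
      have i1 : Integrable (fun x => t * t * f x ^ 2) m := hf.integrable_sq.const_mul _
      have i2 : Integrable (fun x => 2 * t * (f x * g x)) m := hfg.const_mul _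
      have i3 : Integrable (fun x => t * t * f x ^ 2 + 2 * t * (f x * g x)) m := i1.add i2
      rw [this, integral_add i3 hg.integrable_sq, integral_add i1 i2,
        integral_const_mul, integral_const_mul]
      ring
    rw [e]
    exact integral_nonneg fun x => sq_nonneg _
  have := discrim_le_zero hq
  rw [discrim] at this
  nlinarith

/-- Squared Frobenius norm. -/
def frob (M : M2) : ℝ := ∑ i, ∑ j, M i j ^ 2

theorem frob_nonneg (M : M2) : 0 ≤ frob M :=
  Finset.sum_nonneg fun _ _ => Finset.sum_nonneg fun _ _ => sq_nonneg _

/-- Symmetric part. -/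
def symPart (M : M2) : M2 := (1 / 2 : ℝ) • (M + M.transpose)

theorem sq_quad_le {v w : E2} (hv : v 0 ^ 2 + v 1 ^ 2 = 1) (hw : w 0 ^ 2 + w 1 ^ 2 = 1) (M : M2) :
    quad v w M ^ 2 ≤ frob M := by
  have h := Finset.sum_mul_sq_le_sq_mul_sq Finset.univ
    (fun p : Fin 2 × Fin 2 => v p.1 * w p.2) (fun p => M p.1 p.2)
  rw [Fintype.sum_prod_type, Fintype.sum_prod_type, Fintype.sum_prod_type] at h
  simp only [Fin.sum_univ_two] at h
  simp only [quad, frob, Fin.sum_univ_two]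
  have h1 : (v 0 * w 0) ^ 2 + (v 0 * w 1) ^ 2 + ((v 1 * w 0) ^ 2 + (v 1 * w 1) ^ 2) = 1 := by
    linear_combination (w 0 ^ 2 + w 1 ^ 2) * hv + hw
  rw [h1, one_mul] at h
  refine le_trans (le_of_eq ?_) h
  ring

theorem abs_quad_le {v w : E2} (hv : v 0 ^ 2 + v 1 ^ 2 = 1) (hw : w 0 ^ 2 + w 1 ^ 2 = 1) (M : M2) :
    |quad v w M| ≤ √(frob M) := Real.abs_le_sqrt (sq_quad_le hv hw M)

section pointwise

variable {a v w : E2} {h δ B : ℝ} {f g : ℝ → ℝ}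

theorem abs_tens_rescale_le (hB : 0 ≤ B) (hf : ∀ y, |f y| ≤ B) (hg : ∀ y, |g y| ≤ B) (x : E2)
    (r₁ r₂ : ℝ) : |tens a v w (rescale r₁ f) (rescale r₂ g) x| ≤ B ^ 2 := by
  rw [tens, abs_mul, pow_two]
  exact mul_le_mul (hf _) (hg _) (abs_nonneg _) hB

/-- Because `δ ≤ 1`, tangential derivatives cost no more than the factor `(δ h)⁻¹` of normal ones.
So every second derivative is at most `B² (δ h)⁻²`, and four entries of `M` contribute. -/
theorem abs_ccPair_le (hfr : IsFrame v w) (hh : 0 < h) (hδ : 0 < δ) (hδ1 : δ ≤ 1) (hB : 0 ≤ B)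
    (hf : BoundedBy B f) (hg : BoundedBy B g) (M : M2) (x : E2) :
    |ccPair a v w (rescale h f) (rescale (δ * h) g) M x|
      ≤ 4 * B ^ 2 * (δ * h)⁻¹ ^ 2 * √(frob M) := by
  set r := (δ * h)⁻¹ with hr
  have hr0 : 0 ≤ r := by positivity
  have hhr : h⁻¹ ≤ r := by
    rw [hr]; exact inv_anti₀ (by positivity) (by nlinarith)
  have hh0 : 0 ≤ h⁻¹ := by positivity
  have e1 : tens a v w (rescale h f) (deriv (deriv (rescale (δ * h) g))) x
      = r ^ 2 * tens a v w (rescale h f) (rescale (δ * h) (deriv (deriv g))) x := by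
    simp only [tens, deriv_deriv_rescale]; ring
  have e2 : tens a v w (deriv (rescale h f)) (deriv (rescale (δ * h) g)) x
      = h⁻¹ * r * tens a v w (rescale h (deriv f)) (rescale (δ * h) (deriv g)) x := by
    simp only [tens, deriv_rescale]; ring
  have e3 : tens a v w (deriv (deriv (rescale h f))) (rescale (δ * h) g) x
      = h⁻¹ ^ 2 * tens a v w (rescale h (deriv (deriv f))) (rescale (δ * h) g) x := by
    simp only [tens, deriv_deriv_rescale]; ring
  have b1 : |tens a v w (rescale h f) (deriv (deriv (rescale (δ * h) g))) x| ≤ r ^ 2 * B ^ 2 := by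
    rw [e1, abs_mul, abs_of_nonneg (by positivity)]
    exact mul_le_mul_of_nonneg_left (abs_tens_rescale_le hB (fun y => (hf y).1)
      (fun y => (hg y).2.2) x _ _) (by positivity)
  have b2 : |tens a v w (deriv (rescale h f)) (deriv (rescale (δ * h) g)) x| ≤ r ^ 2 * B ^ 2 := by
    rw [e2, abs_mul, abs_of_nonneg (by positivity)]
    refine mul_le_mul ?_ (abs_tens_rescale_le hB (fun y => (hf y).2.1)
      (fun y => (hg y).2.1) x _ _) (abs_nonneg _) (by positivity)
    rw [pow_two]; exact mul_le_mul_of_nonneg_right hhr hr0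
  have b3 : |tens a v w (deriv (deriv (rescale h f))) (rescale (δ * h) g) x| ≤ r ^ 2 * B ^ 2 := by
    rw [e3, abs_mul, abs_of_nonneg (by positivity)]
    exact mul_le_mul (pow_le_pow_left₀ hh0 hhr 2) (abs_tens_rescale_le hB (fun y => (hf y).2.2)
      (fun y => (hg y).1) x _ _) (abs_nonneg _) (by positivity)
  have q1 := abs_quad_le hfr.vv hfr.vv M
  have q2 := abs_quad_le hfr.vv hfr.ww M
  have q3 := abs_quad_le hfr.ww hfr.vv M
  have q4 := abs_quad_le hfr.ww hfr.ww M
  have hs := Real.sqrt_nonneg (frob M)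
  have m1 := mul_le_mul q1 b1 (abs_nonneg _) hs
  have m2 := mul_le_mul ((abs_add_le _ _).trans (add_le_add q2 q3)) b2 (abs_nonneg _)
    (add_nonneg hs hs)
  have m3 := mul_le_mul q4 b3 (abs_nonneg _) hs
  rw [← abs_mul] at m1 m2 m3
  rw [ccPair]
  refine (abs_add_le _ _).trans ((add_le_add_left (abs_sub _ _) _).trans ?_)
  linarith

end pointwise

theorem quad_symPart_add (v w : E2) (M : M2) :
    quad v w (symPart M) + quad w v (symPart M) = quad v w M + quad w v M := by
  simp [quad, symPart, Fin.sum_univ_two]; ring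

/-- Curl Curl `φ` is symmetric. This is the point where the full gradient may be exchanged for the
strain. -/
theorem ccPair_symPart (a v w : E2) (α β : ℝ → ℝ) (M : M2) (x : E2) :
    ccPair a v w α β (symPart M) x = ccPair a v w α β M x := by
  have h1 := quad_symPart_add v v M
  have h2 := quad_symPart_add w w M
  rw [ccPair, ccPair, quad_symPart_add, show quad v v (symPart M) = quad v v M by linarith,
    show quad w w (symPart M) = quad w w M by linarith]

theorem quad_sub (v w : E2) (M M' : M2) : quad v w (M - M') = quad v w M - quad v w M' := by
  simp [quad, Fin.sum_univ_two]; ring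

theorem ccPair_sub (a v w : E2) (α β : ℝ → ℝ) (M M' : M2) (x : E2) :
    ccPair a v w α β (M - M') x = ccPair a v w α β M x - ccPair a v w α β M' x := by
  simp only [ccPair, quad_sub]; ring

/-- The squared distance in `L²(S)` of the symmetric part of `G` from `P`. -/
def strainError (S : Set E2) (G : E2 → M2) (P : Matrix (Fin 2) (Fin 2) Poly2) : ℝ :=
  ∫ x in S, frob (symPart (G x) - evM P x)

theorem strainError_nonneg (S : Set E2) (G : E2 → M2) (P : Matrix (Fin 2) (Fin 2) Poly2) :
    0 ≤ strainError S G P := integral_nonneg fun _ => frob_nonneg _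

section residual

variable {S : Set E2} {a v w : E2} {h δ R : ℝ}

theorem Fits.memLp (F : Fits S a v w h δ R) {f : E2 → ℝ} (hf : Continuous f) :
    MemLp f 2 (volume.restrict S) := by
  obtain ⟨C, hC⟩ := F.isCompact.exists_bound_of_continuousOn hf.continuousOn
  have : IsFiniteMeasure (volume.restrict S) := ⟨by simpa using F.isCompact.measure_lt_top⟩
  exact MemLp.of_bound hf.aestronglyMeasurable C
    ((ae_restrict_iff' F.isCompact.measurableSet).2 (Eventually.of_forall hC))

theorem memLp_quad {m : Measure E2} {G : E2 → M2} (hG : ∀ i j, MemLp (fun x => G x i j) 2 m)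
    (v w : E2) : MemLp (fun x => quad v w (G x)) 2 m := by
  simp only [quad]
  refine memLp_finsetSum _ fun i _ => memLp_finsetSum _ fun j _ => ?_
  have : (fun x => v i * G x i j * w j) = fun x => (v i * w j) * G x i j := by funext x; ring
  rw [this]
  exact (hG i j).const_mul _

theorem Fits.integrable_ccPair (F : Fits S a v w h δ R) {α β : ℝ → ℝ} (hα : ContDiff ℝ ∞ α)
    (hβ : ContDiff ℝ ∞ β) {G : E2 → M2} (hG : ∀ i j, MemLp (fun x => G x i j) 2 (volume.restrict S)) :
    IntegrableOn (fun x => ccPair a v w α β (G x) x) S := by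
  have hα1 := contDiff_deriv_of_smooth hα
  have hα2 := contDiff_deriv_of_smooth hα1
  have hβ1 := contDiff_deriv_of_smooth hβ
  have hβ2 := contDiff_deriv_of_smooth hβ1
  refine Integrable.add (Integrable.sub ?_ ?_) ?_
  · exact (memLp_quad hG v v).integrable_mul
      (F.memLp (continuous_tens a v w hα.continuous hβ2.continuous))
  · exact ((memLp_quad hG v w).add (memLp_quad hG w v)).integrable_mul
      (F.memLp (continuous_tens a v w hα1.continuous hβ1.continuous))
  · exact (memLp_quad hG w w).integrable_mul
      (F.memLp (continuous_tens a v w hα2.continuous hβ.continuous))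

theorem integrable_frob {m : Measure E2} {G : E2 → M2}
    (hG : ∀ i j, MemLp (fun x => G x i j) 2 m) : Integrable (fun x => frob (G x)) m :=
  integrable_finsetSum _ fun i _ => integrable_finsetSum _ fun j _ => (hG i j).integrable_sq

theorem memLp_symPart {m : Measure E2} {G : E2 → M2}
    (hG : ∀ i j, MemLp (fun x => G x i j) 2 m) (i j : Fin 2) :
    MemLp (fun x => symPart (G x) i j) 2 m := by
  have : (fun x => symPart (G x) i j) = fun x => (1 / 2 : ℝ) * (G x i j + G x j i) := by
    funext x; simp [symPart]
  rw [this]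
  exact ((hG i j).add (hG j i)).const_mul _

theorem continuous_evM (P : Matrix (Fin 2) (Fin 2) Poly2) (i j : Fin 2) :
    Continuous fun x => evM P x i j := (contDiff_pev _).continuous

/-- Cauchy-Schwarz against the constant 1; the area bound of `S` supplies `R h²`. -/
theorem Fits.sq_integral_le (F : Fits S a v w h δ R) {f g : E2 → ℝ} {K : ℝ}
    (hf : ∀ x, |f x| ≤ K * √(g x)) (hg0 : ∀ x, 0 ≤ g x) (hg : IntegrableOn g S) :
    (∫ x in S, f x) ^ 2 ≤ K ^ 2 * (R * h ^ 2) * ∫ x in S, g x := by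
  have hsm : MemLp (fun x => √(g x)) 2 (volume.restrict S) := by
    rw [memLp_two_iff_integrable_sq_norm]
    · have : (fun x => ‖√(g x)‖ ^ 2) = g := by
        funext x; rw [Real.norm_eq_abs, sq_abs, Real.sq_sqrt (hg0 x)]
      rw [this]; exact hg
    · exact Real.continuous_sqrt.comp_aestronglyMeasurable hg.aestronglyMeasurable
  have h1m : MemLp (fun _ : E2 => (1 : ℝ)) 2 (volume.restrict S) := F.memLp continuous_const
  have hcs := sq_integral_mul_le h1m hsm
  have hsi : IntegrableOn (fun x => √(g x)) S := by
    have : IsFiniteMeasure (volume.restrict S) := ⟨by simpa using F.isCompact.measure_lt_top⟩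
    exact hsm.integrable (by norm_num)
  have h2 : |∫ x in S, f x| ≤ K * ∫ x in S, √(g x) := by
    rw [← integral_const_mul]
    exact norm_integral_le_of_norm_le (f := f) (hsi.const_mul K) (Eventually.of_forall hf)
  simp only [one_mul, one_pow, Real.sq_sqrt (hg0 _), integral_const, smul_eq_mul, mul_one] at hcs
  have hI : 0 ≤ ∫ x in S, g x := integral_nonneg hg0
  calc (∫ x in S, f x) ^ 2 = |∫ x in S, f x| ^ 2 := (sq_abs _).symm
    _ ≤ (K * ∫ x in S, √(g x)) ^ 2 := pow_le_pow_left₀ (abs_nonneg _) h2 2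
    _ = K ^ 2 * (∫ x in S, √(g x)) ^ 2 := by ring
    _ ≤ K ^ 2 * ((volume.restrict S).real univ * ∫ x in S, g x) :=
        mul_le_mul_of_nonneg_left hcs (sq_nonneg _)
    _ ≤ K ^ 2 * ((R * h ^ 2) * ∫ x in S, g x) := by
        refine mul_le_mul_of_nonneg_left (mul_le_mul_of_nonneg_right ?_ hI) (sq_nonneg _)
        simpa [Measure.real] using F.volume_le
    _ = _ := by ring

theorem Fits.nonneg (F : Fits S a v w h δ R) : 0 ≤ R :=
  nonneg_of_mul_nonneg_left (measureReal_nonneg.trans F.volume_le) (pow_pos F.len_pos 2)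

/-- The residual of `G - P` against a rescaled test function. -/
theorem Fits.sq_integral_ccPair_le (F : Fits S a v w h δ R) {B : ℝ} {f g : ℝ → ℝ} (hB : 0 ≤ B)
    (hf : BoundedBy B f) (hg : BoundedBy B g) {G : E2 → M2}
    (hG : ∀ i j, MemLp (fun x => G x i j) 2 (volume.restrict S))
    (P : Matrix (Fin 2) (Fin 2) Poly2) :
    h ^ 2 * (∫ x in S, ccPair a v w (rescale h f) (rescale (δ * h) g)
        (symPart (G x) - evM P x) x) ^ 2 ≤ 16 * B ^ 4 * δ⁻¹ ^ 4 * R * strainError S G P := by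
  have hh := F.len_pos
  have hδ := F.depth_pos
  have := F.sq_integral_le (f := fun x => ccPair a v w (rescale h f) (rescale (δ * h) g)
      (symPart (G x) - evM P x) x) (g := fun x => frob (symPart (G x) - evM P x))
    (fun x => abs_ccPair_le F.frame hh hδ F.depth_le hB hf hg _ x) (fun x => frob_nonneg _)
    (integrable_frob fun i j => (memLp_symPart hG i j).sub (F.memLp (continuous_evM P i j)))
  refine (mul_le_mul_of_nonneg_left this (sq_nonneg h)).trans (le_of_eq ?_)
  rw [strainError]
  field_simp
  ring

theorem Fits.sq_integral_tens_le (F : Fits S a v w h δ R) {B : ℝ} {f g : ℝ → ℝ} (hB : 0 ≤ B)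
    (hf : BoundedBy B f) (hg : BoundedBy B g) (p : Poly2) :
    (∫ x in S, pev p x * tens a v w (rescale h f) (rescale (δ * h) g) x) ^ 2
      ≤ B ^ 4 * R * h ^ 2 * ∫ x in S, pev p x ^ 2 := by
  have := F.sq_integral_le (K := B ^ 2) (g := fun x => pev p x ^ 2)
    (f := fun x => pev p x * tens a v w (rescale h f) (rescale (δ * h) g) x) (fun x => ?_)
    (fun x => sq_nonneg _) (F.integrableOn ((contDiff_pev p).continuous.pow 2))
  · refine this.trans (le_of_eq ?_); ring
  · rw [abs_mul, Real.sqrt_sq_eq_abs, mul_comm]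
    exact mul_le_mul_of_nonneg_right (abs_tens_rescale_le hB (fun y => (hf y).1)
      (fun y => (hg y).1) x _ _) (abs_nonneg _)

theorem Fits.integral_ccPair_sub (F : Fits S a v w h δ R) {α β : ℝ → ℝ} (hα : ContDiff ℝ ∞ α)
    (hβ : ContDiff ℝ ∞ β) {G : E2 → M2}
    (hG : ∀ i j, MemLp (fun x => G x i j) 2 (volume.restrict S))
    (P : Matrix (Fin 2) (Fin 2) Poly2) :
    ∫ x in S, ccPair a v w α β (symPart (G x) - evM P x) x
      = (∫ x in S, ccPair a v w α β (G x) x) - ∫ x in S, ccPair a v w α β (evM P x) x := by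
  simp only [ccPair_sub, ccPair_symPart]
  exact integral_sub (F.integrable_ccPair hα hβ hG)
    (F.integrable_ccPair hα hβ fun i j => F.memLp (continuous_evM P i j))

end residual

/-- With `bub` as normal factor the value and the normal derivative on the edge vanish, so Green's
identity retains only the volume residual. -/
theorem bub_eventuallyEq_zero (i : ℕ) : bub i =ᶠ[𝓝 0] fun _ => 0 := by
  filter_upwards [Iio_mem_nhds (show (0 : ℝ) < 3 / 8 by norm_num)] with y hy
  exact bub_eq_zero fun h => absurd h.1 (not_le.2 hy)

theorem rescale_bub_zero (d : ℝ) (i : ℕ) : rescale d (bub i) 0 = 0 := by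
  simpa [rescale] using (bub_eventuallyEq_zero i).eq_of_nhds

theorem deriv_rescale_bub_zero (d : ℝ) (i : ℕ) : deriv (rescale d (bub i)) 0 = 0 := by
  rw [deriv_rescale]
  simp [rescale, (bub_eventuallyEq_zero i).deriv_eq]

theorem totalDegree_pderiv_le (i : Fin 2) {p : Poly2} {N : ℕ} (hp : p.totalDegree ≤ N) :
    (MvPolynomial.pderiv i p).totalDegree ≤ N := by
  refine Finset.sup_le fun d hd => ?_
  rw [MvPolynomial.mem_support_iff, MvPolynomial.coeff_pderiv] at hd
  have h1 : d + Finsupp.single i 1 ∈ p.support := by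
    rw [MvPolynomial.mem_support_iff]; intro h0; exact hd (by rw [h0, zero_mul])
  have h2 := (MvPolynomial.le_totalDegree h1).trans hp
  rw [Finsupp.sum_fintype _ _ (fun _ => rfl), Fin.sum_univ_two] at h2 ⊢
  simp only [Finsupp.add_apply] at h2
  omega

/-- The drop of the degree by two is not needed; one common degree bound serves all residuals. -/
theorem totalDegree_rot_rowRot_le {P : Matrix (Fin 2) (Fin 2) Poly2} {N : ℕ}
    (hP : ∀ i j, (P i j).totalDegree ≤ N) : (rot (rowRot P)).totalDegree ≤ N := by
  have hs : ∀ {p q : Poly2}, p.totalDegree ≤ N → q.totalDegree ≤ N → (p - q).totalDegree ≤ N :=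
    fun hp hq => (MvPolynomial.totalDegree_sub _ _).trans (max_le hp hq)
  have hr : ∀ i, (rowRot P i).totalDegree ≤ N := fun i =>
    hs (totalDegree_pderiv_le _ (hP _ _)) (totalDegree_pderiv_le _ (hP _ _))
  exact hs (totalDegree_pderiv_le _ (hr _)) (totalDegree_pderiv_le _ (hr _))

/-- The residual estimate on one triangle: the volume residual, and the edge terms for the test
functions that do not vanish on the edge. -/
theorem exists_local_const (N : ℕ) (δ R : ℝ) : ∃ C, 0 < C ∧
    ∀ (S : Set E2) (a v w : E2) (h : ℝ) (P : Matrix (Fin 2) (Fin 2) Poly2) (G : E2 → M2),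
    Fits S a v w h δ R → P.IsSymm → (∀ i j, (P i j).totalDegree ≤ N) →
    (∀ i j, MemLp (fun x => G x i j) 2 (volume.restrict S)) →
    (∀ i j, ∫ x in S, ccPair a v w (rescale h (bub i)) (rescale (δ * h) (bub j)) (G x) x = 0) →
    h ^ 4 * ∫ x in S, pev (rot (rowRot P)) x ^ 2 ≤ C * strainError S G P ∧
    ∀ i ≤ N, ∀ l ≤ 1,
      h ^ 2 * ((∫ x in S, ccPair a v w (rescale h (bub i)) (rescale (δ * h) (prof l)) (G x) x)
        - prof l 0 * (∫ s in Ioo 0 h, edgeFlux v w P (a + s • v) * rescale h (bub i) s)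
        + (δ * h)⁻¹ * deriv (prof l) 0 *
          ∫ s in Ioo 0 h, pev (pquad v v P) (a + s • v) * rescale h (bub i) s) ^ 2
        ≤ C * strainError S G P := by
  obtain ⟨B, hB, hbub, hprof⟩ := exists_bubble_bound N
  obtain ⟨C, hC, hvol⟩ := exists_volume_moment_const N δ R
  set K : ℝ := 16 * B ^ 4 * δ⁻¹ ^ 4 * |R| with hK
  have hK0 : 0 ≤ K := by positivity
  -- The first summand is for the volume residual, the bracket for an edge residual bounded by
  -- tested error plus volume term; the final 1 only ensures positivity.
  refine ⟨C * K + (2 * K + 2 * (B ^ 4 * |R| * (C * K))) + 1, by positivity,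
    fun S a v w h P G F hP hdeg hG hzero => ?_⟩
  have hh := F.len_pos
  have hd : 0 < δ * h := mul_pos F.depth_pos hh
  set A := strainError S G P with hA
  have hA0 : 0 ≤ A := strainError_nonneg _ _ _
  have hRabs : |R| = R := abs_of_nonneg F.nonneg
  set ρ := rot (rowRot P)
  have hres : ∀ (i : ℕ) (g : ℝ → ℝ), i ≤ N → BoundedBy B g →
      h ^ 2 * (∫ x in S, ccPair a v w (rescale h (bub i)) (rescale (δ * h) g)
        (symPart (G x) - evM P x) x) ^ 2 ≤ K * A := fun i g hi hg => by
    rw [hK, hRabs]; exact F.sq_integral_ccPair_le hB (hbub i hi) hg hG P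
  have hρ : h ^ 4 * ∫ x in S, pev ρ x ^ 2 ≤ C * (K * A) := by
    have := hvol S a v w h (√(K * A) / h) ρ F (totalDegree_rot_rowRot_le hdeg) ?_
    · rw [div_pow, Real.sq_sqrt (by positivity)] at this
      have h2 := mul_le_mul_of_nonneg_left this (sq_nonneg h)
      calc _ = h ^ 2 * (h ^ 2 * ∫ x in S, pev ρ x ^ 2) := by ring
        _ ≤ _ := h2
        _ = _ := by field_simp
    · intro i hi j hj
      have hα := (tangTest_bub i).rescale hh
      have hβ := (normTest_bub j).rescale hd
      have e := F.integral_ccPair_sub hα.smooth hβ.smooth hG P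
      rw [hzero, F.integral_ccPair_evM hα hβ hP, rescale_bub_zero, deriv_rescale_bub_zero] at e
      have h3 := hres i (bub j) hi (hbub j hj)
      rw [e] at h3
      rw [le_div_iff₀ hh]
      refine Real.le_sqrt_of_sq_le ?_
      rw [mul_pow, sq_abs]
      linarith
  refine ⟨?_, fun i hi l hl => ?_⟩
  · nlinarith [mul_nonneg hK0 hA0, mul_nonneg (mul_nonneg (by positivity : 0 ≤ B ^ 4 * |R|)
      (mul_nonneg hC.le hK0)) hA0]
  · have hα := (tangTest_bub i).rescale hh
    have hβ := (normTest_prof l).rescale hd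
    have e := F.integral_ccPair_sub hα.smooth hβ.smooth hG P
    have h0 : rescale (δ * h) (prof l) 0 = prof l 0 := by simp [rescale]
    have h1 : deriv (rescale (δ * h) (prof l)) 0 = (δ * h)⁻¹ * deriv (prof l) 0 := by
      rw [deriv_rescale]; simp [rescale]
    rw [F.integral_ccPair_evM hα hβ hP, h0, h1] at e
    have h3 := hres i (prof l) hi (hprof l hl)
    have h4 := F.sq_integral_tens_le hB (hbub i hi) (hprof l hl) ρ
    rw [← hRabs] at h4
    set X := ∫ x in S, ccPair a v w (rescale h (bub i)) (rescale (δ * h) (prof l))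
        (symPart (G x) - evM P x) x
    set Y := ∫ x in S, pev ρ x * tens a v w (rescale h (bub i)) (rescale (δ * h) (prof l)) x
    have h5 : h ^ 2 * Y ^ 2 ≤ B ^ 4 * |R| * (C * K) * A := by
      calc h ^ 2 * Y ^ 2 ≤ h ^ 2 * (B ^ 4 * |R| * h ^ 2 * ∫ x in S, pev ρ x ^ 2) :=
            mul_le_mul_of_nonneg_left h4 (sq_nonneg h)
        _ = B ^ 4 * |R| * (h ^ 4 * ∫ x in S, pev ρ x ^ 2) := by ring
        _ ≤ B ^ 4 * |R| * (C * (K * A)) := mul_le_mul_of_nonneg_left hρ (by positivity)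
        _ = _ := by ring
    have h6 : (X + Y) ^ 2 ≤ 2 * X ^ 2 + 2 * Y ^ 2 := by nlinarith [sq_nonneg (X - Y)]
    have h7 := mul_le_mul_of_nonneg_left h6 (sq_nonneg h)
    have h8 : 0 ≤ C * K * A := by positivity
    have h9 : ∀ Z, Z = X + Y →
        h ^ 2 * Z ^ 2 ≤ (C * K + (2 * K + 2 * (B ^ 4 * |R| * (C * K))) + 1) * A := by
      rintro Z rfl
      nlinarith
    -- By Green's identity the edge expression is exactly the tested error `X` plus the volume term
    -- `Y`.
    exact h9 _ (by rw [e]; ring)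

/-! ### Weak derivatives in the plane -/

/-- The set where a tensor product of `α` and `β` lives. -/
def box (a v w : E2) (α β : ℝ → ℝ) : Set E2 :=
  {x | coord a v x ∈ tsupport α ∧ coord a w x ∈ tsupport β}

theorem tens_eq_zero {a v w : E2} {α β : ℝ → ℝ} {x : E2} (hx : x ∉ box a v w α β) :
    tens a v w α β x = 0 := by
  by_contra h
  exact hx ⟨subset_tsupport _ (left_ne_zero_of_mul h), subset_tsupport _ (right_ne_zero_of_mul h)⟩

theorem isClosed_box (a v w : E2) (α β : ℝ → ℝ) : IsClosed (box a v w α β) :=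
  ((isClosed_tsupport α).preimage (contDiff_coord a v).continuous).inter
    ((isClosed_tsupport β).preimage (contDiff_coord a w).continuous)

theorem box_mono (a v w : E2) {α β α' β' : ℝ → ℝ} (hα : tsupport α' ⊆ tsupport α)
    (hβ : tsupport β' ⊆ tsupport β) : box a v w α' β' ⊆ box a v w α β :=
  fun _ hx => ⟨hα hx.1, hβ hx.2⟩

theorem hasCompactSupport_tens {v w : E2} (h : IsFrame v w) (a : E2) {α β : ℝ → ℝ}
    (hα : HasCompactSupport α) (hβ : HasCompactSupport β) :
    HasCompactSupport (tens a v w α β) := by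
  refine HasCompactSupport.intro ((hα.isCompact.prod hβ.isCompact).image
    (contDiff_framePt a v w).continuous) fun x hx => tens_eq_zero fun hb => hx ?_
  exact ⟨(coord a v x, coord a w x), hb, framePt_coord h a x⟩

theorem isTest_tens {Ω : Set E2} {v w : E2} (h : IsFrame v w) (a : E2) {α β : ℝ → ℝ}
    (hα : ContDiff ℝ ∞ α) (hαc : HasCompactSupport α) (hβ : ContDiff ℝ ∞ β)
    (hβc : HasCompactSupport β) (hΩ : box a v w α β ⊆ Ω) : IsTest Ω (tens a v w α β) := by
  refine ⟨contDiff_tens a v w hα hβ, hasCompactSupport_tens h a hαc hβc, ?_⟩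
  refine (closure_minimal (fun x hx => ?_) (isClosed_box a v w α β)).trans hΩ
  by_contra hb
  exact hx (tens_eq_zero hb)

theorem partialD_tens {a v w : E2} {α β : ℝ → ℝ} (hα : ContDiff ℝ ∞ α) (hβ : ContDiff ℝ ∞ β)
    (j : Fin 2) (x : E2) : partialD j (tens a v w α β) x
      = v j * tens a v w (deriv α) β x + w j * tens a v w α (deriv β) x := by
  obtain ⟨L, hL, hLe⟩ := hasFDerivAt_coord a v x
  obtain ⟨M, hM, hMe⟩ := hasFDerivAt_coord a w x
  have h1 := (hα.differentiable (by simp) (coord a v x)).hasDerivAt.comp_hasFDerivAt x hL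
  have h2 := (hβ.differentiable (by simp) (coord a w x)).hasDerivAt.comp_hasFDerivAt x hM
  have h3 : HasFDerivAt (tens a v w α β) _ x := h1.mul h2
  rw [partialD, h3.fderiv]
  have hLj : L (EuclideanSpace.single j 1) = v j := by
    rw [hLe]; fin_cases j <;> simp
  have hMj : M (EuclideanSpace.single j 1) = w j := by
    rw [hMe]; fin_cases j <;> simp
  change α (coord a v x) * (deriv β (coord a w x) * M (EuclideanSpace.single j 1))
    + β (coord a w x) * (deriv α (coord a v x) * L (EuclideanSpace.single j 1)) = _
  rw [hLj, hMj]
  simp only [tens]; ring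

section weak

variable {Ω : Set E2} {u : E2 → E2} {Du : E2 → M2}

theorem IsTest.memLp {φ : E2 → ℝ} (hφ : IsTest Ω φ) : MemLp φ 2 (volume.restrict Ω) :=
  (hφ.1.continuous.memLp_of_hasCompactSupport hφ.2.1).restrict Ω

theorem IsTest.memLp_partialD {φ : E2 → ℝ} (hφ : IsTest Ω φ) (j : Fin 2) :
    MemLp (partialD j φ) 2 (volume.restrict Ω) := by
  refine ((continuous_fderiv_apply hφ.1 _).memLp_of_hasCompactSupport ?_).restrict Ω
  exact hφ.2.1.fderiv_apply ℝ _

/-- Directional weak derivatives. -/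
theorem integral_quad_mul_test (hu : ∀ i, IsH1 Ω (fun x => u x i) (fun x => Du x i))
    {φ : E2 → ℝ} (hφ : IsTest Ω φ) (y z : E2) :
    ∫ x in Ω, quad y z (Du x) * φ x
      = - ∫ x in Ω, (∑ i, y i * u x i) * ∑ j, z j * partialD j φ x := by
  have h1 : ∀ i j, Integrable (fun x => y i * z j * (Du x i j * φ x)) (volume.restrict Ω) :=
    fun i j => (((hu i).2 j).1.integrable_mul hφ.memLp).const_mul _
  have h2 : ∀ i j, Integrable (fun x => y i * z j * (u x i * partialD j φ x))
      (volume.restrict Ω) :=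
    fun i j => ((hu i).1.integrable_mul (hφ.memLp_partialD j)).const_mul _
  have e1 : (fun x => quad y z (Du x) * φ x)
      = fun x => ∑ i, ∑ j, y i * z j * (Du x i j * φ x) := by
    funext x; simp only [quad, Finset.sum_mul]
    exact Finset.sum_congr rfl fun i _ => Finset.sum_congr rfl fun j _ => by ring
  have e2 : (fun x => (∑ i, y i * u x i) * ∑ j, z j * partialD j φ x)
      = fun x => ∑ i, ∑ j, y i * z j * (u x i * partialD j φ x) := by
    funext x; rw [Finset.sum_mul_sum]
    exact Finset.sum_congr rfl fun i _ => Finset.sum_congr rfl fun j _ => by ring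
  rw [e1, e2, integral_finsetSum _ fun i _ => integrable_finsetSum _ fun j _ => h1 i j,
    integral_finsetSum _ fun i _ => integrable_finsetSum _ fun j _ => h2 i j,
    ← Finset.sum_neg_distrib]
  refine Finset.sum_congr rfl fun i _ => ?_
  rw [integral_finsetSum _ fun j _ => h1 i j, integral_finsetSum _ fun j _ => h2 i j,
    ← Finset.sum_neg_distrib]
  refine Finset.sum_congr rfl fun j _ => ?_
  rw [integral_const_mul, integral_const_mul, ((hu i).2 j).2 φ hφ]
  ring

variable {a v w : E2}

/-- The gradient of a weakly differentiable field is orthogonal to `Curl Curl φ`. -/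
theorem integral_ccPair_eq_zero (hu : ∀ i, IsH1 Ω (fun x => u x i) (fun x => Du x i))
    (h : IsFrame v w) {α β : ℝ → ℝ} (hα : ContDiff ℝ ∞ α) (hαc : HasCompactSupport α)
    (hβ : ContDiff ℝ ∞ β) (hβc : HasCompactSupport β) (hΩ : box a v w α β ⊆ Ω) :
    ∫ x in Ω, ccPair a v w α β (Du x) x = 0 := by
  have hα1 := contDiff_deriv_of_smooth hα
  have hα2 := contDiff_deriv_of_smooth hα1
  have hβ1 := contDiff_deriv_of_smooth hβ
  have hβ2 := contDiff_deriv_of_smooth hβ1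
  have sα1 := tsupport_deriv_subset_tsupport α
  have sα2 := (tsupport_deriv_subset_tsupport (deriv α)).trans sα1
  have sβ1 := tsupport_deriv_subset_tsupport β
  have sβ2 := (tsupport_deriv_subset_tsupport (deriv β)).trans sβ1
  have t1 : IsTest Ω (tens a v w α (deriv (deriv β))) :=
    isTest_tens h a hα hαc hβ2 hβc.deriv.deriv ((box_mono a v w subset_rfl sβ2).trans hΩ)
  have t2 : IsTest Ω (tens a v w (deriv α) (deriv β)) :=
    isTest_tens h a hα1 hαc.deriv hβ1 hβc.deriv ((box_mono a v w sα1 sβ1).trans hΩ)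
  have t3 : IsTest Ω (tens a v w (deriv (deriv α)) β) :=
    isTest_tens h a hα2 hαc.deriv.deriv hβ hβc ((box_mono a v w sα2 subset_rfl).trans hΩ)
  have hG : ∀ i j, MemLp (fun x => Du x i j) 2 (volume.restrict Ω) := fun i j => ((hu i).2 j).1
  have hi : ∀ y z {φ}, IsTest Ω φ → Integrable (fun x => quad y z (Du x) * φ x)
      (volume.restrict Ω) := fun y z φ hφ => (memLp_quad hG y z).integrable_mul hφ.memLp
  have dv : ∀ {γ ε : ℝ → ℝ}, ContDiff ℝ ∞ γ → ContDiff ℝ ∞ ε → ∀ x,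
      ∑ j, v j * partialD j (tens a v w γ ε) x = tens a v w (deriv γ) ε x := by
    intro γ ε hγ hε x
    simp only [partialD_tens hγ hε, Fin.sum_univ_two]
    linear_combination tens a v w (deriv γ) ε x * h.vv + tens a v w γ (deriv ε) x * h.vw
  have dw : ∀ {γ ε : ℝ → ℝ}, ContDiff ℝ ∞ γ → ContDiff ℝ ∞ ε → ∀ x,
      ∑ j, w j * partialD j (tens a v w γ ε) x = tens a v w γ (deriv ε) x := by
    intro γ ε hγ hε x
    simp only [partialD_tens hγ hε, Fin.sum_univ_two]
    linear_combination tens a v w γ (deriv ε) x * h.ww + tens a v w (deriv γ) ε x * h.vw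
  simp only [ccPair, add_mul]
  rw [integral_add, integral_sub, integral_add (hi _ _ t2) (hi _ _ t2),
    integral_quad_mul_test hu t1, integral_quad_mul_test hu t2, integral_quad_mul_test hu t2,
    integral_quad_mul_test hu t3]
  -- After moving the weak derivatives onto the test functions, what remains is the divergence of
  -- Curl Curl `φ`, whose terms cancel pairwise.
  · simp only [dv hα hβ2, dw hα1 hβ1, dv hα1 hβ1, dw hα2 hβ]
    ring
  · exact hi _ _ t1
  · exact (hi _ _ t2).add (hi _ _ t2)
  · exact (hi _ _ t1).sub ((hi _ _ t2).add (hi _ _ t2))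
  · exact hi _ _ t3

end weak

theorem ccPair_eq_zero {a v w : E2} {α β : ℝ → ℝ} {x : E2} (hx : x ∉ box a v w α β) (M : M2) :
    ccPair a v w α β M x = 0 := by
  have sα1 := tsupport_deriv_subset_tsupport α
  have sα2 := (tsupport_deriv_subset_tsupport (deriv α)).trans sα1
  have sβ1 := tsupport_deriv_subset_tsupport β
  have sβ2 := (tsupport_deriv_subset_tsupport (deriv β)).trans sβ1
  rw [ccPair, tens_eq_zero fun h => hx (box_mono a v w subset_rfl sβ2 h),
    tens_eq_zero fun h => hx (box_mono a v w sα1 sβ1 h),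
    tens_eq_zero fun h => hx (box_mono a v w sα2 subset_rfl h)]
  ring

/-- Used twice, via the whole plane, to pass from triangles to `Ω`. -/
theorem setIntegral_ccPair {a v w : E2} {α β : ℝ → ℝ} {A : Set E2} (hA : box a v w α β ⊆ A)
    (G : E2 → M2) :
    ∫ x in A, ccPair a v w α β (G x) x = ∫ x, ccPair a v w α β (G x) x :=
  setIntegral_eq_integral_of_forall_compl_eq_zero fun _ hx =>
    ccPair_eq_zero (fun h => hx (hA h)) _

/-! ### Uniqueness of weak gradients and traces -/

/-- `HasTrace` comes with a weak gradient of its own, which has to be identified with the given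
`Du`. The difference is orthogonal to all test functions. -/
theorem IsH1.ae_eq {Ω : Set E2} (hΩ : IsOpen Ω) {v : E2 → ℝ} {G G' : E2 → Fin 2 → ℝ}
    (h : IsH1 Ω v G) (h' : IsH1 Ω v G') (j : Fin 2) :
    (fun x => G x j) =ᵐ[volume.restrict Ω] fun x => G' x j := by
  have hG := (h.2 j).1
  have hG' := (h'.2 j).1
  have := hΩ.ae_eq_zero_of_integral_contDiff_smul_eq_zero (μ := volume.restrict Ω)
    (f := fun x => G x j - G' x j) ?_ ?_
  · filter_upwards [this, self_mem_ae_restrict hΩ.measurableSet] with x hx hxΩ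
    exact sub_eq_zero.1 (hx hxΩ)
  · exact ((hG.sub hG').locallyIntegrable (by norm_num)).locallyIntegrableOn Ω
  · intro φ h1 h2 h3
    have ht : IsTest Ω φ := ⟨h1, h2, h3⟩
    have i1 : Integrable (fun x => G x j * φ x) (volume.restrict Ω) := hG.integrable_mul ht.memLp
    have i2 : Integrable (fun x => G' x j * φ x) (volume.restrict Ω) :=
      hG'.integrable_mul ht.memLp
    have : (fun x => φ x • (G x j - G' x j)) = fun x => G x j * φ x - G' x j * φ x := by
      funext x; simp only [smul_eq_mul]; ring
    rw [this, integral_sub i1 i2]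
    linarith [(h.2 j).2 φ ht, (h'.2 j).2 φ ht]

theorem tendsto_integral_mul {X : Type*} [MeasurableSpace X] {m : Measure X} {f : ℕ → X → ℝ}
    {f₀ g : X → ℝ} (hf : ∀ n, MemLp (f n) 2 m) (hf₀ : MemLp f₀ 2 m) (hg : MemLp g 2 m)
    (h : Tendsto (fun n => eLpNorm (fun x => f n x - f₀ x) 2 m) atTop (𝓝 0)) :
    Tendsto (fun n => ∫ x, f n x * g x ∂m) atTop (𝓝 (∫ x, f₀ x * g x ∂m)) := by
  refine tendsto_integral_of_L1' _ (hf₀.integrable_mul hg).1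
    (Eventually.of_forall fun n => (hf n).integrable_mul hg) ?_
  have h2 := ENNReal.Tendsto.mul_const h (Or.inr hg.eLpNorm_ne_top) (b := eLpNorm g 2 m)
  rw [zero_mul] at h2
  refine tendsto_of_tendsto_of_tendsto_of_le_of_le tendsto_const_nhds h2 (fun _ => bot_le)
    fun n => ?_
  have h3 := eLpNorm_smul_le_mul_eLpNorm (p := 2) (q := 2) (r := 1) hg.1 ((hf n).sub hf₀).1
  refine le_trans (le_of_eq (congrArg (fun F => eLpNorm F 1 m) (funext fun x => ?_))) h3
  simp [sub_mul]

theorem isometry_line {v : E2} (hv : v 0 ^ 2 + v 1 ^ 2 = 1) (a : E2) :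
    Isometry fun s : ℝ => a + s • v := by
  have hn : ‖v‖ = 1 := by
    rw [← sq_eq_sq₀ (norm_nonneg _) zero_le_one, EuclideanSpace.norm_sq_eq]
    simpa [Fin.sum_univ_two] using hv
  refine Isometry.of_dist_eq fun s t => ?_
  rw [dist_add_left, dist_eq_norm, ← sub_smul, norm_smul, hn, mul_one, dist_eq_norm]

/-- The parametrization is an isometry, so it carries Lebesgue measure to the one-dimensional
Hausdorff measure on its range. Convergence in `L²(Γ)` thus implies convergence along an edge in
`Γ`. -/
theorem map_line_le {v : E2} (hv : v 0 ^ 2 + v 1 ^ 2 = 1) (a : E2) {h : ℝ} {Γ : Set E2}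
    (hΓ : IsCompact Γ) (hsub : ∀ s ∈ Ioo 0 h, a + s • v ∈ Γ) :
    (volume.restrict (Ioo 0 h)).map (fun s : ℝ => a + s • v) ≤ arcMeasure Γ := by
  have hI := isometry_line hv a
  refine Measure.le_intro fun s hs _ => ?_
  have hmeas := hI.continuous.measurable
  have hmap := hI.map_hausdorffMeasure (d := 1) (Or.inl zero_le_one)
  rw [hausdorffMeasure_real] at hmap
  rw [Measure.map_apply hmeas hs, Measure.restrict_apply (hmeas hs), arcMeasure,
    Measure.restrict_apply hs]
  calc volume ((fun s : ℝ => a + s • v) ⁻¹' s ∩ Ioo 0 h)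
      ≤ volume ((fun s : ℝ => a + s • v) ⁻¹' (s ∩ Γ)) :=
        measure_mono fun t ht => ⟨ht.1, hsub t ht.2⟩
    _ = ((volume : Measure ℝ).map fun s : ℝ => a + s • v) (s ∩ Γ) :=
        (Measure.map_apply hmeas (hs.inter hΓ.measurableSet)).symm
    _ ≤ (μH[1] : Measure E2) (s ∩ Γ) := by
        rw [hmap]; exact Measure.restrict_apply_le _ _

/-- Coefficients of `Curl Curl φ`. -/
def ccCoef (a v w : E2) (α β : ℝ → ℝ) (i j : Fin 2) (x : E2) : ℝ :=
  v i * v j * tens a v w α (deriv (deriv β)) x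
    - (v i * w j + w i * v j) * tens a v w (deriv α) (deriv β) x
    + w i * w j * tens a v w (deriv (deriv α)) β x

theorem ccPair_eq_sum (a v w : E2) (α β : ℝ → ℝ) (M : M2) (x : E2) :
    ccPair a v w α β M x = ∑ i, ∑ j, M i j * ccCoef a v w α β i j x := by
  simp only [ccPair, quad, ccCoef, Fin.sum_univ_two]; ring

section trace

variable {Ω ΓD S : Set E2} {u uD : E2 → E2} {Du : E2 → M2} {a v w : E2} {h δ R : ℝ} {α β : ℝ → ℝ}

theorem continuous_ccCoef (a v w : E2) (hα : ContDiff ℝ ∞ α) (hβ : ContDiff ℝ ∞ β) (i j : Fin 2) :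
    Continuous (ccCoef a v w α β i j) := by
  have hα1 := contDiff_deriv_of_smooth hα
  have hα2 := contDiff_deriv_of_smooth hα1
  have hβ1 := contDiff_deriv_of_smooth hβ
  have hβ2 := contDiff_deriv_of_smooth hβ1
  exact ((continuous_const.mul (continuous_tens a v w hα.continuous hβ2.continuous)).sub
    (continuous_const.mul (continuous_tens a v w hα1.continuous hβ1.continuous))).add
    (continuous_const.mul (continuous_tens a v w hα2.continuous hβ.continuous))

/-- Green's identity for a weakly differentiable field with a trace on the edge. -/
theorem Fits.integral_ccPair_of_hasTrace (F : Fits S a v w h δ R) (hΩ : IsOpen Ω)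
    (hS : S ≤ᵐ[volume] Ω) (hΓ : IsCompact ΓD) (hsub : ∀ s ∈ Ioo 0 h, a + s • v ∈ ΓD)
    (hu : ∀ i, IsH1 Ω (fun x => u x i) (fun x => Du x i))
    (ht : ∀ i, HasTrace Ω ΓD (fun x => u x i) (fun x => uD x i))
    (hα : TangTest h α) (hβ : NormTest (δ * h) β) :
    ∫ x in S, ccPair a v w α β (Du x) x
      = deriv β 0 * (∫ s in Ioo 0 h, (∑ i, v i * uD (a + s • v) i) * deriv α s)
        - β 0 * ∫ s in Ioo 0 h, (∑ i, w i * uD (a + s • v) i) * deriv (deriv α) s := by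
  choose htL G hG W hW hW0 hWG hWt using ht
  have hres : volume.restrict S ≤ volume.restrict Ω := Measure.restrict_mono_ae hS
  have hmap := map_line_le F.frame.vv a hΓ hsub
  have hline : Measurable fun s : ℝ => a + s • v :=
    (isometry_line F.frame.vv a).continuous.measurable
  have hDG : ∀ i j, (fun x => Du x i j) =ᵐ[volume.restrict S] fun x => G i x j := fun i j =>
    ae_mono hres ((hu i).ae_eq hΩ (hG i) j)
  have hcoef : ∀ i j, MemLp (ccCoef a v w α β i j) 2 (volume.restrict S) := fun i j =>
    F.memLp (continuous_ccCoef a v w hα.smooth hβ.smooth i j)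
  have hDuL : ∀ i j, MemLp (fun x => Du x i j) 2 (volume.restrict S) := fun i j =>
    ((hu i).2 j).1.mono_measure hres
  have hgr : ∀ i j n, MemLp (fun x => partialD j (W i n) x) 2 (volume.restrict S) := fun i j n =>
    F.memLp (continuous_fderiv_apply (hW i n) _)
  have hsum : ∀ {M : E2 → M2}, (∀ i j, MemLp (fun x => M x i j) 2 (volume.restrict S)) →
      ∫ x in S, ccPair a v w α β (M x) x
        = ∑ i, ∑ j, ∫ x in S, M x i j * ccCoef a v w α β i j x := by
    intro M hM
    have hi : ∀ i j, Integrable (fun x => M x i j * ccCoef a v w α β i j x)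
        (volume.restrict S) := fun i j => (hM i j).integrable_mul (hcoef i j)
    simp only [ccPair_eq_sum]
    rw [integral_finsetSum _ fun i _ => integrable_finsetSum _ fun j _ => hi i j]
    exact Finset.sum_congr rfl fun i _ => integral_finsetSum _ fun j _ => hi i j
  -- The identity holds for the smooth approximants from `HasTrace`; both of its sides pass to the
  -- limit.
  have hlhs : Tendsto (fun n => ∫ x in S, ccPair a v w α β (gradM (fun i => W i n) x) x) atTop
      (𝓝 (∫ x in S, ccPair a v w α β (Du x) x)) := by
    rw [hsum hDuL]
    have hn : ∀ n, ∫ x in S, ccPair a v w α β (gradM (fun i => W i n) x) x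
        = ∑ i, ∑ j, ∫ x in S, partialD j (W i n) x * ccCoef a v w α β i j x := fun n =>
      hsum (M := gradM fun i => W i n) fun i j => hgr i j n
    simp only [hn]
    refine tendsto_finsetSum _ fun i _ => tendsto_finsetSum _ fun j _ => ?_
    refine tendsto_integral_mul (hgr i j) (hDuL i j) (hcoef i j) ?_
    refine tendsto_of_tendsto_of_tendsto_of_le_of_le tendsto_const_nhds (hWG i j)
      (fun _ => bot_le) fun n => ?_
    refine le_trans (le_of_eq (eLpNorm_congr_ae ?_)) (eLpNorm_mono_measure _ hres)
    filter_upwards [hDG i j] with x hx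
    rw [hx]
  have hbd : ∀ i {γ : ℝ → ℝ}, Continuous γ →
      Tendsto (fun n => ∫ s in Ioo 0 h, W i n (a + s • v) * γ s) atTop
        (𝓝 (∫ s in Ioo 0 h, uD (a + s • v) i * γ s)) := by
    intro i γ hγ
    have hcont : ∀ {f : ℝ → ℝ}, Continuous f → MemLp f 2 (volume.restrict (Ioo 0 h)) := by
      intro f hf
      obtain ⟨C, hC⟩ := isCompact_Icc.exists_bound_of_continuousOn (hf.continuousOn (s := Icc 0 h))
      exact MemLp.of_bound hf.aestronglyMeasurable C ((ae_restrict_iff' measurableSet_Ioo).2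
        (Eventually.of_forall fun s hs => hC s (Ioo_subset_Icc_self hs)))
    have htm : MemLp (fun x => uD x i) 2
        ((volume.restrict (Ioo 0 h)).map fun s : ℝ => a + s • v) := (htL i).mono_measure hmap
    refine tendsto_integral_mul (fun n => hcont ((hW i n).continuous.comp (by fun_prop)))
      (htm.comp_of_map hline.aemeasurable) (hcont hγ) ?_
    refine tendsto_of_tendsto_of_tendsto_of_le_of_le tendsto_const_nhds (hWt i)
      (fun _ => bot_le) fun n => ?_
    have := eLpNorm_map_measure (p := 2) (f := fun s : ℝ => a + s • v)
      (g := fun x => W i n x - uD x i)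
      ((hW i n).continuous.aestronglyMeasurable.sub htm.1) hline.aemeasurable
    refine le_trans (le_of_eq this.symm) (eLpNorm_mono_measure _ hmap)
  have hbi : ∀ i {γ : ℝ → ℝ}, Continuous γ →
      Integrable (fun s => uD (a + s • v) i * γ s) (volume.restrict (Ioo 0 h)) := by
    intro i γ hγ
    have htm : MemLp (fun x => uD x i) 2
        ((volume.restrict (Ioo 0 h)).map fun s : ℝ => a + s • v) := (htL i).mono_measure hmap
    obtain ⟨C, hC⟩ := isCompact_Icc.exists_bound_of_continuousOn (hγ.continuousOn (s := Icc 0 h))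
    have hγm : MemLp γ 2 (volume.restrict (Ioo 0 h)) :=
      MemLp.of_bound hγ.aestronglyMeasurable C ((ae_restrict_iff' measurableSet_Ioo).2
        (Eventually.of_forall fun s hs => hC s (Ioo_subset_Icc_self hs)))
    exact (htm.comp_of_map hline.aemeasurable).integrable_mul hγm
  have hbs : ∀ (y : E2) {γ : ℝ → ℝ}, Continuous γ →
      Tendsto (fun n => ∫ s in Ioo 0 h, (∑ i, y i * W i n (a + s • v)) * γ s) atTop
        (𝓝 (∫ s in Ioo 0 h, (∑ i, y i * uD (a + s • v) i) * γ s)) := by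
    intro y γ hγ
    have e : ∀ {f : Fin 2 → ℝ → ℝ}, (∀ i, Integrable (fun s => f i s * γ s)
        (volume.restrict (Ioo 0 h))) → ∫ s in Ioo 0 h, (∑ i, y i * f i s) * γ s
        = ∑ i, y i * ∫ s in Ioo 0 h, f i s * γ s := by
      intro f hf
      simp only [Finset.sum_mul, mul_assoc]
      rw [integral_finsetSum _ fun i _ => (hf i).const_mul _]
      exact Finset.sum_congr rfl fun i _ => integral_const_mul _ _
    rw [e fun i => hbi i hγ]
    have hWi : ∀ n i, Integrable (fun s => W i n (a + s • v) * γ s)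
        (volume.restrict (Ioo 0 h)) := fun n i =>
      (Continuous.integrableOn_Icc (((hW i n).continuous.comp (by fun_prop)).mul hγ)).mono_set
        Ioo_subset_Icc_self
    simp only [e (hWi _)]
    exact tendsto_finsetSum _ fun i _ => (hbd i hγ).const_mul _
  refine tendsto_nhds_unique hlhs ?_
  simp only [F.integral_ccPair_gradM hα hβ fun i => hW i _]
  exact ((hbs v hα.deriv.smooth.continuous).const_mul _).sub
    ((hbs w hα.deriv.deriv.smooth.continuous).const_mul _)

end trace

/-! ### Shape regularity -/

theorem Edge.sq_len (e : Edge) : Edge.len e ^ 2 = (e.2 - e.1) 0 ^ 2 + (e.2 - e.1) 1 ^ 2 := by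
  rw [Edge.len, EuclideanSpace.norm_sq_eq]
  simp [Fin.sum_univ_two]

theorem Edge.len_nonneg (e : Edge) : 0 ≤ Edge.len e := norm_nonneg _

theorem Edge.isFrame {e : Edge} (h : 0 < Edge.len e) : IsFrame (Edge.tau e) (-Edge.nu e) := by
  have h1 := Edge.sq_len e
  have h2 : Edge.tau e 0 ^ 2 + Edge.tau e 1 ^ 2 = 1 := by
    simp only [Edge.tau, PiLp.smul_apply, smul_eq_mul]
    rw [mul_pow, mul_pow, ← mul_add, ← h1]
    field_simp
  refine ⟨h2, ?_, ?_⟩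
  · simp [Edge.nu]; linarith
  · simp [Edge.nu]; ring

theorem Edge.eq_add_smul_tau {e : Edge} (h : 0 < Edge.len e) :
    e.2 = e.1 + Edge.len e • Edge.tau e := by
  rw [Edge.tau, smul_smul, mul_inv_cancel₀ h.ne', one_smul, add_sub_cancel]

theorem LiesLeft.len_pos {t : Finset E2} {e : Edge} (H : LiesLeft t e) : 0 < Edge.len e := by
  obtain ⟨-, -, c, -, hc⟩ := H
  refine norm_pos_iff.2 fun h0 => ?_
  rw [h0] at hc
  simp at hc

/-- A lower bound for all three angles also keeps each of them away from `π`, and between these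
limits the sine is smallest at the ends. -/
theorem sin_le_sin_of_mem {θ A : ℝ} (h0 : 0 ≤ θ) (h1 : θ ≤ A) (h2 : A ≤ Real.pi - θ) :
    Real.sin θ ≤ Real.sin A := by
  rcases le_total A (Real.pi / 2) with h | h
  · exact Real.sin_le_sin_of_le_of_le_pi_div_two (by linarith [Real.pi_pos]) h h1
  · rw [← Real.sin_pi_sub A]
    exact Real.sin_le_sin_of_le_of_le_pi_div_two (by linarith [Real.pi_pos]) (by linarith)
      (by linarith)

/-- In a triangle with angles at least `θ`, the sides are comparable, and the heights are
comparable to the sides. -/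
theorem side_bounds {θ : ℝ} (h0 : 0 < θ) {a b c : E2} (hab : a ≠ b)
    (hA : θ ≤ EuclideanGeometry.angle b a c) (hB : θ ≤ EuclideanGeometry.angle a b c)
    (hC : θ ≤ EuclideanGeometry.angle b c a) :
    Real.sin θ * dist c a ≤ dist a b ∧ Real.sin θ * dist a b ≤ dist c a ∧
    Real.sin θ ≤ Real.sin (EuclideanGeometry.angle b a c) := by
  have hsum := EuclideanGeometry.angle_add_angle_add_angle_eq_pi c hab.symm
  rw [EuclideanGeometry.angle_comm c a b] at hsum
  have sA := sin_le_sin_of_mem h0.le hA (by linarith)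
  have sB := sin_le_sin_of_mem h0.le hB (by linarith)
  have sC := sin_le_sin_of_mem h0.le hC (by linarith)
  have hl := EuclideanGeometry.law_sin b c a
  have h1 := mul_le_mul_of_nonneg_right sC (dist_nonneg (x := c) (y := a))
  have h2 := mul_le_mul_of_nonneg_right sB (dist_nonneg (x := a) (y := b))
  have h4 := mul_le_mul_of_nonneg_right (Real.sin_le_one (EuclideanGeometry.angle b c a))
    (dist_nonneg (x := c) (y := a))
  have h5 := mul_le_mul_of_nonneg_right (Real.sin_le_one (EuclideanGeometry.angle a b c))
    (dist_nonneg (x := a) (y := b))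
  exact ⟨by linarith, by linarith, sA⟩

theorem coord_convex_comb (a v x y : E2) {p q : ℝ} (h : p + q = 1) :
    coord a v (p • x + q • y) = p * coord a v x + q * coord a v y := by
  simp [coord]; linear_combination (a 0 * v 0 + a 1 * v 1) * h

theorem convex_halfPlane (a w : E2) : Convex ℝ (halfPlane a w) := by
  intro x hx y hy p q hp hq hpq
  change 0 ≤ coord a w _
  rw [coord_convex_comb a w x y hpq]
  exact add_nonneg (mul_nonneg hp hx) (mul_nonneg hq hy)

theorem IsFrame.coord_sq_add {v w : E2} (h : IsFrame v w) (a x : E2) :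
    coord a v x ^ 2 + coord a w x ^ 2 = dist x a ^ 2 := by
  rw [← norm_framePt_sub h a, framePt_coord h, dist_eq_norm]

theorem IsFrame.abs_coord_le {v w : E2} (h : IsFrame v w) (a x : E2) :
    |coord a v x| ≤ dist x a ∧ |coord a w x| ≤ dist x a := by
  have := h.coord_sq_add a x
  have h1 := sq_nonneg (coord a v x)
  have h2 := sq_nonneg (coord a w x)
  exact ⟨abs_le_of_sq_le_sq (by linarith) dist_nonneg,
    abs_le_of_sq_le_sq (by linarith) dist_nonneg⟩

theorem mem_tri_of_combination {a b c x : E2} {t : Finset E2} (ha : a ∈ t) (hb : b ∈ t)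
    (hc : c ∈ t) {p q : ℝ} (hp : 0 ≤ p) (hq : 0 ≤ q) (hpq : p + q ≤ 1)
    (hx : x = a + p • (b - a) + q • (c - a)) : x ∈ tri t := by
  have hs := convex_convexHull ℝ (t : Set E2)
  have := hs.sum_mem (t := Finset.univ) (w := ![1 - p - q, p, q]) (z := ![a, b, c])
    (fun i _ => by fin_cases i <;> simp <;> linarith) (by simp [Fin.sum_univ_three]; ring)
    (fun i _ => subset_convexHull ℝ _ (by fin_cases i <;> simpa))
  rw [tri]
  convert this using 1
  rw [hx]
  simp [Fin.sum_univ_three]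
  module

theorem eq_of_liesLeft {t : Finset E2} (ht : t.card = 3) {e : Edge} {c : E2} (h1 : e.1 ∈ t)
    (h2 : e.2 ∈ t) (hc : c ∈ t)
    (hpos : 0 < (e.2 - e.1) 0 * (c - e.1) 1 - (e.2 - e.1) 1 * (c - e.1) 0) :
    e.1 ≠ e.2 ∧ e.1 ≠ c ∧ e.2 ≠ c ∧ t = {e.1, e.2, c} := by
  have n1 : e.1 ≠ e.2 := fun h => by rw [← h] at hpos; simp at hpos
  have n2 : e.1 ≠ c := fun h => by rw [← h] at hpos; simp at hpos
  have n3 : e.2 ≠ c := fun h => by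
    rw [← h, mul_comm] at hpos; simp at hpos
  refine ⟨n1, n2, n3, (Finset.eq_of_subset_of_card_le ?_ ?_).symm⟩
  · intro x hx
    simp only [Finset.mem_insert, Finset.mem_singleton] at hx
    rcases hx with rfl | rfl | rfl <;> assumption
  · rw [ht, Finset.card_eq_three.2 ⟨_, _, _, n1, n2, n3, rfl⟩]

theorem Fits.mono {S : Set E2} {a v w : E2} {h δ R R' : ℝ} (F : Fits S a v w h δ R)
    (hR : R ≤ R') : Fits S a v w h δ R' :=
  { F with
    coord_le := fun x hx => ⟨(F.coord_le x hx).1.trans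
      (mul_le_mul_of_nonneg_right hR F.len_pos.le), (F.coord_le x hx).2.trans
      (mul_le_mul_of_nonneg_right hR F.len_pos.le)⟩
    volume_le := F.volume_le.trans (mul_le_mul_of_nonneg_right hR (sq_nonneg _)) }

/-- All angles of a set of vertices are at least `θ`. -/
def AnglesGe (θ : ℝ) (t : Finset E2) : Prop :=
  ∀ a ∈ t, ∀ b ∈ t, ∀ c ∈ t, a ≠ b → b ≠ c → a ≠ c → θ ≤ EuclideanGeometry.angle a b c

/-- A triangle to the left of an edge contains a rectangle at that edge. -/
theorem exists_fits_left {θ : ℝ} (h0 : 0 < θ) (h3 : θ ≤ Real.pi / 3) : ∃ δ R, 0 < δ ∧ 0 < R ∧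
    ∀ (t : Finset E2) (e : Edge), t.card = 3 → AnglesGe θ t → LiesLeft t e →
      Fits (tri t) e.1 (Edge.tau e) (-Edge.nu e) (Edge.len e) δ R ∧
        triDiam t ≤ R * Edge.len e := by
  set s := Real.sin θ with hs
  have hs0 : 0 < s := Real.sin_pos_of_pos_of_lt_pi h0 (by linarith [Real.pi_pos])
  have hs1 : s ≤ 1 := Real.sin_le_one θ
  set V := volume.real (Metric.ball (0 : E2) 1) with hV
  have hV0 : 0 ≤ V := measureReal_nonneg
  -- The height over the edge is at least `s² h` and the triangle lies in the disc of radius `s⁻¹ h`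
  -- about `e.1`. The depth `s³ h / 8` is then at most `s / 8` of the height, while `R` covers the
  -- diameter of that disc and its area.
  refine ⟨s ^ 3 / 8, 2 * s⁻¹ + s⁻¹ ^ 2 * V, by positivity, by positivity,
    fun t e hcard hang hleft => ?_⟩
  have hh := hleft.len_pos
  have hF := Edge.isFrame hh
  obtain ⟨h1, h2, c, hc, hpos⟩ := hleft
  obtain ⟨n1, n2, n3, ht⟩ := eq_of_liesLeft hcard h1 h2 hc hpos
  set h := Edge.len e with hlen
  set τ := Edge.tau e with hτ
  have hdist : dist e.1 e.2 = h := by rw [dist_comm, dist_eq_norm]; rfl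
  obtain ⟨b1, b2, b3⟩ := side_bounds h0 n1 (hang _ h2 _ h1 _ hc n1.symm n2 n3)
    (hang _ h1 _ h2 _ hc n1 n3 n2) (hang _ h2 _ hc _ h1 n3 n2.symm n1.symm)
  rw [hdist, ← hs] at b1 b2
  rw [← hs] at b3
  have hb : e.2 = e.1 + h • τ := Edge.eq_add_smul_tau hh
  set S := coord e.1 τ c with hS
  set H := coord e.1 (-Edge.nu e) c with hH
  have hcr : h * H = (e.2 - e.1) 0 * (c - e.1) 1 - (e.2 - e.1) 1 * (c - e.1) 0 := by
    have e0 : (e.2 - e.1) 0 = h * τ 0 := by rw [hb]; simp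
    have e1 : (e.2 - e.1) 1 = h * τ 1 := by rw [hb]; simp
    rw [e0, e1, hH]
    simp [coord, Edge.nu, ← hτ]; ring
  -- Twice the area, computed once from the height and once from two sides and their angle.
  have hsin : h * H = Real.sin (EuclideanGeometry.angle e.2 e.1 c) * (h * dist c e.1) := by
    have := InnerProductGeometry.sin_angle_mul_norm_mul_norm (e.2 - e.1) (c - e.1)
    rw [EuclideanGeometry.angle, vsub_eq_sub, vsub_eq_sub, dist_eq_norm]
    rw [show h = ‖e.2 - e.1‖ from rfl, this]
    rw [← show h = ‖e.2 - e.1‖ from rfl, hcr]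
    symm
    rw [← Real.sqrt_sq hpos.le]
    congr 1
    simp only [PiLp.inner_apply, Fin.sum_univ_two, RCLike.inner_apply, conj_trivial]
    ring
  have hHlow : s ^ 2 * h ≤ H := by
    have : h * (s ^ 2 * h) ≤ h * H := by
      rw [hsin]
      calc h * (s ^ 2 * h) = s * (h * (s * h)) := by ring
        _ ≤ s * (h * dist c e.1) := by gcongr
        _ ≤ _ := by gcongr
    exact le_of_mul_le_mul_left this hh
  have hH0 : 0 < H := lt_of_lt_of_le (by positivity) hHlow
  have hca : dist c e.1 ≤ s⁻¹ * h := by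
    rw [inv_mul_eq_div, le_div_iff₀ hs0]; linarith
  have hSle : |S| ≤ s⁻¹ * h := (hF.abs_coord_le e.1 c).1.trans hca
  have hinv : 1 ≤ s⁻¹ := (one_le_inv₀ hs0).2 hs1
  have hball : tri t ⊆ Metric.closedBall e.1 (s⁻¹ * h) := by
    refine convexHull_min ?_ (convex_closedBall _ _)
    intro x hx
    rw [Finset.mem_coe, ht] at hx
    simp only [Finset.mem_insert, Finset.mem_singleton] at hx
    rw [Metric.mem_closedBall]
    rcases hx with rfl | rfl | rfl
    · rw [dist_self]; positivity
    · rw [dist_comm, hdist]; nlinarith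
    · exact hca
  refine ⟨⟨hF, hh, by positivity, ?_, ?_, ?_, ?_, ?_, ?_⟩, ?_⟩
  · have : s ^ 3 ≤ 1 := pow_le_one₀ hs0.le hs1
    linarith
  · exact t.finite_toSet.isCompact_convexHull (𝕜 := ℝ)
  · refine convexHull_min ?_ (convex_halfPlane _ _)
    intro x hx
    rw [Finset.mem_coe, ht] at hx
    simp only [Finset.mem_insert, Finset.mem_singleton] at hx
    change 0 ≤ coord _ _ _
    rcases hx with rfl | rfl | rfl
    · simp [coord]
    · rw [hb]; simp [coord, Edge.nu, ← hτ]; apply le_of_eq; ring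
    · exact hH0.le
  · intro x hx1 hx2
    set σ := coord e.1 τ x
    set n := coord e.1 (-Edge.nu e) x
    have hq0 : 0 ≤ n / H := div_nonneg hx2.1 hH0.le
    have hqs : n / H ≤ s / 8 := by
      rw [div_le_iff₀ hH0]
      calc n ≤ s ^ 3 / 8 * h := hx2.2
        _ = s / 8 * (s ^ 2 * h) := by ring
        _ ≤ s / 8 * H := by gcongr
    -- A point of the rectangle has barycentric weight at most `1/8` at the apex; the apex shifts
    -- the tangential coordinate by at most `h / 8`. The weight at `e.2` thus lies in `[1/4, 3/4]`.
    have hqS : |n / H * S| ≤ h / 8 := by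
      rw [abs_mul, abs_of_nonneg hq0]
      calc n / H * |S| ≤ s / 8 * (s⁻¹ * h) := by gcongr
        _ = h / 8 := by field_simp
    have hqS' := abs_le.1 hqS
    refine mem_tri_of_combination (p := (σ - n / H * S) / h) (q := n / H) h1 h2 hc ?_ hq0 ?_ ?_
    · exact div_nonneg (by linarith [hx1.1]) hh.le
    · have : (σ - n / H * S) / h ≤ 3 / 4 := by
        rw [div_le_iff₀ hh]; linarith [hx1.2]
      linarith
    · have hx := framePt_coord hF e.1 x
      have hc' := framePt_coord hF e.1 c
      rw [show e.2 - e.1 = h • τ by rw [hb]; simp]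
      rw [show c - e.1 = S • τ + H • (-Edge.nu e) by
        conv_lhs => rw [← hc']
        simp only [framePt]; module]
      rw [← hx]
      simp only [framePt]
      rw [smul_add, smul_smul, smul_smul, smul_smul, div_mul_cancel₀ _ hh.ne',
        div_mul_cancel₀ _ hH0.ne', sub_smul]
      module
  · intro x hx
    have hd : dist x e.1 ≤ (2 * s⁻¹ + s⁻¹ ^ 2 * V) * h := by
      refine (Metric.mem_closedBall.1 (hball hx)).trans (mul_le_mul_of_nonneg_right ?_ hh.le)
      have : 0 ≤ s⁻¹ ^ 2 * V := by positivity
      linarith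
    exact ⟨(hF.abs_coord_le e.1 x).1.trans hd, (hF.abs_coord_le e.1 x).2.trans hd⟩
  · calc volume.real (tri t) ≤ volume.real (Metric.closedBall e.1 (s⁻¹ * h)) :=
          measureReal_mono hball (measure_closedBall_lt_top).ne
      _ = (s⁻¹ * h) ^ 2 * V := by
          rw [measureReal_def, Measure.addHaar_closedBall _ _ (by positivity), ENNReal.toReal_mul,
            ENNReal.toReal_ofReal (by positivity)]
          simp [hV, measureReal_def]
      _ = s⁻¹ ^ 2 * V * h ^ 2 := by ring
      _ ≤ _ := mul_le_mul_of_nonneg_right (by linarith) (sq_nonneg h)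
  · calc triDiam t ≤ 2 * (s⁻¹ * h) :=
          Metric.diam_le_of_subset_closedBall (by positivity) hball
      _ = 2 * s⁻¹ * h := by ring
      _ ≤ _ := mul_le_mul_of_nonneg_right (le_add_of_nonneg_right (by positivity)) hh.le

theorem Edge.len_swap (e : Edge) : Edge.len e.swap = Edge.len e := by
  simp [Edge.len, norm_sub_rev]

theorem Edge.tau_swap (e : Edge) : Edge.tau e.swap = -Edge.tau e := by
  rw [Edge.tau, Edge.len_swap, Edge.tau, ← smul_neg, neg_sub]; rfl

theorem Edge.nu_swap (e : Edge) : Edge.nu e.swap = -Edge.nu e := by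
  ext i; fin_cases i <;> simp [Edge.nu, Edge.tau_swap]

/-- The triangle on the right is fitted with the same origin and tangent as the one on the left, so
one test function serves both. Reversing the edge sends the tangential coordinate `s` to `h - s`,
which preserves the middle part and costs the increase of `R` by 1. -/
theorem exists_fits {θ : ℝ} (h0 : 0 < θ) (h3 : θ ≤ Real.pi / 3) : ∃ δ R, 0 < δ ∧ 0 < R ∧
    ∀ (t : Finset E2) (e : Edge), t.card = 3 → AnglesGe θ t →
      (LiesLeft t e → Fits (tri t) e.1 (Edge.tau e) (-Edge.nu e) (Edge.len e) δ R ∧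
        triDiam t ≤ R * Edge.len e) ∧
      (LiesLeft t e.swap → Fits (tri t) e.1 (Edge.tau e) (Edge.nu e) (Edge.len e) δ R) := by
  obtain ⟨δ, R, hδ, hR, hfit⟩ := exists_fits_left h0 h3
  refine ⟨δ, R + 1, hδ, by linarith, fun t e hcard hang => ⟨fun hl => ?_, fun hl => ?_⟩⟩
  · obtain ⟨F, hd⟩ := hfit t e hcard hang hl
    exact ⟨F.mono (by linarith), hd.trans
      (mul_le_mul_of_nonneg_right (by linarith) (Edge.len_nonneg e))⟩
  · obtain ⟨F, -⟩ := hfit t e.swap hcard hang hl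
    have hh : 0 < Edge.len e := by simpa [Edge.len_swap] using F.len_pos
    have hfr := Edge.isFrame hh
    have e1 : ∀ x, coord e.swap.1 (Edge.tau e.swap) x = Edge.len e - coord e.1 (Edge.tau e) x := by
      intro x
      rw [Edge.tau_swap, Prod.fst_swap, Edge.eq_add_smul_tau hh]
      simp [coord]; linear_combination Edge.len e * hfr.vv
    have e2 : ∀ x, coord e.swap.1 (-Edge.nu e.swap) x = coord e.1 (Edge.nu e) x := by
      intro x
      rw [Edge.nu_swap, Prod.fst_swap, Edge.eq_add_smul_tau hh]
      have := hfr.vw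
      simp at this
      simp [coord]; linear_combination Edge.len e * this
    have hfr' : IsFrame (Edge.tau e) (Edge.nu e) := by simpa using hfr.neg
    refine ⟨hfr', hh, hδ, F.depth_le, F.isCompact, fun x hx => ?_, fun x hx1 hx2 => ?_,
      fun x hx => ?_, ?_⟩
    · have := F.subset hx
      change 0 ≤ coord _ _ _ at this
      rwa [e2] at this
    · refine F.mem x ?_ ?_
      · rw [e1, Edge.len_swap]; exact ⟨by linarith [hx1.2], by linarith [hx1.1]⟩
      · rw [e2, Edge.len_swap]; exact hx2
    · have := F.coord_le x hx
      rw [e1, e2, Edge.len_swap] at this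
      refine ⟨?_, this.2.trans (mul_le_mul_of_nonneg_right (by linarith) hh.le)⟩
      have h4 := abs_le.1 this.1
      exact abs_le.2 ⟨by linarith [h4.2], by linarith [h4.1]⟩
    · have := F.volume_le
      rw [Edge.len_swap] at this
      exact this.trans (mul_le_mul_of_nonneg_right (by linarith) (sq_nonneg _))

/-- Every triangle lies to the left of one of its edges. -/
theorem exists_liesLeft {t : Finset E2} (ht : t.card = 3)
    (hi : AffineIndependent ℝ (fun x : t => (x : E2))) : ∃ e, LiesLeft t e := by
  obtain ⟨a, b, c, hab, hac, hbc, rfl⟩ := Finset.card_eq_three.1 ht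
  have hne : (b - a) 0 * (c - a) 1 - (b - a) 1 * (c - a) 0 ≠ 0 := by
    intro h
    have hcol : Collinear ℝ ({a, b, c} : Set E2) := by
      rw [collinear_iff_of_mem (p₀ := a) (by simp)]
      refine ⟨b - a, ?_⟩
      have hba : b - a ≠ 0 := sub_ne_zero.2 hab.symm
      have hn : 0 < (b - a) 0 ^ 2 + (b - a) 1 ^ 2 := by
        have h1 := EuclideanSpace.norm_sq_eq (b - a)
        simp only [Fin.sum_univ_two, Real.norm_eq_abs, sq_abs] at h1
        rw [← h1]
        exact pow_pos (norm_pos_iff.2 hba) 2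
      intro p hp
      simp only [mem_insert_iff, mem_singleton_iff] at hp
      rcases hp with rfl | rfl | rfl
      · exact ⟨0, by simp⟩
      · exact ⟨1, by simp⟩
      · refine ⟨((b - a) 0 * (p - a) 0 + (b - a) 1 * (p - a) 1) /
          ((b - a) 0 ^ 2 + (b - a) 1 ^ 2), ?_⟩
        ext i
        simp only [vadd_eq_add, PiLp.add_apply, PiLp.smul_apply, smul_eq_mul]
        rw [div_mul_eq_mul_div, ← sub_eq_iff_eq_add, eq_div_iff hn.ne']
        fin_cases i
        · simp only [PiLp.sub_apply] at h ⊢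
          simp; linear_combination (-(b 1 - a 1)) * h
        · simp only [PiLp.sub_apply] at h ⊢
          simp; linear_combination (b 0 - a 0) * h
    have h2 := affineIndependent_iff_not_collinear_set (k := ℝ) (p₁ := a) (p₂ := b) (p₃ := c)
    refine (h2.1 ?_) hcol
    let f : Fin 3 ↪ ({a, b, c} : Finset E2) :=
      ⟨fun i => ⟨(![a, b, c] : Fin 3 → E2) i, by fin_cases i <;> simp⟩, fun i j hij => by
        have := Subtype.ext_iff.1 hij
        fin_cases i <;> fin_cases j <;> simp_all⟩
    exact hi.comp_embedding f
  -- The sign of the area decides the direction in which the edge is traversed.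
  rcases lt_or_gt_of_ne hne with h | h
  · refine ⟨(b, a), by simp, by simp, c, by simp, ?_⟩
    simp only [PiLp.sub_apply] at h ⊢
    linarith
  · exact ⟨(a, b), by simp, by simp, c, by simp, h⟩

/-! ### Edge estimates -/

theorem exists_line_poly {p : Poly2} {N : ℕ} (hp : p.totalDegree ≤ N) (a v : E2) :
    ∃ q : Polynomial ℝ, q.natDegree ≤ N ∧ ∀ s, q.eval s = pev p (a + s • v) := by
  refine ⟨MvPolynomial.aeval (fun i => Polynomial.C (a i) + Polynomial.C (v i) * Polynomial.X) p,
    ?_, fun s => ?_⟩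
  · have := MvPolynomial.aeval_natDegree_le p hp
      (fun i => Polynomial.C (a i) + Polynomial.C (v i) * Polynomial.X) (n := 1) fun i =>
        (Polynomial.natDegree_add_le _ _).trans (max_le (by simp)
          ((Polynomial.natDegree_C_mul_le _ _).trans Polynomial.natDegree_X_le))
    simpa using this
  · rw [MvPolynomial.aeval_def, MvPolynomial.eval₂_eq', pev, MvPolynomial.eval_eq',
      Polynomial.eval_finsetSum]
    refine Finset.sum_congr rfl fun d _ => ?_
    simp only [Fin.prod_univ_two, Polynomial.eval_mul, Polynomial.eval_pow, Polynomial.eval_add,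
      Polynomial.eval_C, Polynomial.eval_X, Polynomial.algebraMap_eq, PiLp.add_apply,
      PiLp.smul_apply, smul_eq_mul, mul_comm s]

theorem memLp_Ioo {f : ℝ → ℝ} (hf : Continuous f) (h : ℝ) :
    MemLp f 2 (volume.restrict (Ioo 0 h)) := by
  obtain ⟨C, hC⟩ := isCompact_Icc.exists_bound_of_continuousOn (hf.continuousOn (s := Icc 0 h))
  exact MemLp.of_bound hf.aestronglyMeasurable C ((ae_restrict_iff' measurableSet_Ioo).2
    (Eventually.of_forall fun s hs => hC s (Ioo_subset_Icc_self hs)))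

/-- If the moments of `q - d` against bubbles are small, then `q - d` is small, up to the distance
of `d` from polynomials. -/
theorem exists_edge_const (N : ℕ) : ∃ C, 0 < C ∧ ∀ (h Y : ℝ) (q p : Polynomial ℝ) (d : ℝ → ℝ),
    0 < h → q.natDegree ≤ N → p.natDegree ≤ N → MemLp d 2 (volume.restrict (Ioo 0 h)) →
    (∀ i ≤ N, (∫ s in Ioo 0 h, (q.eval s - d s) * rescale h (bub i) s) ^ 2 ≤ Y) →
    h * ∫ s in Ioo 0 h, (q.eval s - d s) ^ 2
      ≤ C * (Y + h * ∫ s in Ioo 0 h, (d s - p.eval s) ^ 2) := by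
  obtain ⟨C, hC, hm⟩ := exists_edge_moment_const N
  obtain ⟨B, hB, hbub, -⟩ := exists_bubble_bound N
  -- Split `q - d` as `(q - p) - (d - p)`. The polynomial `q - p` is bounded by its moments, those
  -- of `q - d` plus those of `d - p`, and each split doubles the constant.
  refine ⟨4 * C * (1 + B ^ 2) + 2, by positivity, fun h Y q p d hh hq hp hd hY => ?_⟩
  have hY0 : 0 ≤ Y := (sq_nonneg _).trans (hY 0 (Nat.zero_le _))
  set D := ∫ s in Ioo 0 h, (d s - p.eval s) ^ 2
  have hD0 : 0 ≤ D := integral_nonneg fun _ => sq_nonneg _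
  have hqL := memLp_Ioo q.continuous h
  have hpL := memLp_Ioo p.continuous h
  have h1 : h * ∫ s in Ioo 0 h, (q - p).eval s ^ 2 ≤ C * √(2 * Y + 2 * (B ^ 2 * h * D)) ^ 2 := by
    refine hm h _ (q - p) hh ((Polynomial.natDegree_sub_le _ _).trans (max_le hq hp))
      fun i hi => ?_
    have hα := memLp_Ioo ((tangTest_bub i).rescale hh).smooth.continuous h
    have i1 : Integrable (fun s => (q.eval s - d s) * rescale h (bub i) s)
        (volume.restrict (Ioo 0 h)) := (hqL.sub hd).integrable_mul hα
    have i2 : Integrable (fun s => (d s - p.eval s) * rescale h (bub i) s)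
        (volume.restrict (Ioo 0 h)) := (hd.sub hpL).integrable_mul hα
    have e : ∫ s in Ioo 0 h, (q - p).eval s * rescale h (bub i) s
        = (∫ s in Ioo 0 h, (q.eval s - d s) * rescale h (bub i) s)
          + ∫ s in Ioo 0 h, (d s - p.eval s) * rescale h (bub i) s := by
      rw [← integral_add i1 i2]
      congr 1; funext s; rw [Polynomial.eval_sub]; ring
    have h2 : (∫ s in Ioo 0 h, (d s - p.eval s) * rescale h (bub i) s) ^ 2 ≤ B ^ 2 * h * D := by
      refine (sq_integral_mul_le (hd.sub hpL) hα).trans ?_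
      have h3 : ∫ s in Ioo 0 h, rescale h (bub i) s ^ 2 ≤ B ^ 2 * h := by
        have := setIntegral_mono_on hα.integrable_sq (integrableOn_const (C := B ^ 2) (by simp))
          measurableSet_Ioo fun s _ => by
            rw [← sq_abs]
            exact pow_le_pow_left₀ (abs_nonneg _) (hbub i hi _).1 2
        refine this.trans (le_of_eq ?_)
        simp [hh.le, mul_comm]
      rw [mul_comm]
      exact mul_le_mul_of_nonneg_right h3 hD0
    rw [e]
    refine Real.abs_le_sqrt ?_
    have h4 := hY i hi
    generalize (∫ s in Ioo 0 h, (q.eval s - d s) * rescale h (bub i) s) = x at h4 ⊢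
    generalize (∫ s in Ioo 0 h, (d s - p.eval s) * rescale h (bub i) s) = y at h2 ⊢
    nlinarith [sq_nonneg (x - y)]
  rw [Real.sq_sqrt (by positivity)] at h1
  have h5 : ∫ s in Ioo 0 h, (q.eval s - d s) ^ 2
      ≤ 2 * (∫ s in Ioo 0 h, (q - p).eval s ^ 2) + 2 * D := by
    have hL := (hqL.sub hpL)
    have j1 : Integrable (fun s => (q - p).eval s ^ 2) (volume.restrict (Ioo 0 h)) :=
      (memLp_Ioo (q - p).continuous h).integrable_sq
    have j2 : Integrable (fun s => (d s - p.eval s) ^ 2) (volume.restrict (Ioo 0 h)) :=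
      (hd.sub hpL).integrable_sq
    rw [← integral_const_mul, ← integral_const_mul, ← integral_add (j1.const_mul 2)
      (j2.const_mul 2)]
    refine integral_mono (hqL.sub hd).integrable_sq ((j1.const_mul 2).add (j2.const_mul 2))
      fun s => ?_
    simp only [Polynomial.eval_sub]
    nlinarith [sq_nonneg ((q.eval s - p.eval s) + (d s - p.eval s))]
  have h6 := mul_le_mul_of_nonneg_left h5 hh.le
  have hhD : 0 ≤ h * D := by positivity
  nlinarith [mul_nonneg hC.le hY0, mul_nonneg (mul_nonneg hC.le (sq_nonneg B)) hY0,
    mul_nonneg hC.le hhD, mul_nonneg (mul_nonneg hC.le (sq_nonneg B)) hhD]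

/-! ### Reflection of the normal coordinate -/

theorem prof_neg {l : ℕ} (s : ℝ) : prof l (-s) = (-1) ^ l * prof l s := by
  simp only [prof, cutoff.neg]
  rw [neg_pow]; ring

theorem deriv_of_parity {β : ℝ → ℝ} {ε : ℝ} (h : ∀ s, β (-s) = ε * β s) (s : ℝ) :
    deriv β (-s) = -ε * deriv β s := by
  have h1 : deriv (fun s => β (-s)) s = -deriv β (-s) := deriv_comp_neg β s
  have h2 : deriv (fun s => β (-s)) s = ε * deriv β s := by
    rw [show (fun s => β (-s)) = fun s => ε * β s from funext h, deriv_const_mul_field]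
  linarith

theorem quad_neg_right (v w : E2) (M : M2) : quad v (-w) M = - quad v w M := by
  simp [quad, Fin.sum_univ_two]; ring

theorem quad_neg_left (v w : E2) (M : M2) : quad (-v) w M = - quad v w M := by
  simp [quad, Fin.sum_univ_two]; ring

/-- Reflecting the normal changes the test function only by its parity, so estimates from the two
sides of an edge refer to the same `φ` up to sign. -/
theorem ccPair_neg_of_parity {β : ℝ → ℝ} {ε : ℝ} (h : ∀ s, β (-s) = ε * β s) (a v w : E2)
    (α : ℝ → ℝ) (M : M2) (x : E2) :
    ccPair a v (-w) α β M x = ε * ccPair a v w α β M x := by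
  have h1 := deriv_of_parity h
  have h2 := deriv_of_parity h1
  simp only [ccPair, tens, coord_neg, h, h1, h2, quad_neg_left, quad_neg_right]
  ring

theorem ccPair_neg_prof (a v w : E2) (d : ℝ) (l : ℕ) (α : ℝ → ℝ) (M : M2) (x : E2) :
    ccPair a v (-w) α (rescale d (prof l)) M x
      = (-1) ^ l * ccPair a v w α (rescale d (prof l)) M x :=
  ccPair_neg_of_parity (fun s => by rw [rescale, neg_mul, prof_neg]; rfl) a v w α M x

/-! ### Sign, linearity and degree of the edge residuals -/

theorem pev_sub (p q : Poly2) (x : E2) : pev (p - q) x = pev p x - pev q x := by simp [pev]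

theorem edgeFlux_neg (v w : E2) (P : Matrix (Fin 2) (Fin 2) Poly2) (x : E2) :
    edgeFlux v (-w) P x = - edgeFlux v w P x := by
  simp only [edgeFlux, dirD, pquad, Fin.sum_univ_two, pev, map_add, map_mul, Derivation.leibniz,
    MvPolynomial.pderiv_C, MvPolynomial.eval_C, PiLp.neg_apply, smul_eq_mul, mul_zero, add_zero,
    zero_add]
  ring

theorem edgeFlux_sub (v w : E2) (P P' : Matrix (Fin 2) (Fin 2) Poly2) (x : E2) :
    edgeFlux v w (P - P') x = edgeFlux v w P x - edgeFlux v w P' x := by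
  simp only [edgeFlux, dirD, pquad, Fin.sum_univ_two, pev, map_add, map_sub, map_mul,
    Derivation.leibniz, MvPolynomial.pderiv_C, MvPolynomial.eval_C, smul_eq_mul, mul_zero,
    add_zero, zero_add, Matrix.sub_apply]
  ring

theorem pquad_sub (v w : E2) (P P' : Matrix (Fin 2) (Fin 2) Poly2) :
    pquad v w (P - P') = pquad v w P - pquad v w P' := by
  simp only [pquad, Fin.sum_univ_two, Matrix.sub_apply]; ring

theorem totalDegree_pquad_le {P : Matrix (Fin 2) (Fin 2) Poly2} {N : ℕ}
    (hP : ∀ i j, (P i j).totalDegree ≤ N) (v w : E2) : (pquad v w P).totalDegree ≤ N := by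
  refine MvPolynomial.totalDegree_finsetSum_le fun i _ =>
    MvPolynomial.totalDegree_finsetSum_le fun j _ => ?_
  refine (MvPolynomial.totalDegree_mul _ _).trans ?_
  rw [MvPolynomial.totalDegree_C, add_zero]
  refine (MvPolynomial.totalDegree_mul _ _).trans ?_
  rw [MvPolynomial.totalDegree_C, zero_add]
  exact hP i j

theorem totalDegree_dirD_le {p : Poly2} {N : ℕ} (hp : p.totalDegree ≤ N) (v : E2) :
    (dirD v p).totalDegree ≤ N := by
  refine MvPolynomial.totalDegree_finsetSum_le fun i _ => ?_
  refine (MvPolynomial.totalDegree_mul _ _).trans ?_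
  rw [MvPolynomial.totalDegree_C, zero_add]
  exact totalDegree_pderiv_le i hp

theorem exists_flux_poly {P : Matrix (Fin 2) (Fin 2) Poly2} {N : ℕ}
    (hP : ∀ i j, (P i j).totalDegree ≤ N) (a v w : E2) :
    ∃ q : Polynomial ℝ, q.natDegree ≤ N ∧ ∀ s, q.eval s = edgeFlux v w P (a + s • v) := by
  obtain ⟨q₁, h1, e1⟩ := exists_line_poly
    (totalDegree_dirD_le (totalDegree_pquad_le hP v v) w) a v
  obtain ⟨q₂, h2, e2⟩ := exists_line_poly
    (totalDegree_dirD_le (totalDegree_pquad_le hP v w) v) a v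
  refine ⟨q₁ - Polynomial.C 2 * q₂, (Polynomial.natDegree_sub_le _ _).trans (max_le h1
    ((Polynomial.natDegree_C_mul_le _ _).trans h2)), fun s => ?_⟩
  simp [e1, e2, edgeFlux]

theorem integrable_poly_mul (q : Polynomial ℝ) {h : ℝ} (hh : 0 < h) (i : ℕ) :
    Integrable (fun s => q.eval s * rescale h (bub i) s) (volume.restrict (Ioo 0 h)) :=
  (memLp_Ioo q.continuous h).integrable_mul
    (memLp_Ioo ((tangTest_bub i).rescale hh).smooth.continuous h)

/-! ### Estimates on interior and Dirichlet edges -/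

/-- The jump estimates on an interior edge. -/
theorem exists_interior_const (N : ℕ) {δ : ℝ} (R : ℝ) (hδ : 0 < δ) : ∃ C, 0 < C ∧
    ∀ (S S' : Set E2) (a v w : E2) (h : ℝ) (P P' : Matrix (Fin 2) (Fin 2) Poly2) (G : E2 → M2),
    Fits S a v w h δ R → Fits S' a v (-w) h δ R → P.IsSymm → P'.IsSymm →
    (∀ i j, (P i j).totalDegree ≤ N) → (∀ i j, (P' i j).totalDegree ≤ N) →
    (∀ i j, MemLp (fun x => G x i j) 2 (volume.restrict S)) →
    (∀ i j, MemLp (fun x => G x i j) 2 (volume.restrict S')) →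
    (∀ i j, ∫ x in S, ccPair a v w (rescale h (bub i)) (rescale (δ * h) (bub j)) (G x) x = 0) →
    (∀ i j, ∫ x in S', ccPair a v (-w) (rescale h (bub i)) (rescale (δ * h) (bub j)) (G x) x
      = 0) →
    (∀ i l, (∫ x in S, ccPair a v w (rescale h (bub i)) (rescale (δ * h) (prof l)) (G x) x)
      + ∫ x in S', ccPair a v w (rescale h (bub i)) (rescale (δ * h) (prof l)) (G x) x = 0) →
    (h * ∫ s in Ioo 0 h, pev (pquad v v (P - P')) (a + s • v) ^ 2
      ≤ C * (strainError S G P + strainError S' G P')) ∧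
    (h ^ 3 * ∫ s in Ioo 0 h, edgeFlux v w (P - P') (a + s • v) ^ 2
      ≤ C * (strainError S G P + strainError S' G P')) := by
  obtain ⟨C, hC, hloc⟩ := exists_local_const N δ R
  obtain ⟨D, hD, hedge⟩ := exists_edge_const N
  refine ⟨D * (2 * C * (1 + δ ^ 2)), by positivity, fun S S' a v w h P P' G F F' hP hP' hdeg hdeg'
    hG hG' hz hz' hsum => ?_⟩
  have hh := F.len_pos
  obtain ⟨-, h1⟩ := hloc S a v w h P G F hP hdeg hG hz
  obtain ⟨-, h2⟩ := hloc S' a v (-w) h P' G F' hP' hdeg' hG' hz'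
  set A := strainError S G P
  set A' := strainError S' G P'
  have hA : 0 ≤ A := strainError_nonneg _ _ _
  have hA' : 0 ≤ A' := strainError_nonneg _ _ _
  obtain ⟨q, hq, hqe⟩ := exists_line_poly (totalDegree_pquad_le hdeg v v) a v
  obtain ⟨q', hq', hqe'⟩ := exists_line_poly (totalDegree_pquad_le hdeg' v v) a v
  obtain ⟨r, hr, hre⟩ := exists_flux_poly hdeg a v w
  obtain ⟨r', hr', hre'⟩ := exists_flux_poly hdeg' a v w
  have hnn : ∀ {x y z w : ℝ}, x ^ 2 ≤ z → y ^ 2 ≤ w → (x + y) ^ 2 ≤ 2 * z + 2 * w ∧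
      (x - y) ^ 2 ≤ 2 * z + 2 * w := fun {x y z w} hx hy =>
    ⟨by nlinarith [sq_nonneg (x - y)], by nlinarith [sq_nonneg (x + y)]⟩
  constructor
  · have key := hedge h (δ ^ 2 * (2 * (C * A) + 2 * (C * A'))) (q - q') 0 (fun _ => 0) hh
      ((Polynomial.natDegree_sub_le _ _).trans (max_le hq hq')) (by simp) (by simp) fun i hi => ?_
    · simp only [Polynomial.eval_sub, sub_zero, hqe, hqe', Polynomial.eval_zero] at key
      simp only [pquad_sub, pev_sub]
      refine key.trans ?_
      simp only [ne_eq, OfNat.ofNat_ne_zero, not_false_eq_true, zero_pow, integral_zero, mul_zero,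
        add_zero]
      rw [mul_assoc]
      refine mul_le_mul_of_nonneg_left ?_ hD.le
      nlinarith [mul_nonneg hC.le hA, mul_nonneg hC.le hA']
    · have b1 := h1 i hi 1 le_rfl
      have b2 := h2 i hi 1 le_rfl
      simp only [ccPair_neg_prof, prof_one_zero, deriv_prof_one, zero_mul, sub_zero, mul_one,
        pow_one, integral_const_mul] at b1 b2
      have hs := hsum i 1
      simp only [← hqe, ← hqe'] at b1 b2
      simp only [Polynomial.eval_sub, sub_zero, sub_mul]
      rw [integral_sub (integrable_poly_mul q hh i) (integrable_poly_mul q' hh i)]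
      generalize (∫ x in S, ccPair a v w (rescale h (bub i)) (rescale (δ * h) (prof 1)) (G x) x)
        = X at *
      generalize (∫ x in S', ccPair a v w (rescale h (bub i)) (rescale (δ * h) (prof 1)) (G x) x)
        = X' at *
      generalize (∫ s in Ioo 0 h, q.eval s * rescale h (bub i) s) = Q at *
      generalize (∫ s in Ioo 0 h, q'.eval s * rescale h (bub i) s) = Q' at *
      rw [← mul_pow] at b1 b2
      have := (hnn b1 b2).2
      -- The odd profile flips sign under reflection, so the two one-sided estimates are subtracted;
      -- `X' = -X` removes the exact solution and leaves the jump.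
      have e : h * (X + (δ * h)⁻¹ * Q) - h * (-1 * X' + (δ * h)⁻¹ * Q') = δ⁻¹ * (Q - Q') := by
        have : X' = -X := by linarith
        rw [this]; field_simp; ring
      rw [e, mul_pow, inv_pow, inv_mul_le_iff₀ (by positivity)] at this
      exact this
  · have key := hedge h ((h ^ 2)⁻¹ * (2 * (C * A) + 2 * (C * A'))) (r - r') 0 (fun _ => 0) hh
      ((Polynomial.natDegree_sub_le _ _).trans (max_le hr hr')) (by simp) (by simp) fun i hi => ?_
    · simp only [Polynomial.eval_sub, sub_zero, hre, hre', Polynomial.eval_zero] at key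
      simp only [edgeFlux_sub]
      simp only [ne_eq, OfNat.ofNat_ne_zero, not_false_eq_true, zero_pow, integral_zero, mul_zero,
        add_zero] at key
      have key2 := mul_le_mul_of_nonneg_left key (sq_nonneg h)
      have e : h ^ 2 * (D * ((h ^ 2)⁻¹ * (2 * (C * A) + 2 * (C * A'))))
          = D * (2 * (C * A) + 2 * (C * A')) := by field_simp
      rw [e, ← mul_assoc] at key2
      rw [show h ^ 3 = h ^ 2 * h by ring]
      refine key2.trans ?_
      rw [mul_assoc D]
      refine mul_le_mul_of_nonneg_left ?_ hD.le
      nlinarith [mul_nonneg (mul_nonneg hC.le hA) (sq_nonneg δ),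
        mul_nonneg (mul_nonneg hC.le hA') (sq_nonneg δ)]
    · have b1 := h1 i hi 0 zero_le_one
      have b2 := h2 i hi 0 zero_le_one
      simp only [ccPair_neg_prof, prof_zero_zero, deriv_prof_zero, one_mul, zero_mul, mul_zero,
        pow_zero, add_zero, edgeFlux_neg, neg_mul, integral_neg, sub_neg_eq_add] at b1 b2
      have hs := hsum i 0
      simp only [← hre, ← hre'] at b1 b2
      simp only [Polynomial.eval_sub, sub_zero, sub_mul]
      rw [integral_sub (integrable_poly_mul r hh i) (integrable_poly_mul r' hh i)]
      generalize (∫ x in S, ccPair a v w (rescale h (bub i)) (rescale (δ * h) (prof 0)) (G x) x)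
        = X at *
      generalize (∫ x in S', ccPair a v w (rescale h (bub i)) (rescale (δ * h) (prof 0)) (G x) x)
        = X' at *
      generalize (∫ s in Ioo 0 h, r.eval s * rescale h (bub i) s) = Q at *
      generalize (∫ s in Ioo 0 h, r'.eval s * rescale h (bub i) s) = Q' at *
      rw [← mul_pow] at b1 b2
      have := (hnn b1 b2).1
      -- The even profile keeps its sign while the flux changes sign with the normal, so here the
      -- two estimates are added.
      have e : h * (X - Q) + h * (X' + Q') = - (h * (Q - Q')) := by
        have : X' = -X := by linarith
        rw [this]; ring
      rw [e, neg_sq, mul_pow] at this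
      rw [le_inv_mul_iff₀ (by positivity)]
      exact this

/-- The estimates on a Dirichlet edge. -/
theorem exists_dirichlet_const (N : ℕ) {δ : ℝ} (R : ℝ) (hδ : 0 < δ) : ∃ C, 0 < C ∧
    ∀ (S : Set E2) (a v w : E2) (h : ℝ) (P : Matrix (Fin 2) (Fin 2) Poly2) (G : E2 → M2)
      (d₁ d₂ : ℝ → ℝ) (p₁ p₂ : Polynomial ℝ),
    Fits S a v w h δ R → P.IsSymm → (∀ i j, (P i j).totalDegree ≤ N) →
    (∀ i j, MemLp (fun x => G x i j) 2 (volume.restrict S)) →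
    (∀ i j, ∫ x in S, ccPair a v w (rescale h (bub i)) (rescale (δ * h) (bub j)) (G x) x = 0) →
    MemLp d₁ 2 (volume.restrict (Ioo 0 h)) → MemLp d₂ 2 (volume.restrict (Ioo 0 h)) →
    p₁.natDegree ≤ N → p₂.natDegree ≤ N →
    (∀ i l, ∫ x in S, ccPair a v w (rescale h (bub i)) (rescale (δ * h) (prof l)) (G x) x
      = -((δ * h)⁻¹ * deriv (prof l) 0) * (∫ s in Ioo 0 h, d₁ s * rescale h (bub i) s)
        - prof l 0 * ∫ s in Ioo 0 h, d₂ s * rescale h (bub i) s) →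
    (h * ∫ s in Ioo 0 h, (pev (pquad v v P) (a + s • v) - d₁ s) ^ 2
      ≤ C * (strainError S G P + h * ∫ s in Ioo 0 h, (d₁ s - p₁.eval s) ^ 2)) ∧
    (h ^ 3 * ∫ s in Ioo 0 h, (edgeFlux v w P (a + s • v) + d₂ s) ^ 2
      ≤ C * (strainError S G P + h ^ 3 * ∫ s in Ioo 0 h, (d₂ s - p₂.eval s) ^ 2)) := by
  obtain ⟨C, hC, hloc⟩ := exists_local_const N δ R
  obtain ⟨D, hD, hedge⟩ := exists_edge_const N
  refine ⟨D * (C * (1 + δ ^ 2) + 1), by positivity, fun S a v w h P G d₁ d₂ p₁ p₂ F hP hdeg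
    hG hz hd₁ hd₂ hp₁ hp₂ hdir => ?_⟩
  have hh := F.len_pos
  obtain ⟨-, h1⟩ := hloc S a v w h P G F hP hdeg hG hz
  set A := strainError S G P
  have hA : 0 ≤ A := strainError_nonneg _ _ _
  obtain ⟨q, hq, hqe⟩ := exists_line_poly (totalDegree_pquad_le hdeg v v) a v
  obtain ⟨r, hr, hre⟩ := exists_flux_poly hdeg a v w
  have hid : ∀ {d : ℝ → ℝ}, MemLp d 2 (volume.restrict (Ioo 0 h)) → ∀ i,
      Integrable (fun s => d s * rescale h (bub i) s) (volume.restrict (Ioo 0 h)) :=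
    fun hd i => hd.integrable_mul
      (memLp_Ioo ((tangTest_bub i).rescale hh).smooth.continuous h)
  have hO₁ : 0 ≤ ∫ s in Ioo 0 h, (d₁ s - p₁.eval s) ^ 2 := integral_nonneg fun _ => sq_nonneg _
  have hO₂ : 0 ≤ ∫ s in Ioo 0 h, (d₂ s - p₂.eval s) ^ 2 := integral_nonneg fun _ => sq_nonneg _
  have hCA : 0 ≤ C * A := mul_nonneg hC.le hA
  constructor
  · have key := hedge h (δ ^ 2 * (C * A)) q p₁ d₁ hh hq hp₁ hd₁ fun i hi => ?_
    · simp only [hqe] at key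
      refine key.trans ?_
      rw [mul_assoc]
      refine mul_le_mul_of_nonneg_left ?_ hD.le
      set O := h * ∫ s in Ioo 0 h, (d₁ s - p₁.eval s) ^ 2
      have hO : 0 ≤ O := mul_nonneg hh.le hO₁
      nlinarith [mul_nonneg hC.le hO, mul_nonneg (mul_nonneg hC.le hO) (sq_nonneg δ)]
    · have b1 := h1 i hi 1 le_rfl
      rw [hdir i 1] at b1
      simp only [prof_one_zero, deriv_prof_one, zero_mul, sub_zero, mul_one, ← hqe] at b1
      simp only [sub_mul]
      rw [integral_sub (integrable_poly_mul q hh i) (hid hd₁ i)]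
      generalize (∫ s in Ioo 0 h, q.eval s * rescale h (bub i) s) = Q at *
      generalize (∫ s in Ioo 0 h, d₁ s * rescale h (bub i) s) = X at *
      have e : h ^ 2 * (-(δ * h)⁻¹ * X + (δ * h)⁻¹ * Q) ^ 2 = (δ ^ 2)⁻¹ * (Q - X) ^ 2 := by
        field_simp; ring
      rw [e, inv_mul_le_iff₀ (by positivity)] at b1
      exact b1
  -- The general estimate concerns a difference while the flux is added to `d₂`, hence the signs.
  · have key := hedge h ((h ^ 2)⁻¹ * (C * A)) r (-p₂) (fun s => -d₂ s) hh hr (by simpa using hp₂)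
      hd₂.neg fun i hi => ?_
    · simp only [hre, sub_neg_eq_add, Polynomial.eval_neg] at key
      have e0 : ∀ s, (-d₂ s + p₂.eval s) ^ 2 = (d₂ s - p₂.eval s) ^ 2 := fun s => by ring
      simp only [e0] at key
      have key2 := mul_le_mul_of_nonneg_left key (sq_nonneg h)
      set O := ∫ s in Ioo 0 h, (d₂ s - p₂.eval s) ^ 2
      have e : h ^ 2 * (D * ((h ^ 2)⁻¹ * (C * A) + h * O)) = D * (C * A + h ^ 3 * O) := by
        field_simp
      rw [e, ← mul_assoc] at key2
      rw [show h ^ 3 * ∫ s in Ioo 0 h, (edgeFlux v w P (a + s • v) + d₂ s) ^ 2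
        = h ^ 2 * h * ∫ s in Ioo 0 h, (edgeFlux v w P (a + s • v) + d₂ s) ^ 2 by ring]
      refine key2.trans ?_
      rw [mul_assoc D]
      refine mul_le_mul_of_nonneg_left ?_ hD.le
      have hO : 0 ≤ h ^ 3 * O := mul_nonneg (by positivity) hO₂
      nlinarith [mul_nonneg hC.le hO, mul_nonneg (mul_nonneg hC.le hO) (sq_nonneg δ),
        mul_nonneg hCA (sq_nonneg δ)]
    · have b1 := h1 i hi 0 zero_le_one
      rw [hdir i 0] at b1
      simp only [prof_zero_zero, deriv_prof_zero, one_mul, zero_mul, mul_zero, add_zero, neg_zero,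
        zero_sub, ← hre] at b1
      simp only [sub_neg_eq_add, add_mul]
      rw [integral_add (integrable_poly_mul r hh i) (hid hd₂ i)]
      generalize (∫ s in Ioo 0 h, r.eval s * rescale h (bub i) s) = Q at *
      generalize (∫ s in Ioo 0 h, d₂ s * rescale h (bub i) s) = X at *
      rw [le_inv_mul_iff₀ (by positivity)]
      refine le_trans (le_of_eq ?_) b1
      ring

/-! ### Lipschitz domains and triangulations -/

/-- A Lipschitz domain lies on one side of its boundary. -/
theorem HasLipschitzBoundary.interior_closure_subset {Ω : Set E2} (hL : HasLipschitzBoundary Ω) :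
    interior (closure Ω) ⊆ Ω := by
  intro x hx
  by_contra hxΩ
  obtain ⟨U, hU, L, φ, K, hφ, h⟩ :=
    hL x ⟨interior_subset hx, fun h => hxΩ (interior_subset h)⟩
  have hxφ : φ (L x 0) ≤ L x 1 := not_lt.1 fun h' => hxΩ ((h x (mem_of_mem_nhds hU)).2 h')
  -- A point outside `Ω` is on or above the graph. Moving it up slightly keeps it in the interior of
  -- the closure, yet strictly above the graph, where nearby points of `Ω` cannot exist.
  set e : E2 := EuclideanSpace.single 1 1
  have hcont : Continuous fun ε : ℝ => L.symm (L x + ε • e) :=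
    L.symm.continuous.comp (by fun_prop)
  have h0 : L.symm (L x + (0 : ℝ) • e) = x := by simp
  have hev : ∀ᶠ ε in 𝓝[>] (0 : ℝ), L.symm (L x + ε • e) ∈ interior U ∩ interior (closure Ω) := by
    refine nhdsWithin_le_nhds (hcont.continuousAt.eventually_mem ?_)
    rw [h0]
    exact inter_mem (interior_mem_nhds.2 hU) (isOpen_interior.mem_nhds hx)
  obtain ⟨ε, hm, hε⟩ := (hev.and self_mem_nhdsWithin).exists
  have hopen : IsOpen {z | φ (L z 0) < L z 1} := by
    have hL' := L.continuous
    have hφ' := hφ.continuous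
    exact isOpen_lt (by fun_prop) (by fun_prop)
  obtain ⟨z, ⟨hzU, hz⟩, hzΩ⟩ := mem_closure_iff.1 (interior_subset hm.2) _
    (isOpen_interior.inter hopen) ⟨hm.1, by
      have : (0 : ℝ) < ε := hε
      simp [e]; linarith⟩
  exact lt_asymm hz ((h z (interior_subset hzU)).1 hzΩ)

theorem convex_tri (t : Finset E2) : Convex ℝ (tri t) := convex_convexHull ℝ _

theorem interior_tri_ae_eq (t : Finset E2) : interior (tri t) =ᵐ[volume] tri t :=
  interior_ae_eq_of_null_frontier ((convex_tri t).addHaar_frontier volume)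

theorem volume_convexHull_eq_zero {s : Set E2} {p q : E2} (hs : s ⊆ {p, q}) :
    volume (convexHull ℝ s) = 0 := by
  refine measure_mono_null ((convexHull_mono hs).trans (convexHull_subset_affineSpan _))
    (Measure.addHaar_affineSubspace volume _ fun htop => ?_)
  have h1 := collinear_iff_finrank_le_one.1 (collinear_pair ℝ p q)
  rw [← direction_affineSpan, htop, AffineSubspace.direction_top, finrank_top] at h1
  simp at h1

namespace Mesh

variable {Ω : Set E2} (𝒯 : Mesh Ω) {t t' : Finset E2}

theorem tri_subset_closure (ht : t ∈ 𝒯.T) : tri t ⊆ closure Ω := by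
  rw [← 𝒯.cover]; exact subset_biUnion_of_mem (u := fun t => tri t) ht

/-- The mesh covers only the closure of `Ω`; the Lipschitz boundary excludes slits along a common
edge, so a test function living on both triangles is admissible in `Ω`. -/
theorem interior_union_subset (hL : HasLipschitzBoundary Ω) (ht : t ∈ 𝒯.T) (ht' : t' ∈ 𝒯.T) :
    interior (tri t ∪ tri t') ⊆ Ω :=
  (interior_mono (union_subset (𝒯.tri_subset_closure ht) (𝒯.tri_subset_closure ht'))).trans
    hL.interior_closure_subset

theorem interior_tri_subset (hL : HasLipschitzBoundary Ω) (ht : t ∈ 𝒯.T) :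
    interior (tri t) ⊆ Ω := by
  simpa using 𝒯.interior_union_subset hL ht ht

theorem tri_ae_le (hL : HasLipschitzBoundary Ω) (ht : t ∈ 𝒯.T) : tri t ≤ᵐ[volume] Ω :=
  (interior_tri_ae_eq t).symm.le.trans (𝒯.interior_tri_subset hL ht).eventuallyLE

/-- Distinct triangles share at most two vertices, so by regularity they meet within a segment. -/
theorem aedisjoint_tri (ht : t ∈ 𝒯.T) (ht' : t' ∈ 𝒯.T) (h : t ≠ t') :
    AEDisjoint volume (tri t) (tri t') := by
  classical
  have hns : ¬ t ⊆ t' := fun hs => h (Finset.eq_of_subset_of_card_le hs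
    (by rw [𝒯.card_eq t ht, 𝒯.card_eq t' ht']))
  obtain ⟨x, hx, hx'⟩ := Finset.not_subset.1 hns
  obtain ⟨p, q, -, hpq⟩ := Finset.card_eq_two.1
    (show (t.erase x).card = 2 by rw [Finset.card_erase_of_mem hx, 𝒯.card_eq t ht])
  rw [AEDisjoint, 𝒯.regular t ht t' ht']
  refine volume_convexHull_eq_zero (p := p) (q := q) fun y hy => ?_
  have : y ∈ t.erase x := Finset.mem_erase.2 ⟨fun h => hx' (h ▸ hy.2), hy.1⟩
  rw [hpq] at this
  simpa using this

theorem disjoint_interior (ht : t ∈ 𝒯.T) (ht' : t' ∈ 𝒯.T) (h : t ≠ t') :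
    Disjoint (interior (tri t)) (interior (tri t')) := by
  rw [disjoint_iff_inter_eq_empty,
    ← (isOpen_interior.inter isOpen_interior).measure_eq_zero_iff volume]
  exact measure_mono_null (inter_subset_inter interior_subset interior_subset)
    (𝒯.aedisjoint_tri ht ht' h)

theorem fn_eq (ht : t ∈ 𝒯.T) (p : PW) {x : E2} (hx : x ∈ interior (tri t)) :
    𝒯.fn p x = pev (p t) x := by
  rw [fn, Finset.sum_eq_single t, indicator_of_mem hx]
  · intro t' ht' hne
    exact indicator_of_notMem
      (fun hx' => disjoint_left.1 (𝒯.disjoint_interior ht' ht hne) hx' hx) _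
  · exact fun h => absurd ht h

theorem matFn_eq (ht : t ∈ 𝒯.T) (p : PWMat) {x : E2} (hx : x ∈ interior (tri t)) :
    𝒯.matFn p x = evM (p t) x := by
  ext i j
  exact 𝒯.fn_eq ht _ hx

theorem sum_setIntegral_le (hL : HasLipschitzBoundary Ω) {F : E2 → ℝ}
    (hF : IntegrableOn F Ω) (h0 : ∀ x, 0 ≤ F x) :
    ∑ t ∈ 𝒯.T, ∫ x in interior (tri t), F x ≤ ∫ x in Ω, F x := by
  have hdisj : (𝒯.T : Set (Finset E2)).Pairwise
      (Function.onFun Disjoint fun t => interior (tri t)) :=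
    fun t ht t' ht' h => 𝒯.disjoint_interior ht ht' h
  have hInt : ∀ t ∈ 𝒯.T, IntegrableOn F (interior (tri t)) volume :=
    fun t ht => hF.mono_set (𝒯.interior_tri_subset hL ht)
  have hsub : (⋃ t ∈ 𝒯.T, interior (tri t)) ⊆ Ω :=
    iUnion₂_subset fun t ht => 𝒯.interior_tri_subset hL ht
  calc ∑ t ∈ 𝒯.T, ∫ x in interior (tri t), F x
      = ∫ x in ⋃ t ∈ 𝒯.T, interior (tri t), F x := by
        refine (integral_biUnion_finset 𝒯.T (fun _ _ => ?_) hdisj hInt).symm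
        exact isOpen_interior.measurableSet
    _ ≤ ∫ x in Ω, F x := by
        refine setIntegral_mono_set hF ?_ ?_
        · exact Eventually.of_forall h0
        · exact hsub.eventuallyLE

theorem left_spec {e : Edge} (h : ∃ t ∈ 𝒯.T, LiesLeft t e) :
    𝒯.left e ∈ 𝒯.T ∧ LiesLeft (𝒯.left e) e := by
  rw [left, dif_pos h]; exact h.choose_spec

theorem left_spec_of_mem {e : Edge} (h : e ∈ orientedEdges 𝒯.T) :
    𝒯.left e ∈ 𝒯.T ∧ LiesLeft (𝒯.left e) e := by
  classical
  rw [orientedEdges, Finset.mem_filter] at h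
  exact 𝒯.left_spec h.2

theorem left_spec_dirichlet {ΓD : Set E2} {e : Edge} (h : e ∈ 𝒯.dirichletEdges ΓD) :
    𝒯.left e ∈ 𝒯.T ∧ LiesLeft (𝒯.left e) e ∧ Edge.seg e ⊆ ΓD := by
  classical
  rw [dirichletEdges, Finset.mem_filter, boundaryEdges, Finset.mem_filter] at h
  have h2 := 𝒯.left_spec_of_mem h.1.1
  exact ⟨h2.1, h2.2, h.2⟩

theorem left_spec_interior {e : Edge} (h : e ∈ 𝒯.interiorEdges) :
    (𝒯.left e ∈ 𝒯.T ∧ LiesLeft (𝒯.left e) e) ∧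
      (𝒯.left e.swap ∈ 𝒯.T ∧ LiesLeft (𝒯.left e.swap) e.swap) := by
  classical
  have h1 := 𝒯.interiorEdges_subset h
  rw [interiorEdgesBoth, Finset.mem_filter] at h1
  exact ⟨𝒯.left_spec_of_mem h1.1, 𝒯.left_spec h1.2⟩

/-- A triangle has at most nine pairs of vertices. -/
theorem sum_edges_le {F : Finset Edge} {ℓ : Edge → Finset E2} {A : Finset E2 → ℝ}
    (hA : ∀ t, 0 ≤ A t) (hℓ : ∀ e ∈ F, ℓ e ∈ 𝒯.T ∧ e.1 ∈ ℓ e ∧ e.2 ∈ ℓ e) :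
    ∑ e ∈ F, A (ℓ e) ≤ 9 * ∑ t ∈ 𝒯.T, A t := by
  classical
  calc ∑ e ∈ F, A (ℓ e)
      ≤ ∑ e ∈ F, ∑ t ∈ 𝒯.T, if e ∈ t ×ˢ t then A t else 0 := by
        refine Finset.sum_le_sum fun e he => ?_
        obtain ⟨h1, h2⟩ := hℓ e he
        refine le_trans (le_of_eq ?_) (Finset.single_le_sum
          (f := fun t => if e ∈ t ×ˢ t then A t else 0) (fun t _ => ?_) h1)
        · simp [Finset.mem_product, h2]
        · split_ifs; exacts [hA t, le_rfl]
    _ = ∑ t ∈ 𝒯.T, ∑ e ∈ F, if e ∈ t ×ˢ t then A t else 0 := Finset.sum_comm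
    _ ≤ ∑ t ∈ 𝒯.T, 9 * A t := by
        refine Finset.sum_le_sum fun t ht => ?_
        rw [← Finset.sum_filter, Finset.sum_const, nsmul_eq_mul]
        refine mul_le_mul_of_nonneg_right ?_ (hA t)
        have : (F.filter fun e => e ∈ t ×ˢ t).card ≤ (t ×ˢ t).card :=
          Finset.card_le_card fun e he => (Finset.mem_filter.1 he).2
        rw [Finset.card_product, 𝒯.card_eq t ht] at this
        exact_mod_cast this
    _ = _ := (Finset.mul_sum ..).symm

end Mesh

/-! ### Test functions supported in the domain -/

section support

variable {S S' Ω : Set E2} {a v w : E2} {h δ R : ℝ} {u : E2 → E2} {Du : E2 → M2}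

theorem Fits.box_bub_subset (F : Fits S a v w h δ R) (i j : ℕ) :
    box a v w (rescale h (bub i)) (rescale (δ * h) (bub j)) ⊆ interior S := by
  have hh := F.len_pos
  have hd : 0 < δ * h := mul_pos F.depth_pos hh
  refine Subset.trans (fun x hx => ?_) (interior_maximal (s := S)
    (t := coord a v ⁻¹' Ioo (3 / 8 * h) (5 / 8 * h) ∩ coord a w ⁻¹' Ioo 0 (δ * h))
    (fun x hx => F.mem x (Ioo_subset_Icc_self hx.1) (Ioo_subset_Icc_self hx.2))
    ((isOpen_Ioo.preimage (contDiff_coord a v).continuous).inter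
      (isOpen_Ioo.preimage (contDiff_coord a w).continuous)))
  refine ⟨tsupport_rescale_subset_Ioo hh (tsupport_bub_subset_Ioo i) hx.1, ?_⟩
  have := tsupport_rescale_subset_Ioo hd (tsupport_bub_subset_Ioo j) hx.2
  exact ⟨by linarith [this.1], by linarith [this.2]⟩

theorem Fits.box_prof_subset (F : Fits S a v w h δ R) (F' : Fits S' a v (-w) h δ R) (i j : ℕ) :
    box a v w (rescale h (bub i)) (rescale (δ * h) (prof j)) ⊆ interior (S ∪ S') := by
  have hh := F.len_pos
  have hd : 0 < δ * h := mul_pos F.depth_pos hh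
  refine Subset.trans (fun x hx => ?_) (interior_maximal (s := S ∪ S')
    (t := coord a v ⁻¹' Ioo (3 / 8 * h) (5 / 8 * h) ∩ coord a w ⁻¹' Ioo (-(δ * h)) (δ * h))
    (fun x hx => ?_)
    ((isOpen_Ioo.preimage (contDiff_coord a v).continuous).inter
      (isOpen_Ioo.preimage (contDiff_coord a w).continuous)))
  · refine ⟨tsupport_rescale_subset_Ioo hh (tsupport_bub_subset_Ioo i) hx.1, ?_⟩
    have := tsupport_rescale_subset_Ioo hd (tsupport_prof_subset_Ioo j) hx.2
    exact ⟨by linarith [this.1], by linarith [this.2]⟩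
  · rcases le_total 0 (coord a w x) with h0 | h0
    · exact Or.inl (F.mem x (Ioo_subset_Icc_self hx.1) ⟨h0, hx.2.2.le⟩)
    · refine Or.inr (F'.mem x (Ioo_subset_Icc_self hx.1) ?_)
      rw [coord_neg]
      exact ⟨by linarith, by linarith [hx.2.1]⟩

/-- The middle of the far side of the rectangle lies in `S` but strictly outside the opposite half
plane. -/
theorem Fits.ne_of_neg (F : Fits S a v w h δ R) (F' : Fits S' a v (-w) h δ R) : S ≠ S' := by
  rintro rfl
  have hh := F.len_pos
  have hd : 0 < δ * h := mul_pos F.depth_pos hh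
  have hx : framePt a v w (h / 2, δ * h) ∈ S := by
    refine F.mem _ ?_ ?_
    · rw [coord_framePt_left F.frame]; exact ⟨by linarith, by linarith⟩
    · rw [coord_framePt_right F.frame]; exact ⟨hd.le, le_rfl⟩
  have h1 : 0 ≤ coord a (-w) (framePt a v w (h / 2, δ * h)) := F'.subset hx
  rw [coord_neg, coord_framePt_right F.frame] at h1
  linarith

theorem Fits.integral_ccPair_bub (F : Fits S a v w h δ R) (hS : interior S ⊆ Ω)
    (hu : ∀ i, IsH1 Ω (fun x => u x i) (fun x => Du x i)) (i j : ℕ) :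
    ∫ x in S, ccPair a v w (rescale h (bub i)) (rescale (δ * h) (bub j)) (Du x) x = 0 := by
  have hb := F.box_bub_subset i j
  have hh := F.len_pos
  have hα := (tangTest_bub i).rescale hh
  have hβ := (normTest_bub j).rescale (mul_pos F.depth_pos hh)
  rw [setIntegral_ccPair (hb.trans interior_subset), ← setIntegral_ccPair (hb.trans hS)]
  exact integral_ccPair_eq_zero hu F.frame hα.smooth hα.compact hβ.smooth hβ.compact (hb.trans hS)

/-- The two rectangles together form a neighbourhood of the middle of the edge which contains the
support, so Curl Curl `φ` is orthogonal to `Du` over the union. -/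
theorem Fits.integral_ccPair_prof (F : Fits S a v w h δ R) (F' : Fits S' a v (-w) h δ R)
    (hS : interior (S ∪ S') ⊆ Ω) (hd : AEDisjoint volume S S')
    (hG : ∀ i j, MemLp (fun x => Du x i j) 2 (volume.restrict S))
    (hG' : ∀ i j, MemLp (fun x => Du x i j) 2 (volume.restrict S'))
    (hu : ∀ i, IsH1 Ω (fun x => u x i) (fun x => Du x i)) (i l : ℕ) :
    (∫ x in S, ccPair a v w (rescale h (bub i)) (rescale (δ * h) (prof l)) (Du x) x)
      + ∫ x in S', ccPair a v w (rescale h (bub i)) (rescale (δ * h) (prof l)) (Du x) x = 0 := by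
  have hb := F.box_prof_subset F' i l
  have hh := F.len_pos
  have hα := (tangTest_bub i).rescale hh
  have hβ := (normTest_prof l).rescale (mul_pos F.depth_pos hh)
  have hI' : IntegrableOn (fun x =>
      ccPair a v w (rescale h (bub i)) (rescale (δ * h) (prof l)) (Du x) x) S' := by
    simp only [ccPair_eq_sum]
    exact integrable_finsetSum _ fun p _ => integrable_finsetSum _ fun q _ =>
      (hG' p q).integrable_mul (F'.memLp (continuous_ccCoef a v w hα.smooth hβ.smooth p q))
  rw [← setIntegral_union₀ hd F'.isCompact.measurableSet.nullMeasurableSet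
    (F.integrable_ccPair hα.smooth hβ.smooth hG) hI',
    setIntegral_ccPair (hb.trans interior_subset), ← setIntegral_ccPair (hb.trans hS)]
  exact integral_ccPair_eq_zero hu F.frame hα.smooth hα.compact hβ.smooth hβ.compact (hb.trans hS)

end support

/-! ### Edge terms of the estimator -/

theorem tanTan_eq (A : Matrix (Fin 2) (Fin 2) Poly2) (e : Edge) (s : ℝ) :
    tanTan A e s = pev (pquad (Edge.tau e) (Edge.tau e) A) (Edge.pt e s) := by
  simp [tanTan, pquad, pev]

/-- Both sides are `∂_ν (τ·Aτ) - 2 ∂_τ (τ·Aν)`, since `τ·rot A = ∂_ν (τ·Aτ) - ∂_τ (τ·Aν)`. This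
links the estimator to Green's identity, whose inward normal is `-ν`. -/
theorem tanRot_sub_dsPair {e : Edge} (he : 0 < Edge.len e) (A : Matrix (Fin 2) (Fin 2) Poly2)
    (s : ℝ) : tanRot A e s - dsPair (Edge.tau e) (Edge.nu e) A e s
      = - edgeFlux (Edge.tau e) (-Edge.nu e) A (Edge.pt e s) := by
  have h := (Edge.isFrame he).vv
  simp only [tanRot, dsPair, edgeFlux, dirD, tanDeriv, pquad, rowRot, rot, pev, Fin.sum_univ_two,
    map_add, map_sub, map_mul, MvPolynomial.eval_C, MvPolynomial.pderiv_mul, MvPolynomial.pderiv_C,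
    map_zero, Edge.nu, PiLp.neg_apply, map_neg]
  simp only [Matrix.cons_val_zero, Matrix.cons_val_one, Matrix.cons_val_fin_one]
  set x : Fin 2 → ℝ := fun i => (Edge.pt e s) i
  set D : Fin 2 → Fin 2 → Fin 2 → ℝ := fun k i j =>
    MvPolynomial.eval x (MvPolynomial.pderiv k (A i j)) with hD
  linear_combination (-(Edge.tau e 0 * (D 0 0 1 - D 1 0 0) + Edge.tau e 1 * (D 0 1 1 - D 1 1 0))) * h

theorem dsPair_comm {A : Matrix (Fin 2) (Fin 2) Poly2} (hA : A.IsSymm) (a b : E2) (e : Edge)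
    (s : ℝ) : dsPair a b A e s = dsPair b a A e s := by
  have : A 1 0 = A 0 1 := hA.apply 0 1
  simp only [dsPair, Fin.sum_univ_two, this]; ring

/-! ### The inverse elasticity tensor -/

theorem compliance_sub (lam mu : ℝ) (A B : M2) :
    compliance lam mu (A - B) = compliance lam mu A - compliance lam mu B := by
  ext i j
  fin_cases i <;> fin_cases j <;> simp [compliance, Matrix.trace, Fin.sum_univ_two] <;> ring

theorem evM_compliance (lam mu : ℝ) (P : Matrix (Fin 2) (Fin 2) Poly2) (x : E2) :
    evM (compliance lam mu P) x = compliance lam mu (evM P x) := by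
  ext i j
  fin_cases i <;> fin_cases j <;>
    simp [compliance, evM, pev, Matrix.trace, Fin.sum_univ_two, MvPolynomial.smul_eval, mul_add]

theorem isSymm_compliance {lam mu : ℝ} {P : Matrix (Fin 2) (Fin 2) Poly2} (hP : P.IsSymm) :
    (compliance lam mu P).IsSymm :=
  (hP.sub ((Matrix.isSymm_one.smul _).smul _)).smul _

theorem totalDegree_compliance_le {lam mu : ℝ} {P : Matrix (Fin 2) (Fin 2) Poly2} {N : ℕ}
    (hP : ∀ i j, (P i j).totalDegree ≤ N) (i j : Fin 2) :
    (compliance lam mu P i j).totalDegree ≤ N := by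
  have htr : (P.trace * (1 : Matrix (Fin 2) (Fin 2) Poly2) i j).totalDegree ≤ N := by
    have h1 : P.trace.totalDegree ≤ N := by
      rw [Matrix.trace, Fin.sum_univ_two]
      exact (MvPolynomial.totalDegree_add _ _).trans (max_le (hP 0 0) (hP 1 1))
    rw [Matrix.one_apply]
    split_ifs
    · rwa [mul_one]
    · simp
  refine (MvPolynomial.totalDegree_smul_le _ _).trans ((MvPolynomial.totalDegree_sub _ _).trans
    (max_le (hP i j) ((MvPolynomial.totalDegree_smul_le _ _).trans htr)))

/-- Subtracting `κ tr(M)` times the identity lowers the squared norm by `2κ(1-κ) tr(M)²`, which is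
nonnegative since `0 ≤ κ ≤ 1` for all `λ`. This makes the constant independent of `λ`. -/
theorem frob_compliance_le {lam mu : ℝ} (hl : 0 < lam) (hm : 0 < mu) (M : M2) :
    frob (compliance lam mu M) ≤ (2 * mu)⁻¹ ^ 2 * frob M := by
  set κ := lam / (2 * (lam + mu)) with hκ
  have h0 : 0 ≤ κ := by positivity
  have h1 : κ ≤ 1 := by rw [hκ, div_le_one (by positivity)]; linarith
  have e : frob (compliance lam mu M) = (2 * mu)⁻¹ ^ 2 *
      (frob M - 2 * κ * (1 - κ) * (M 0 0 + M 1 1) ^ 2) := by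
    simp only [frob, compliance, Fin.sum_univ_two, Matrix.smul_apply, Matrix.sub_apply,
      Matrix.trace, Matrix.diag_apply, Matrix.one_apply, smul_eq_mul, ← hκ]
    simp
    ring
  rw [e]
  refine mul_le_mul_of_nonneg_left ?_ (sq_nonneg _)
  have : 0 ≤ 2 * κ * (1 - κ) * (M 0 0 + M 1 1) ^ 2 :=
    mul_nonneg (mul_nonneg (by linarith) (by linarith)) (sq_nonneg _)
  linarith

/-- The strain errors of all triangles are controlled by the stress error. -/
theorem Mesh.sum_strainError_le {Ω : Set E2} (𝒯 : Mesh Ω) (hL : HasLipschitzBoundary Ω)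
    {lam mu : ℝ} (hl : 0 < lam) (hm : 0 < mu) {σ : E2 → M2} {Du : E2 → M2} {σh : PWMat}
    (hσ : ∀ i j, MemLp (fun x => σ x i j) 2 (volume.restrict Ω))
    (hσh : ∀ i j, MemLp (fun x => 𝒯.matFn σh x i j) 2 (volume.restrict Ω))
    (hDu : ∀ᵐ x ∂(volume.restrict Ω),
      σ x = stiffness lam mu ((1 / 2 : ℝ) • (Du x + (Du x).transpose))) :
    ∑ t ∈ 𝒯.T, strainError (tri t) Du (strain lam mu σh t)
      ≤ ((2 * mu)⁻¹ * 𝒯.stressError σ σh) ^ 2 := by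
  set F : E2 → ℝ := fun x => ∑ i, ∑ j, (σ x i j - 𝒯.matFn σh x i j) ^ 2 with hF
  have hF0 : ∀ x, 0 ≤ F x := fun x =>
    Finset.sum_nonneg fun _ _ => Finset.sum_nonneg fun _ _ => sq_nonneg _
  have hFi : IntegrableOn F Ω := integrable_finsetSum _ fun i _ => integrable_finsetSum _ fun j _ =>
    ((hσ i j).sub (hσh i j)).integrable_sq
  have hE : 𝒯.stressError σ σh ^ 2 = ∫ x in Ω, F x :=
    Real.sq_sqrt (integral_nonneg hF0)
  rw [mul_pow, hE]
  refine le_trans ?_ (mul_le_mul_of_nonneg_left (𝒯.sum_setIntegral_le hL hFi hF0) (sq_nonneg _))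
  rw [Finset.mul_sum]
  refine Finset.sum_le_sum fun t ht => ?_
  rw [strainError, ← setIntegral_congr_set (interior_tri_ae_eq t), ← integral_const_mul]
  have hsub := 𝒯.interior_tri_subset hL ht
  refine integral_mono_of_nonneg (Eventually.of_forall fun x => frob_nonneg _)
    ((hFi.mono_set hsub).const_mul _) ?_
  filter_upwards [ae_restrict_of_ae_restrict_of_subset hsub hDu,
    ae_restrict_mem isOpen_interior.measurableSet] with x hx hxt
  -- Hooke's law inverted: the strain error is the compliance applied to the stress error.
  have e1 : symPart (Du x) = compliance lam mu (σ x) := by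
    rw [hx, compliance_stiffness lam mu hl hm]; rfl
  rw [e1, strain, evM_compliance, ← 𝒯.matFn_eq ht σh hxt, ← compliance_sub]
  exact frob_compliance_le hl hm _

/-! ### Data on Dirichlet edges -/

theorem weakDeriv_spec {h : ℝ} {f : ℝ → ℝ} (hf : MemH1Interval h f) :
    MemLp (weakDeriv h f) 2 (volume.restrict (Ioo 0 h)) ∧ IsWeakDeriv h f (weakDeriv h f) := by
  rw [weakDeriv, dif_pos hf.2]; exact hf.2.choose_spec

theorem TangTest.tsupport_subset_Ioo {h : ℝ} (hh : 0 < h) {α : ℝ → ℝ} (hα : TangTest h α) :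
    tsupport α ⊆ Ioo 0 h :=
  hα.supp.trans (Icc_subset_Ioo (by linarith) (by linarith))

theorem TangTest.memLp {h : ℝ} {α : ℝ → ℝ} (hα : TangTest h α) :
    MemLp α 2 (volume.restrict (Ioo 0 h)) := memLp_Ioo hα.smooth.continuous h

theorem integral_sum_mul {h : ℝ} (c : E2) {f : Fin 2 → ℝ → ℝ} {α : ℝ → ℝ}
    (hf : ∀ i, MemLp (f i) 2 (volume.restrict (Ioo 0 h))) (hα : TangTest h α) :
    ∫ s in Ioo 0 h, (∑ i, c i * f i s) * α s = ∑ i, c i * ∫ s in Ioo 0 h, f i s * α s := by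
  have : ∀ s, (∑ i, c i * f i s) * α s = ∑ i, c i * (f i s * α s) := fun s => by
    rw [Finset.sum_mul]; exact Finset.sum_congr rfl fun i _ => by ring
  simp only [this]
  have hi : ∀ i, Integrable (fun s => c i * (f i s * α s)) (volume.restrict (Ioo 0 h)) :=
    fun i => ((hf i).integrable_mul hα.memLp).const_mul (c i)
  rw [integral_finsetSum _ fun i _ => hi i]
  exact Finset.sum_congr rfl fun i _ => integral_const_mul _ _

section dirichlet

variable {uD : E2 → E2} {e : Edge} {α : ℝ → ℝ}

theorem integral_deriv_data (he : 0 < Edge.len e)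
    (hu : ∀ i, MemH2Interval (Edge.len e) (fun s => uD (Edge.pt e s) i)) (c : E2)
    (hα : TangTest (Edge.len e) α) :
    ∫ s in Ioo 0 (Edge.len e), (∑ i, c i * uD (Edge.pt e s) i) * deriv α s
      = - ∫ s in Ioo 0 (Edge.len e), (∑ i, c i * dsData uD e i s) * α s := by
  have h1 := fun i => weakDeriv_spec (hu i).1
  rw [integral_sum_mul c (f := fun i s => uD (Edge.pt e s) i) (fun i => (hu i).1.1) hα.deriv,
    integral_sum_mul c (f := fun i => dsData uD e i) (fun i => (h1 i).1) hα,
    ← Finset.sum_neg_distrib]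
  refine Finset.sum_congr rfl fun i _ => ?_
  rw [(h1 i).2 α hα.smooth hα.compact (hα.tsupport_subset_Ioo he)]
  simp only [dsData]; ring

theorem integral_deriv_deriv_data (he : 0 < Edge.len e)
    (hu : ∀ i, MemH2Interval (Edge.len e) (fun s => uD (Edge.pt e s) i)) (c : E2)
    (hα : TangTest (Edge.len e) α) :
    ∫ s in Ioo 0 (Edge.len e), (∑ i, c i * uD (Edge.pt e s) i) * deriv (deriv α) s
      = ∫ s in Ioo 0 (Edge.len e), (∑ i, c i * dssData uD e i s) * α s := by
  have h1 := fun i => weakDeriv_spec (hu i).1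
  have h2 := fun i => weakDeriv_spec (hu i).2
  rw [integral_deriv_data he hu c hα.deriv,
    integral_sum_mul c (f := fun i => dsData uD e i) (fun i => (h1 i).1) hα.deriv,
    integral_sum_mul c (f := fun i => dssData uD e i) (fun i => (h2 i).1) hα,
    ← Finset.sum_neg_distrib]
  refine Finset.sum_congr rfl fun i _ => ?_
  have := (h2 i).2 α hα.smooth hα.compact (hα.tsupport_subset_Ioo he)
  simp only [dsData, dssData]
  rw [this]; ring

end dirichlet

/-- Only membership in the polynomials is needed, not orthogonality; it also holds for the default
value 0. -/
theorem exists_edgeProj_eq (m : ℕ) (e : Edge) (w : ℝ → ℝ) :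
    ∃ p : Polynomial ℝ, p.natDegree ≤ m ∧ edgeProj m e w = fun s => p.eval s := by
  rw [edgeProj, l2Proj]
  split_ifs with H
  · exact H.choose_spec.1
  · exact ⟨0, by simp, by funext s; simp⟩

/-! ### Efficiency of the estimator -/

/-- A shape-regular triangulation with symmetric piecewise polynomials `P` to be compared with the
weak gradient `Du`. -/
structure Mesh.StrainData {Ω : Set E2} (𝒯 : Mesh Ω) (m : ℕ) (θ : ℝ) (u : E2 → E2) (Du : E2 → M2)
    (P : PWMat) : Prop where
  lipschitz : HasLipschitzBoundary Ω
  angles : ∀ t ∈ 𝒯.T, AnglesGe θ t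
  weakGrad : ∀ i, IsH1 Ω (fun x => u x i) (fun x => Du x i)
  symm : ∀ t ∈ 𝒯.T, (P t).IsSymm
  degree : ∀ t ∈ 𝒯.T, ∀ i j, (P t i j).totalDegree ≤ m

theorem Mesh.StrainData.memLp {Ω : Set E2} {𝒯 : Mesh Ω} {m : ℕ} {θ : ℝ} {u : E2 → E2}
    {Du : E2 → M2} {P : PWMat} (H : 𝒯.StrainData m θ u Du P) {t : Finset E2} (ht : t ∈ 𝒯.T)
    (i j : Fin 2) : MemLp (fun x => Du x i j) 2 (volume.restrict (tri t)) :=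
  ((H.weakGrad i).2 j).1.mono_measure (Measure.restrict_mono_ae (𝒯.tri_ae_le H.lipschitz ht))

namespace Mesh

variable {Ω : Set E2} (𝒯 : Mesh Ω)

theorem oscVolSq_nonneg (k : ℕ) (f : E2 → E2) : 0 ≤ 𝒯.oscVolSq k f :=
  Finset.sum_nonneg fun _ _ => mul_nonneg (sq_nonneg _)
    (Finset.sum_nonneg fun _ _ => integral_nonneg fun _ => sq_nonneg _)

theorem oscNeuSq_nonneg (ΓD : Set E2) (g gh : E2 → E2) : 0 ≤ 𝒯.oscNeuSq ΓD g gh :=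
  Finset.sum_nonneg fun e _ => mul_nonneg (Edge.len_nonneg e)
    (integral_nonneg fun _ => Finset.sum_nonneg fun _ _ => sq_nonneg _)

theorem oscDirSq_nonneg (m : ℕ) (ΓD : Set E2) (uD : E2 → E2) : 0 ≤ 𝒯.oscDirSq m ΓD uD :=
  Finset.sum_nonneg fun e _ => by
    have := Edge.len_nonneg e
    refine add_nonneg (mul_nonneg this ?_) (mul_nonneg (pow_nonneg this 3) ?_) <;>
      exact integral_nonneg fun _ => sq_nonneg _

end Mesh

/-! ### Summation over triangles and edges -/

theorem exists_volume_const (m : ℕ) {θ : ℝ} (h0 : 0 < θ) (h3 : θ ≤ Real.pi / 3) : ∃ C, 0 < C ∧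
    ∀ {Ω : Set E2} (𝒯 : Mesh Ω) (u : E2 → E2) (Du : E2 → M2) (P : PWMat),
    𝒯.StrainData m θ u Du P →
    ∑ t ∈ 𝒯.T, triDiam t ^ 4 * ∫ x in tri t, pev (rot (rowRot (P t))) x ^ 2
      ≤ C * ∑ t ∈ 𝒯.T, strainError (tri t) Du (P t) := by
  obtain ⟨δ, R, hδ, hR, hfit⟩ := exists_fits h0 h3
  obtain ⟨C, hC, hloc⟩ := exists_local_const m δ R
  refine ⟨R ^ 4 * C, by positivity, fun 𝒯 u Du P H => ?_⟩
  rw [Finset.mul_sum]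
  refine Finset.sum_le_sum fun t ht => ?_
  obtain ⟨e, he⟩ := exists_liesLeft (𝒯.card_eq t ht) (𝒯.nondegenerate t ht)
  obtain ⟨F, hd⟩ := (hfit t e (𝒯.card_eq t ht) (H.angles t ht)).1 he
  obtain ⟨hv, -⟩ := hloc _ _ _ _ _ (P t) Du F (H.symm t ht) (H.degree t ht) (H.memLp ht)
    fun i j => F.integral_ccPair_bub (𝒯.interior_tri_subset H.lipschitz ht) H.weakGrad i j
  have hI : 0 ≤ ∫ x in tri t, pev (rot (rowRot (P t))) x ^ 2 :=
    integral_nonneg fun _ => sq_nonneg _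
  calc triDiam t ^ 4 * ∫ x in tri t, pev (rot (rowRot (P t))) x ^ 2
      ≤ (R * Edge.len e) ^ 4 * ∫ x in tri t, pev (rot (rowRot (P t))) x ^ 2 := by
        refine mul_le_mul_of_nonneg_right (pow_le_pow_left₀ Metric.diam_nonneg hd 4) hI
    _ = R ^ 4 * (Edge.len e ^ 4 * ∫ x in tri t, pev (rot (rowRot (P t))) x ^ 2) := by ring
    _ ≤ R ^ 4 * (C * strainError (tri t) Du (P t)) :=
        mul_le_mul_of_nonneg_left hv (by positivity)
    _ = _ := by ring

theorem exists_interior_sum_const (m : ℕ) {θ : ℝ} (h0 : 0 < θ) (h3 : θ ≤ Real.pi / 3) :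
    ∃ C, 0 < C ∧ ∀ {Ω : Set E2} (𝒯 : Mesh Ω) (u : E2 → E2) (Du : E2 → M2) (P : PWMat),
    𝒯.StrainData m θ u Du P →
    ∑ e ∈ 𝒯.interiorEdges,
      (Edge.len e * (Edge.integral e fun s => tanTan (𝒯.jump P e) e s ^ 2)
      + Edge.len e ^ 3 * (Edge.integral e fun s => (tanRot (𝒯.jump P e) e s
          - dsPair (Edge.tau e) (Edge.nu e) (𝒯.jump P e) e s) ^ 2))
      ≤ C * ∑ t ∈ 𝒯.T, strainError (tri t) Du (P t) := by
  obtain ⟨δ, R, hδ, hR, hfit⟩ := exists_fits h0 h3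
  obtain ⟨C, hC, hInt⟩ := exists_interior_const m R hδ
  -- Two terms per edge, two adjacent triangles, at most nine vertex pairs per triangle.
  refine ⟨36 * C, by positivity, fun 𝒯 u Du P H => ?_⟩
  set A : Finset E2 → ℝ := fun t => strainError (tri t) Du (P t)
  have hA : ∀ t, 0 ≤ A t := fun t => strainError_nonneg _ _ _
  have hsum1 := 𝒯.sum_edges_le (F := 𝒯.interiorEdges) (ℓ := 𝒯.left) hA fun e he =>
    ⟨(𝒯.left_spec_interior he).1.1, (𝒯.left_spec_interior he).1.2.1,
      (𝒯.left_spec_interior he).1.2.2.1⟩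
  have hsum2 := 𝒯.sum_edges_le (F := 𝒯.interiorEdges) (ℓ := fun e => 𝒯.left e.swap) hA
    fun e he => ⟨(𝒯.left_spec_interior he).2.1, (𝒯.left_spec_interior he).2.2.2.1,
      (𝒯.left_spec_interior he).2.2.1⟩
  have hedge : ∀ e ∈ 𝒯.interiorEdges,
      Edge.len e * (Edge.integral e fun s => tanTan (𝒯.jump P e) e s ^ 2)
      + Edge.len e ^ 3 * (Edge.integral e fun s => (tanRot (𝒯.jump P e) e s
          - dsPair (Edge.tau e) (Edge.nu e) (𝒯.jump P e) e s) ^ 2)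
      ≤ 2 * C * (A (𝒯.left e) + A (𝒯.left e.swap)) := by
    intro e he
    obtain ⟨⟨ht, hl⟩, ht', hl'⟩ := 𝒯.left_spec_interior he
    have F := ((hfit _ e (𝒯.card_eq _ ht) (H.angles _ ht)).1 hl).1
    have F' := (hfit _ e (𝒯.card_eq _ ht') (H.angles _ ht')).2 hl'
    rw [← neg_neg (Edge.nu e)] at F'
    have hne : 𝒯.left e ≠ 𝒯.left e.swap := fun h => F.ne_of_neg F' (by rw [h])
    obtain ⟨b1, b2⟩ := hInt _ _ _ _ _ _ (P (𝒯.left e)) (P (𝒯.left e.swap)) Du F F'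
      (H.symm _ ht) (H.symm _ ht') (H.degree _ ht) (H.degree _ ht') (H.memLp ht) (H.memLp ht')
      (F.integral_ccPair_bub (𝒯.interior_tri_subset H.lipschitz ht) H.weakGrad)
      (F'.integral_ccPair_bub (𝒯.interior_tri_subset H.lipschitz ht') H.weakGrad)
      (F.integral_ccPair_prof F' (𝒯.interior_union_subset H.lipschitz ht ht')
        (𝒯.aedisjoint_tri ht ht' hne) (H.memLp ht) (H.memLp ht') H.weakGrad)
    have e1 : (Edge.integral e fun s => tanTan (𝒯.jump P e) e s ^ 2)
        = ∫ s in Ioo 0 (Edge.len e), pev (pquad (Edge.tau e) (Edge.tau e)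
          (P (𝒯.left e) - P (𝒯.left e.swap))) (e.1 + s • Edge.tau e) ^ 2 := by
      simp only [Edge.integral, tanTan_eq]; rfl
    have e2 : (Edge.integral e fun s => (tanRot (𝒯.jump P e) e s
          - dsPair (Edge.tau e) (Edge.nu e) (𝒯.jump P e) e s) ^ 2)
        = ∫ s in Ioo 0 (Edge.len e), edgeFlux (Edge.tau e) (-Edge.nu e)
          (P (𝒯.left e) - P (𝒯.left e.swap)) (e.1 + s • Edge.tau e) ^ 2 := by
      simp only [Edge.integral, tanRot_sub_dsPair F.len_pos, neg_sq]; rfl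
    rw [e1, e2]
    linarith
  refine (Finset.sum_le_sum hedge).trans ?_
  rw [← Finset.mul_sum, Finset.sum_add_distrib]
  nlinarith

theorem exists_dirichlet_sum_const (m : ℕ) {θ : ℝ} (h0 : 0 < θ) (h3 : θ ≤ Real.pi / 3) :
    ∃ C, 0 < C ∧ ∀ {Ω : Set E2} (𝒯 : Mesh Ω) (u : E2 → E2) (Du : E2 → M2) (P : PWMat)
      (ΓD : Set E2) (uD : E2 → E2),
    𝒯.StrainData m θ u Du P → IsOpen Ω → IsCompact ΓD →
    (∀ i, HasTrace Ω ΓD (fun x => u x i) (fun x => uD x i)) →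
    (∀ e ∈ 𝒯.dirichletEdges ΓD, ∀ i,
      MemH2Interval (Edge.len e) (fun s => uD (Edge.pt e s) i)) →
    ∑ e ∈ 𝒯.dirichletEdges ΓD,
      (Edge.len e * (Edge.integral e fun s =>
          (tanTan (P (𝒯.left e)) e s - dsTan uD e s) ^ 2)
      + Edge.len e ^ 3 * (Edge.integral e fun s => (tanRot (P (𝒯.left e)) e s
          - (dsPair (Edge.nu e) (Edge.tau e) (P (𝒯.left e)) e s - dssNor uD e s)) ^ 2))
      ≤ C * (∑ t ∈ 𝒯.T, strainError (tri t) Du (P t) + 𝒯.oscDirSq m ΓD uD) := by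
  obtain ⟨δ, R, hδ, hR, hfit⟩ := exists_fits h0 h3
  obtain ⟨C, hC, hdir⟩ := exists_dirichlet_const m R hδ
  refine ⟨18 * C, by positivity, fun {Ω} 𝒯 u Du P ΓD uD H hΩ hΓ htr hH2 => ?_⟩
  set A : Finset E2 → ℝ := fun t => strainError (tri t) Du (P t)
  have hA : ∀ t, 0 ≤ A t := fun t => strainError_nonneg _ _ _
  have hsum := 𝒯.sum_edges_le (F := 𝒯.dirichletEdges ΓD) (ℓ := 𝒯.left) hA fun e he =>
    ⟨(𝒯.left_spec_dirichlet he).1, (𝒯.left_spec_dirichlet he).2.1.1,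
      (𝒯.left_spec_dirichlet he).2.1.2.1⟩
  have hedge : ∀ e ∈ 𝒯.dirichletEdges ΓD,
      Edge.len e * (Edge.integral e fun s =>
          (tanTan (P (𝒯.left e)) e s - dsTan uD e s) ^ 2)
      + Edge.len e ^ 3 * (Edge.integral e fun s => (tanRot (P (𝒯.left e)) e s
          - (dsPair (Edge.nu e) (Edge.tau e) (P (𝒯.left e)) e s - dssNor uD e s)) ^ 2)
      ≤ C * (2 * A (𝒯.left e) + (Edge.len e *
          (Edge.integral e fun s => (dsTan uD e s - edgeProj m e (dsTan uD e) s) ^ 2)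
        + Edge.len e ^ 3 *
          (Edge.integral e fun s => (dssNor uD e s - edgeProj m e (dssNor uD e) s) ^ 2))) := by
    intro e he
    obtain ⟨ht, hl, hseg⟩ := 𝒯.left_spec_dirichlet he
    have F := ((hfit _ e (𝒯.card_eq _ ht) (H.angles _ ht)).1 hl).1
    have hh := F.len_pos
    have hu := hH2 e he
    have hds : ∀ i, MemLp (dsData uD e i) 2 (volume.restrict (Ioo 0 (Edge.len e))) :=
      fun i => (weakDeriv_spec (hu i).1).1
    have hdss : ∀ i, MemLp (dssData uD e i) 2 (volume.restrict (Ioo 0 (Edge.len e))) :=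
      fun i => (weakDeriv_spec (hu i).2).1
    have hd1 : MemLp (dsTan uD e) 2 (volume.restrict (Ioo 0 (Edge.len e))) :=
      memLp_finsetSum _ fun i _ => (hds i).const_mul _
    have hd2 : MemLp (dssNor uD e) 2 (volume.restrict (Ioo 0 (Edge.len e))) :=
      memLp_finsetSum _ fun i _ => (hdss i).const_mul _
    obtain ⟨p₁, hp₁, hpe₁⟩ := exists_edgeProj_eq m e (dsTan uD e)
    obtain ⟨p₂, hp₂, hpe₂⟩ := exists_edgeProj_eq m e (dssNor uD e)
    have hpt : ∀ s ∈ Ioo 0 (Edge.len e), e.1 + s • Edge.tau e ∈ ΓD := by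
      intro s hs
      refine hseg ⟨1 - s / Edge.len e, s / Edge.len e, ?_, by have := hs.1; positivity, by ring, ?_⟩
      · rw [sub_nonneg, div_le_one hh]; exact hs.2.le
      · ext i
        simp only [Edge.tau, PiLp.add_apply, PiLp.smul_apply, PiLp.sub_apply, smul_eq_mul]
        ring
    -- The frame uses the inward normal `-ν`, so the second derivative of the normal data and its
    -- projection enter with a minus sign.
    obtain ⟨b1, b2⟩ := hdir _ _ _ _ _ (P (𝒯.left e)) Du (dsTan uD e) (-dssNor uD e) p₁ (-p₂) F
      (H.symm _ ht) (H.degree _ ht) (H.memLp ht)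
      (F.integral_ccPair_bub (𝒯.interior_tri_subset H.lipschitz ht) H.weakGrad) hd1 hd2.neg hp₁
      (by rwa [Polynomial.natDegree_neg]) fun i l => by
        have hα := (tangTest_bub i).rescale hh
        have hβ := (normTest_prof l).rescale (mul_pos hδ hh)
        rw [F.integral_ccPair_of_hasTrace hΩ (𝒯.tri_ae_le H.lipschitz ht) hΓ hpt H.weakGrad htr
          hα hβ]
        have i1 := integral_deriv_data hh hu (Edge.tau e) hα
        have i2 := integral_deriv_deriv_data hh hu (-Edge.nu e) hα
        simp only [Edge.pt] at i1 i2
        rw [i1, i2, deriv_rescale]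
        have e3 : ∀ s, (-dssNor uD e) s = ∑ i, (-Edge.nu e) i * dssData uD e i s := fun s => by
          simp [dssNor, Fin.sum_univ_two]
        simp only [e3, dsTan, rescale, zero_mul]
        ring
    have e1 : (Edge.integral e fun s => (tanTan (P (𝒯.left e)) e s - dsTan uD e s) ^ 2)
        = ∫ s in Ioo 0 (Edge.len e), (pev (pquad (Edge.tau e) (Edge.tau e)
          (P (𝒯.left e))) (e.1 + s • Edge.tau e) - dsTan uD e s) ^ 2 := by
      simp only [Edge.integral, tanTan_eq]; rfl
    have e2 : (Edge.integral e fun s => (tanRot (P (𝒯.left e)) e s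
          - (dsPair (Edge.nu e) (Edge.tau e) (P (𝒯.left e)) e s - dssNor uD e s)) ^ 2)
        = ∫ s in Ioo 0 (Edge.len e), (edgeFlux (Edge.tau e) (-Edge.nu e)
          (P (𝒯.left e)) (e.1 + s • Edge.tau e) + (-dssNor uD e) s) ^ 2 := by
      have : ∀ s, tanRot (P (𝒯.left e)) e s
          - (dsPair (Edge.nu e) (Edge.tau e) (P (𝒯.left e)) e s - dssNor uD e s)
          = -(edgeFlux (Edge.tau e) (-Edge.nu e) (P (𝒯.left e)) (e.1 + s • Edge.tau e)
            + (-dssNor uD e) s) := fun s => by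
        have := tanRot_sub_dsPair hh (P (𝒯.left e)) s
        rw [Edge.pt] at this
        rw [dsPair_comm (H.symm _ ht), Pi.neg_apply]
        linarith
      simp only [Edge.integral, this, neg_sq]
    have e3 : ∀ s, ((-dssNor uD e) s - (-p₂).eval s) ^ 2 = (dssNor uD e s - p₂.eval s) ^ 2 :=
      fun s => by rw [Pi.neg_apply, Polynomial.eval_neg]; ring
    simp only [e3] at b2
    rw [e1, e2, hpe₁, hpe₂]
    simp only [Edge.integral]
    linarith
  refine (Finset.sum_le_sum hedge).trans ?_
  rw [← Finset.mul_sum, Finset.sum_add_distrib, ← Finset.mul_sum, mul_comm 18 C, mul_assoc]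
  refine mul_le_mul_of_nonneg_left ?_ hC.le
  change _ + 𝒯.oscDirSq m ΓD uD ≤ _
  have hosc := 𝒯.oscDirSq_nonneg m ΓD uD
  linarith

/-- The square of a sum of nonnegative numbers dominates the sum of their squares. -/
theorem sqrt_le_of_le {C x a b c y : ℝ} (hC : 0 < C) (hx : 0 ≤ x) (ha : 0 ≤ a) (hb : 0 ≤ b)
    (hc : 0 ≤ c) (h : y ≤ C ^ 2 * (x ^ 2 + a + b + c)) :
    C⁻¹ * √y ≤ x + √a + √b + √c := by
  rw [inv_mul_le_iff₀ hC]
  refine Real.sqrt_le_iff.2 ⟨by positivity, h.trans ?_⟩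
  rw [mul_pow]
  refine mul_le_mul_of_nonneg_left ?_ (sq_nonneg C)
  have h1 := Real.sq_sqrt ha
  have h2 := Real.sq_sqrt hb
  have h3 := Real.sq_sqrt hc
  have p1 := Real.sqrt_nonneg a
  have p2 := Real.sqrt_nonneg b
  have p3 := Real.sqrt_nonneg c
  nlinarith [mul_nonneg hx p1, mul_nonneg hx p2, mul_nonneg hx p3, mul_nonneg p1 p2,
    mul_nonneg p1 p3, mul_nonneg p2 p3]

end AW

end
-- The efficiency theorem
theorem theorem1p2 (k m : ℕ) (hk : 1 ≤ k) (hm : k + 2 ≤ m) (θ₀ : ℝ) (hθ₀ : 0 < θ₀) :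
    ∃ Ceff : ℝ, 0 < Ceff ∧
    ∀ (Ω ΓD : Set AW.E2), AW.IsElasticBody Ω →
      IsCompact ΓD → ΓD ⊆ frontier Ω →
      0 < AW.arcMeasure ΓD Set.univ → 0 < AW.arcMeasure (AW.neumannBdry Ω ΓD) Set.univ →
    -- the data and the exact solution
    ∀ (lam mu : ℝ), 0 < lam → 0 < mu →
    ∀ (uD f g u : AW.E2 → AW.E2) (σ : AW.E2 → AW.M2),
      (∀ i, AW.HasTrace Ω ΓD (fun x => uD x i) (fun x => uD x i)) →
      ContinuousOn uD ΓD →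
      MemLp f 2 (volume.restrict Ω) →
      MemLp g 2 (AW.arcMeasure (AW.neumannBdry Ω ΓD)) →
      AW.IsSolution Ω ΓD lam mu uD f g u σ →
    -- the triangulation and the discrete solution
    ∀ (𝒯 : AW.Mesh Ω), 𝒯.Compatible ΓD → 𝒯.MinAngle θ₀ →
      (∀ e ∈ 𝒯.dirichletEdges ΓD, ∀ i,
        AW.MemH2Interval (AW.Edge.len e) (fun s => uD (AW.Edge.pt e s) i)) →
    ∀ (gh : AW.E2 → AW.E2) (σh : AW.PWMat) (uh : AW.PWVec),
      𝒯.MemG k ΓD gh →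
      (∀ e ∈ 𝒯.neumannEdges ΓD, ∀ i,
        AW.Edge.integral e (fun s => g (AW.Edge.pt e s) i - gh (AW.Edge.pt e s) i) = 0) →
      𝒯.IsDiscreteSolution k ΓD lam mu uD f gh σh uh →
      Ceff⁻¹ * √(𝒯.etaSq k ΓD lam mu uD f g gh σh)
          ≤ (2 * mu)⁻¹ * 𝒯.stressError σ σh
            + √(𝒯.oscVolSq k f) + √(𝒯.oscNeuSq ΓD g gh) + √(𝒯.oscDirSq m ΓD uD) ∧
      (Ceff * max 1 (2 * mu)⁻¹)⁻¹ * √(𝒯.etaSq k ΓD lam mu uD f g gh σh)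
          ≤ 𝒯.stressError σ σh
            + √(𝒯.oscVolSq k f) + √(𝒯.oscNeuSq ΓD g gh) + √(𝒯.oscDirSq m ΓD uD) := by
  -- Lowering the angle bound weakens the condition on the mesh and guarantees a positive sine.
  have hθ : 0 < min θ₀ (Real.pi / 3) := lt_min hθ₀ (by positivity)
  obtain ⟨A, hA, hvol⟩ := AW.exists_volume_const m hθ (min_le_right _ _)
  obtain ⟨B, hB, hInt⟩ := AW.exists_interior_sum_const m hθ (min_le_right _ _)
  obtain ⟨D, hD, hdir⟩ := AW.exists_dirichlet_sum_const m hθ (min_le_right _ _)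
  set C := 1 + A + B + D with hC
  have hC1 : 1 ≤ C := by linarith
  refine ⟨C, by linarith, fun Ω ΓD hΩ hΓ _ _ _ lam mu hl hmu uD f g u σ _ _ _ _ hsol 𝒯 _ hang hH2
    gh σh uh _ _ hdisc => ?_⟩
  obtain ⟨⟨Du, hu, hσ⟩, htr, hdiv, -⟩ := hsol
  obtain ⟨⟨hAW, hAWdiv⟩, -⟩ := hdisc
  have hdata : 𝒯.StrainData m (min θ₀ (Real.pi / 3)) u Du (AW.strain lam mu σh) :=
    { lipschitz := hΩ.lipschitz
      angles := fun t ht a ha b hb c hc h1 h2 h3 =>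
        (min_le_left _ _).trans (hang t ht a ha b hb c hc h1 h2 h3)
      weakGrad := hu
      symm := fun t ht => AW.isSymm_compliance (hAW t ht).1
      -- Here `k + 2 ≤ m` lets one degree `m` serve both for `ε_h` and for the projected Dirichlet
      -- data.
      degree := fun t ht => AW.totalDegree_compliance_le fun i j =>
        ((hAW t ht).2.1 i j).trans hm }
  have h1 := hvol 𝒯 u Du _ hdata
  have h2 := hInt 𝒯 u Du _ hdata
  have h3 := hdir 𝒯 u Du _ ΓD uD hdata hΩ.isOpen hΓ htr hH2
  have hE := 𝒯.sum_strainError_le hΩ.lipschitz hl hmu hdiv.1 hAWdiv.1 hσ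
  set E := ∑ t ∈ 𝒯.T, AW.strainError (AW.tri t) Du (AW.strain lam mu σh t)
  set X := (2 * mu)⁻¹ * 𝒯.stressError σ σh with hX
  have hE0 : 0 ≤ E := Finset.sum_nonneg fun t _ => AW.strainError_nonneg _ _ _
  have herr : 0 ≤ 𝒯.stressError σ σh := Real.sqrt_nonneg _
  have hX0 : 0 ≤ X := by positivity
  have hV := 𝒯.oscVolSq_nonneg k f
  have hN := 𝒯.oscNeuSq_nonneg ΓD g gh
  have hO := 𝒯.oscDirSq_nonneg m ΓD uD
  have hη : 𝒯.etaSq k ΓD lam mu uD f g gh σh ≤ C ^ 2 *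
      (X ^ 2 + 𝒯.oscVolSq k f + 𝒯.oscNeuSq ΓD g gh + 𝒯.oscDirSq m ΓD uD) := by
    have hη1 : 𝒯.etaSq k ΓD lam mu uD f g gh σh ≤ A * E + 𝒯.oscVolSq k f + 𝒯.oscNeuSq ΓD g gh
        + B * E + D * (E + 𝒯.oscDirSq m ΓD uD) :=
      add_le_add (add_le_add (add_le_add_left (add_le_add_left h1 _) _) h2) h3
    have hη2 : A * E + 𝒯.oscVolSq k f + 𝒯.oscNeuSq ΓD g gh
        + B * E + D * (E + 𝒯.oscDirSq m ΓD uD)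
        ≤ C * (E + 𝒯.oscVolSq k f + 𝒯.oscNeuSq ΓD g gh + 𝒯.oscDirSq m ΓD uD) := by
      rw [hC]
      linarith [mul_nonneg hA.le hV, mul_nonneg hB.le hV, mul_nonneg hD.le hV,
        mul_nonneg hA.le hN, mul_nonneg hB.le hN, mul_nonneg hD.le hN,
        mul_nonneg hA.le hO, mul_nonneg hB.le hO]
    refine hη1.trans (hη2.trans ?_)
    -- `C ≤ C²` because of the summand 1 in `C`.
    refine mul_le_mul (by nlinarith) (by linarith) (by positivity) (by positivity)
  have hmain := AW.sqrt_le_of_le (by linarith) hX0 hV hN hO hη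
  refine ⟨hmain, ?_⟩
  set M := max 1 (2 * mu)⁻¹ with hM
  have hM1 : 1 ≤ M := le_max_left _ _
  have hXM : X ≤ M * 𝒯.stressError σ σh := mul_le_mul_of_nonneg_right (le_max_right _ _) herr
  rw [mul_inv, mul_comm C⁻¹, mul_assoc, inv_mul_le_iff₀ (by linarith)]
  refine hmain.trans ?_
  have hS : ∀ x, √x ≤ M * √x := fun x => le_mul_of_one_le_left (Real.sqrt_nonneg x) hM1
  linarith [hS (𝒯.oscVolSq k f), hS (𝒯.oscNeuSq ΓD g gh), hS (𝒯.oscDirSq m ΓD uD)]
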